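/- **Setting.** Let $E,V,H$ be separable real Banach spaces with continuous embeddings $E\subset V\subset H$; write $\|\cdot\|$ for the norm of $V$. For $T\ge 0$ let $X_T=C([0,T];V)\cap L^2(0,T;E)$ with $|u|_{X_T}^2=\sup_{s\le T}\|u(s)\|^2+\int_0^T|u(s)|_E^2\,ds$. Let $(\Omega,\mathcal F,\mathbb P)$ be a complete probability space with a filtration $(\mathcal F_t)_{t\ge0}$ satisfying the usual conditions, and let $W$ be a one-dimensional $(\mathcal F_t)$-Wiener process. Let $M^2(0,T;V)$ be the progressively measurable $V$-valued processes $\xi$ with $|\xi|^2_{M^2(0,T;V)}=\mathbb E\int_0^T\|\xi\|^2ds<\infty$, and $M^2(X_T)$ the progressively measurable processes with paths a.s. in $X_T$ and $|u|^2_{M^2(X_T)}=\mathbb E|u|_{X_T}^2<\infty$. *Nonlinearities.* $F:E\to H$ satisfies $F(0)=0$ and, for some $p\ge1$, $\alpha\in[0,1)$, $C>0$ and all $x,y\in E$, $$|F(y)-F(x)|_H\le C\big[\|y-x\|\,\|y\|^{p-\alpha}|y|_E^{\alpha}+|y-x|_E^{\alpha}\|y-x\|^{1-\alpha}\|x\|^{p}\big];$$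 $G:E\to V$ satisfies $G(0)=0$ and the same condition in the norm of $V$, with some $k\ge1$, $\beta\in[0,1)$, $C_G>0$ in place of $p,\alpha,C$. *Semigroup.* $S(t)$, $t\ge0$, is a semigroup of bounded linear operators on $H$ ($S(0)=I$, $S(s+t)=S(s)S(t)$), and there are $C_1,C_2>0$ such that for every $T>0$: (i) for $f\in L^2(0,T;H)$, $(S*f)(t)=\int_0^tS(t-r)f(r)\,dr$ exists for $t\le T$, $S*f\in X_T$ and $|S*f|_{X_T}\le C_1|f|_{L^2(0,T;H)}$; (ii) for $\xi\in M^2(0,T;V)$, the Itô integral $(S\diamond\xi)(t)=\int_0^tS(t-r)\xi(r)\,dW(r)$ exists in $H$ for $t\le T$, has a version in $M^2(X_T)$, and $|S\diamond\xi|_{M^2(X_T)}\le C_2|\xi|_{M^2(0,T;V)}$; (iii) for $v\in V$, $Sv\in X_T$, and for every $T_0>0$ there is $C_0>0$ with $|Sv|_{X_T}\le C_0\|v\|$ for all $T\in(0,T_0]$, $v\in V$. The $H$-valued Itô integral of a measurable process is the limit in probability of the integrals of bounded simple adapted processes that approximate it in $L^2(0,\infty;H)$ in probability. *Solutions.* Let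 $u_0\in L^2(\Omega,\mathcal F_0,\mathbb P;V)$. A stopping time $\tau$ is accessible if there are stopping times $\rho_n$ increasing to $\tau$ with $\rho_n<\tau$, a.s. A process $u:[0,\tau)\times\Omega\to V$ is admissible if $u(t)|_{\{t<\tau\}}$ is $\mathcal F_t$-measurable for all $t\geq 0$ and its paths are a.s. continuous on $[0,\tau)$. A local mild solution of $du=(Au+F(u))\,dt+G(u)\,dW$, $u(0)=u_0$ (where $A$ stands for the generator of $S$), is a pair $(u,\tau)$ with $\tau$ accessible and $u$ admissible on $[0,\tau)$ for which there are finite stopping times $\sigma_m$, a.s. with $\sigma_m<\tau$ and $\sigma_m\uparrow\tau$, such that for all $m$ and $t\ge0$, $\mathbb E|u|^2_{X_{t\wedge\sigma_m}}<\infty$ and, a.s., $$u(t\wedge\sigma_m)=S(t\wedge\sigma_m)u_0+\int_0^{t\wedge\sigma_m}S(t\wedge\sigma_m-s)F(u(s))\,ds+J_m(t\wedge\sigma_m),$$ where $J_m$ is a continuous $V$-valued version of $S\diamond(1_{[0,\sigma_m)}G(u))$. Write $(u,\tau)\preceq(v,\sigma)$ if $\tau\le\sigma$ a.s. and a.s.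 $u=v$ on $[0,\tau)$, and $(u,\tau)\sim(v,\sigma)$ if moreover $\tau=\sigma$ a.s. A maximal local mild solution is a local mild solution $(u,\tau)$ such that every local mild solution $(v,\sigma)\succeq(u,\tau)$ satisfies $(v,\sigma)\sim(u,\tau)$. *Truncation.* Let $\theta:[0,\infty)\to[0,1]$ be $C^\infty$ and nonincreasing, with $\theta(x)=1$ iff $x\le1$ and $\theta(x)=0$ iff $x\ge2$. **Theorem 3.2.** For every integer $n\ge1$ the truncated equation $$u^n(t)=S(t)u_0+\int_0^tS(t-r)\,\theta\big(|u^n|_{X_r}/n\big)F(u^n(r))\,dr+\int_0^tS(t-r)\,\theta\big(|u^n|_{X_r}/n\big)G(u^n(r))\,dW(r),\quad t\ge0,$$ has a solution $u^n$ with $u^n\in M^2(X_T)$ for all $T$, unique up to indistinguishability. With $\tau_n=\inf\{t\ge0:|u^n|_{X_t}\ge n\}$, a.s. the sequence $(\tau_n)$ is nondecreasing, and there is a process $u$ on $[0,\tau_\infty)$, $\tau_\infty=\lim_n\tau_n$, such that a.s. $u=u^n$ on $[0,\tau_n)$ for every $n$. For this process, $(u,\tau_\infty)$ is a maximal local mild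 solution; it is unique, that is, every local mild solution $(v,\sigma)$ satisfies a.s. $v=u$ on $[0,\tau_\infty\wedge\sigma)$, and every maximal local mild solution is equivalent to $(u,\tau_\infty)$. Moreover $$\mathbb P\Big(\{\tau_\infty<\infty\}\cap\big\{\sup_{t<\tau_\infty}\|u(t)\|<\infty\big\}\Big)=0,$$ and a.s. on $\{\tau_\infty<\infty\}$, $\limsup_{t\uparrow\tau_\infty}\|u(t)\|=\infty$. -/

import Mathlib

open MeasureTheory ProbabilityTheory Filter Topology
open scoped NNReal ENNReal

namespace StochEvol

/-! ### The spaces `X_T`, `M²(X_T)` and the nonlinearities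

Time is `ℝ≥0` with Lebesgue measure `leb`; `Set.Iic T` is the interval `[0, T]`.
The continuous embedding `E ⊂ V` is an injective continuous linear map `j : E →L[ℝ] V`, and
`V ⊂ H` an injective continuous linear map `k : V →L[ℝ] H`. Paths of processes live in `V`. -/

/-- Lebesgue measure on `[0, ∞)`. -/
noncomputable def leb : Measure ℝ≥0 := Measure.comap ((↑) : ℝ≥0 → ℝ) volume

section Spaces

variable {E V H X Ω : Type*}
  [NormedAddCommGroup E] [NormedSpace ℝ E] [NormedAddCommGroup V] [NormedSpace ℝ V]
  [NormedAddCommGroup H] [NormedSpace ℝ H] [NormedAddCommGroup X]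

/-- The norm of `E` as an extended-valued function on `V`, equal to `∞` outside `E`. -/
noncomputable def eNormE (j : E →L[ℝ] V) (v : V) : ℝ≥0∞ :=
  Function.extend j (fun e => ‖e‖ₑ) (fun _ => ⊤) v

/-- A map on `E`, read on `V`: its value at `v` is `Φ e` if `v = j e`, and `0` if `v ∉ E`. (Paths
of finite `X_T`-norm are in `E` at almost every time.) -/
noncomputable def onV (j : E →L[ℝ] V) (Φ : E → X) (v : V) : X :=
  Function.extend j Φ (fun _ => 0) v

/-- `|w|_{X_T} = (sup_{s ≤ T} ‖w s‖_V² + ∫_0^T |w s|_E² ds)^{1/2}`, with values in `[0, ∞]`. -/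
noncomputable def xNorm (j : E →L[ℝ] V) (w : ℝ≥0 → V) (T : ℝ≥0) : ℝ≥0∞ :=
  ((⨆ s ∈ Set.Iic T, ‖w s‖ₑ ^ 2) + ∫⁻ s in Set.Iic T, eNormE j (w s) ^ 2 ∂leb) ^ (1 / 2 : ℝ)

/-- `w` restricted to `[0, T]` belongs to `X_T = C([0, T]; V) ∩ L²(0, T; E)`. -/
def MemX (j : E →L[ℝ] V) (w : ℝ≥0 → V) (T : ℝ≥0) : Prop :=
  ContinuousOn w (Set.Iic T) ∧ xNorm j w T < ⊤

/-- The local Lipschitz condition with polynomial growth imposed on `F : E → H` and on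
`G : E → V`. -/
def PolyLocallyLipschitz (j : E →L[ℝ] V) (Φ : E → X) : Prop :=
  Φ 0 = 0 ∧ ∃ p α C : ℝ, 1 ≤ p ∧ 0 ≤ α ∧ α < 1 ∧ 0 < C ∧ ∀ x y : E,
    ‖Φ y - Φ x‖ ≤ C * (‖j (y - x)‖ * ‖j y‖ ^ (p - α) * ‖y‖ ^ α
      + ‖y - x‖ ^ α * ‖j (y - x)‖ ^ (1 - α) * ‖j x‖ ^ p)

/-- The cutoff function: smooth and nonincreasing on `[0, ∞)`, with values in `[0, 1]`,
equal to `1` exactly on `[0, 1]` and to `0` exactly on `[2, ∞)`. -/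
structure IsCutoff (θ : ℝ → ℝ) : Prop where
  smooth : ContDiffOn ℝ (⊤ : ℕ∞) θ (Set.Ici 0)
  antitone : AntitoneOn θ (Set.Ici 0)
  mem_Icc : ∀ x, 0 ≤ x → θ x ∈ Set.Icc (0 : ℝ) 1
  eq_one_iff : ∀ x, 0 ≤ x → (θ x = 1 ↔ x ≤ 1)
  eq_zero_iff : ∀ x, 0 ≤ x → (θ x = 0 ↔ 2 ≤ x)

variable {mΩ : MeasurableSpace Ω}

/-- The norm of `M²(X_T)`: `(𝔼 |u|_{X_T}²)^{1/2}`. -/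
noncomputable def m2xNorm (j : E →L[ℝ] V) (P : Measure Ω) (u : ℝ≥0 → Ω → V) (T : ℝ≥0) : ℝ≥0∞ :=
  (∫⁻ ω, xNorm j (fun s => u s ω) T ^ 2 ∂P) ^ (1 / 2 : ℝ)

/-- `u` restricted to `[0, T]` belongs to `M²(X_T)`. -/
def MemM2X (j : E →L[ℝ] V) (𝓕 : Filtration ℝ≥0 mΩ) (P : Measure Ω)
    (u : ℝ≥0 → Ω → V) (T : ℝ≥0) : Prop :=
  IsStronglyProgressive 𝓕 u ∧ (∀ᵐ ω ∂P, MemX j (fun s => u s ω) T) ∧ m2xNorm j P u T < ⊤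

/-- The norm of `M²(0, T; X)`: `(𝔼 ∫_0^T ‖ξ s‖² ds)^{1/2}`. -/
noncomputable def m2Norm (P : Measure Ω) (ξ : ℝ≥0 → Ω → X) (T : ℝ≥0) : ℝ≥0∞ :=
  (∫⁻ ω, ∫⁻ s in Set.Iic T, ‖ξ s ω‖ₑ ^ 2 ∂leb ∂P) ^ (1 / 2 : ℝ)

/-- `ξ` restricted to `[0, T]` belongs to `M²(0, T; X)`. -/
def MemM2 (𝓕 : Filtration ℝ≥0 mΩ) (P : Measure Ω) (ξ : ℝ≥0 → Ω → X) (T : ℝ≥0) : Prop :=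
  IsStronglyProgressive 𝓕 ξ ∧ m2Norm P ξ T < ⊤

end Spaces

/-! ### Filtrations, the Wiener process and the Itô integral -/

section Integral

variable {Ω X : Type*} {mΩ : MeasurableSpace Ω} [NormedAddCommGroup X] [NormedSpace ℝ X]

/-- The usual conditions: right-continuity, and every null set belongs to `𝓕 0`. -/
structure UsualConditions (𝓕 : Filtration ℝ≥0 mΩ) (P : Measure Ω) : Prop where
  rightContinuous : 𝓕.IsRightContinuous
  null_mem : ∀ s : Set Ω, P s = 0 → MeasurableSet[𝓕 0] s

/-- `W` is a real Wiener process relative to the filtration `𝓕`. -/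
structure IsWienerProcess (W : ℝ≥0 → Ω → ℝ) (𝓕 : Filtration ℝ≥0 mΩ) (P : Measure Ω) :
    Prop where
  brownian : IsBrownianReal W P
  adapted : StronglyAdapted 𝓕 W
  indep : ∀ s t : ℝ≥0, s ≤ t →
    Indep (MeasurableSpace.comap (fun ω => W t ω - W s ω) inferInstance) (𝓕 s) P

variable (X) in
/-- A bounded simple process `∑_{i < num} coeff i · 1_{(time i, time (i + 1)]}`. -/
structure SimpleProcess (𝓕 : Filtration ℝ≥0 mΩ) where
  num : ℕ
  time : ℕ → ℝ≥0
  mono : Monotone time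
  coeff : ℕ → Ω → X
  measurable : ∀ i, StronglyMeasurable[𝓕 (time i)] (coeff i)
  bounded : ∃ C : ℝ, ∀ i ω, ‖coeff i ω‖ ≤ C

/-- The value of a simple process at time `s`. -/
noncomputable def SimpleProcess.eval {𝓕 : Filtration ℝ≥0 mΩ} (Φ : SimpleProcess X 𝓕)
    (s : ℝ≥0) (ω : Ω) : X :=
  ∑ i ∈ Finset.range Φ.num,
    (Set.Ioc (Φ.time i) (Φ.time (i + 1))).indicator (fun _ => Φ.coeff i ω) s

/-- The stochastic integral over `[0, ∞)` of a simple process. -/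
noncomputable def SimpleProcess.integral {𝓕 : Filtration ℝ≥0 mΩ} (Φ : SimpleProcess X 𝓕)
    (W : ℝ≥0 → Ω → ℝ) (ω : Ω) : X :=
  ∑ i ∈ Finset.range Φ.num, (W (Φ.time (i + 1)) ω - W (Φ.time i) ω) • Φ.coeff i ω

/-- `I = ∫_0^∞ φ(s) dW(s)`: there are simple processes `Φ n` with
`∫_0^∞ ‖Φ n - φ‖² ds → 0` and `∫ Φ n dW → I`, both in probability. -/
def IsItoIntegral (W : ℝ≥0 → Ω → ℝ) (𝓕 : Filtration ℝ≥0 mΩ) (P : Measure Ω)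
    (φ : ℝ≥0 → Ω → X) (I : Ω → X) : Prop :=
  AEStronglyMeasurable (Function.uncurry φ) (leb.prod P) ∧
  ∃ Φ : ℕ → SimpleProcess X 𝓕,
    (∀ ε : ℝ≥0∞, 0 < ε → Tendsto
      (fun n => P {ω | ε ≤ ∫⁻ s, ‖(Φ n).eval s ω - φ s ω‖ₑ ^ 2 ∂leb}) atTop (𝓝 0)) ∧
    TendstoInMeasure P (fun n ω => (Φ n).integral W ω) atTop I

end Integral

/-! ### Convolutions and the assumptions on `S` -/

section Convolution

variable {E V H Ω : Type*}
  [NormedAddCommGroup E] [NormedSpace ℝ E] [NormedAddCommGroup V] [NormedSpace ℝ V]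
  [NormedAddCommGroup H] [NormedSpace ℝ H] {mΩ : MeasurableSpace Ω}

/-- `h = ∫_0^t S(t - r) f(r) dr`, a Bochner integral in `H` (whose existence is part of the
assertion). -/
def IsConvAt (S : ℝ≥0 → H →L[ℝ] H) (f : ℝ≥0 → H) (t : ℝ≥0) (h : H) : Prop :=
  IntegrableOn (fun r => S (t - r) (f r)) (Set.Iic t) leb ∧
    h = ∫ r in Set.Iic t, S (t - r) (f r) ∂leb

/-- `h = ∫_0^t S(t - r) ξ(r) dW(r)` for a `V`-valued process `ξ`, an Itô integral in `H`. -/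
def IsStochConvAt (k : V →L[ℝ] H) (S : ℝ≥0 → H →L[ℝ] H) (W : ℝ≥0 → Ω → ℝ)
    (𝓕 : Filtration ℝ≥0 mΩ) (P : Measure Ω) (ξ : ℝ≥0 → Ω → V) (t : ℝ≥0) (h : Ω → H) : Prop :=
  IsItoIntegral W 𝓕 P
    (fun r ω => (Set.Iio t).indicator (fun r => S (t - r) (k (ξ r ω))) r) h

/-- `J` is a version with continuous `V`-valued paths of the stochastic convolution
`(S ⋄ ξ)(t) = ∫_0^t S(t - r) ξ(r) dW(r)`, `t ≥ 0`. -/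
def IsStochConv (k : V →L[ℝ] H) (S : ℝ≥0 → H →L[ℝ] H) (W : ℝ≥0 → Ω → ℝ)
    (𝓕 : Filtration ℝ≥0 mΩ) (P : Measure Ω) (ξ J : ℝ≥0 → Ω → V) : Prop :=
  (∀ᵐ ω ∂P, Continuous (fun t => J t ω)) ∧
    ∀ t, IsStochConvAt k S W 𝓕 P ξ t (fun ω => k (J t ω))

/-- The assumptions on the semigroup `S` on `H`, with the regularity of `S * f`, of `S ⋄ ξ`
and of `S u₀`. -/
structure SemigroupAssumption (j : E →L[ℝ] V) (k : V →L[ℝ] H) (S : ℝ≥0 → H →L[ℝ] H)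
    (W : ℝ≥0 → Ω → ℝ) (𝓕 : Filtration ℝ≥0 mΩ) (P : Measure Ω) : Prop where
  map_zero : S 0 = ContinuousLinearMap.id ℝ H
  map_add : ∀ s t, S (s + t) = (S s).comp (S t)
  conv : ∃ C₁ : ℝ≥0, 0 < C₁ ∧ ∀ T : ℝ≥0, 0 < T → ∀ f : ℝ≥0 → H,
    MemLp f 2 (leb.restrict (Set.Iic T)) →
    ∃ w : ℝ≥0 → V, MemX j w T ∧ (∀ t ≤ T, IsConvAt S f t (k (w t))) ∧
      xNorm j w T ≤ C₁ * eLpNorm f 2 (leb.restrict (Set.Iic T))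
  stochConv : ∃ C₂ : ℝ≥0, 0 < C₂ ∧ ∀ T : ℝ≥0, 0 < T → ∀ ξ : ℝ≥0 → Ω → V,
    MemM2 𝓕 P ξ T →
    ∃ J : ℝ≥0 → Ω → V, MemM2X j 𝓕 P J T ∧
      (∀ t ≤ T, IsStochConvAt k S W 𝓕 P ξ t (fun ω => k (J t ω))) ∧
      m2xNorm j P J T ≤ C₂ * m2Norm P ξ T
  orbit : ∀ T₀ : ℝ≥0, 0 < T₀ → ∃ C₀ : ℝ≥0, 0 < C₀ ∧ ∀ T : ℝ≥0, 0 < T → T ≤ T₀ → ∀ v : V,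
    ∃ w : ℝ≥0 → V, MemX j w T ∧ (∀ t ≤ T, k (w t) = S t (k v)) ∧ xNorm j w T ≤ C₀ * ‖v‖ₑ

end Convolution

/-! ### Local and maximal mild solutions -/

section Solutions

variable {E V H Ω : Type*}
  [NormedAddCommGroup E] [NormedSpace ℝ E] [NormedAddCommGroup V] [NormedSpace ℝ V]
  [NormedAddCommGroup H] [NormedSpace ℝ H] {mΩ : MeasurableSpace Ω}

/-- `τ` is an accessible stopping time. -/
def IsAccessible (𝓕 : Filtration ℝ≥0 mΩ) (P : Measure Ω) (τ : Ω → WithTop ℝ≥0) : Prop :=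
  IsStoppingTime 𝓕 τ ∧ ∃ ρ : ℕ → Ω → WithTop ℝ≥0, (∀ n, IsStoppingTime 𝓕 (ρ n)) ∧
    ∀ᵐ ω ∂P, Monotone (fun n => ρ n ω) ∧ (∀ n, ρ n ω < τ ω) ∧ (⨆ n, ρ n ω) = τ ω

/-- `u` is an admissible process on `[0, τ) × Ω`: adapted, with almost surely continuous paths.
A process on `[0, τ) × Ω` is a function on `ℝ≥0 × Ω` whose values at `t ≥ τ ω` are
irrelevant. -/
def IsAdmissible (𝓕 : Filtration ℝ≥0 mΩ) (P : Measure Ω) (u : ℝ≥0 → Ω → V)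
    (τ : Ω → WithTop ℝ≥0) : Prop :=
  (∀ t : ℝ≥0, StronglyMeasurable[𝓕 t] ({ω | (t : WithTop ℝ≥0) < τ ω}.indicator (u t))) ∧
    ∀ᵐ ω ∂P, ContinuousOn (fun t => u t ω) {t : ℝ≥0 | (t : WithTop ℝ≥0) < τ ω}

/-- `(u, τ)` is a local mild solution of `du = (A u + F(u)) dt + G(u) dW`, `u(0) = u₀`. The
stochastic term at the random time `t ∧ σ` is the value at `t ∧ σ` of the continuous process
`J = S ⋄ (1_{[0, σ)} G(u))`. -/
def IsLocalMildSolution (j : E →L[ℝ] V) (k : V →L[ℝ] H) (S : ℝ≥0 → H →L[ℝ] H)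
    (F : E → H) (G : E → V) (W : ℝ≥0 → Ω → ℝ) (𝓕 : Filtration ℝ≥0 mΩ) (P : Measure Ω)
    (u₀ : Ω → V) (u : ℝ≥0 → Ω → V) (τ : Ω → WithTop ℝ≥0) : Prop :=
  IsAccessible 𝓕 P τ ∧ IsAdmissible 𝓕 P u τ ∧
  ∃ σ : ℕ → Ω → ℝ≥0,
    (∀ m, IsStoppingTime 𝓕 (fun ω => (σ m ω : WithTop ℝ≥0))) ∧
    (∀ᵐ ω ∂P, Monotone (fun m => σ m ω) ∧ (∀ m, (σ m ω : WithTop ℝ≥0) < τ ω) ∧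
      (⨆ m, (σ m ω : WithTop ℝ≥0)) = τ ω) ∧
    ∀ m,
      (∀ t : ℝ≥0, ∫⁻ ω, xNorm j (fun s => u s ω) (min t (σ m ω)) ^ 2 ∂P < ⊤) ∧
      ∃ J : ℝ≥0 → Ω → V,
        IsStochConv k S W 𝓕 P
          (fun s ω => (Set.Iio (σ m ω)).indicator (fun s => onV j G (u s ω)) s) J ∧
        ∀ t : ℝ≥0, ∀ᵐ ω ∂P, ∃ h : H,
          IsConvAt S (fun s => onV j F (u s ω)) (min t (σ m ω)) h ∧
          k (u (min t (σ m ω)) ω) =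
            S (min t (σ m ω)) (k (u₀ ω)) + h + k (J (min t (σ m ω)) ω)

/-- The processes `u` and `v` coincide almost surely on `[0, τ)`. -/
def AgreeBefore (P : Measure Ω) (τ : Ω → WithTop ℝ≥0) (u v : ℝ≥0 → Ω → V) : Prop :=
  ∀ᵐ ω ∂P, ∀ t : ℝ≥0, (t : WithTop ℝ≥0) < τ ω → u t ω = v t ω

/-- The order `(u, τ) ≼ (v, σ)`: `τ ≤ σ` a.s. and `v` extends `u`. -/
def Precedes (P : Measure Ω) (u : ℝ≥0 → Ω → V) (τ : Ω → WithTop ℝ≥0)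
    (v : ℝ≥0 → Ω → V) (σ : Ω → WithTop ℝ≥0) : Prop :=
  (∀ᵐ ω ∂P, τ ω ≤ σ ω) ∧ AgreeBefore P τ u v

/-- The equivalence `(u, τ) ∼ (v, σ)`. -/
def Equivalent (P : Measure Ω) (u : ℝ≥0 → Ω → V) (τ : Ω → WithTop ℝ≥0)
    (v : ℝ≥0 → Ω → V) (σ : Ω → WithTop ℝ≥0) : Prop :=
  (∀ᵐ ω ∂P, τ ω = σ ω) ∧ AgreeBefore P τ u v

/-- `(u, τ)` is a maximal local mild solution: a maximal element, up to equivalence, of the set of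
all local mild solutions ordered by `≼`. -/
def IsMaximalLocalMildSolution (j : E →L[ℝ] V) (k : V →L[ℝ] H) (S : ℝ≥0 → H →L[ℝ] H)
    (F : E → H) (G : E → V) (W : ℝ≥0 → Ω → ℝ) (𝓕 : Filtration ℝ≥0 mΩ) (P : Measure Ω)
    (u₀ : Ω → V) (u : ℝ≥0 → Ω → V) (τ : Ω → WithTop ℝ≥0) : Prop :=
  IsLocalMildSolution j k S F G W 𝓕 P u₀ u τ ∧
  ∀ v σ, IsLocalMildSolution j k S F G W 𝓕 P u₀ v σ → Precedes P u τ v σ →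
    Equivalent P u τ v σ

/-- `u` is a global solution of the equation truncated at level `R`:
`u(t) = S(t) u₀ + ∫_0^t S(t - r) [θ(|u|_{X_r} / R) F(u(r))] dr
  + ∫_0^t S(t - r) [θ(|u|_{X_r} / R) G(u(r))] dW(r)`, with `u ∈ M²(X_T)` for all `T`. -/
def IsTruncatedSolution (θ : ℝ → ℝ) (R : ℝ) (j : E →L[ℝ] V) (k : V →L[ℝ] H)
    (S : ℝ≥0 → H →L[ℝ] H) (F : E → H) (G : E → V) (W : ℝ≥0 → Ω → ℝ)
    (𝓕 : Filtration ℝ≥0 mΩ) (P : Measure Ω) (u₀ : Ω → V) (u : ℝ≥0 → Ω → V) : Prop :=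
  (∀ T : ℝ≥0, MemM2X j 𝓕 P u T) ∧
  ∃ J : ℝ≥0 → Ω → V,
    IsStochConv k S W 𝓕 P
      (fun r ω => θ ((xNorm j (fun s => u s ω) r).toReal / R) • onV j G (u r ω)) J ∧
    ∀ t : ℝ≥0, ∀ᵐ ω ∂P, ∃ h : H,
      IsConvAt S (fun r => θ ((xNorm j (fun s => u s ω) r).toReal / R) • onV j F (u r ω)) t h ∧
      k (u t ω) = S t (k (u₀ ω)) + h + k (J t ω)

/-- `inf {t ≥ 0 : |u|_{X_t} ≥ R}`, equal to `∞` if there is no such `t`. -/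
noncomputable def exitTime (j : E →L[ℝ] V) (R : ℝ≥0∞) (u : ℝ≥0 → Ω → V) :
    Ω → WithTop ℝ≥0 :=
  hittingAfter (fun t ω => xNorm j (fun s => u s ω) t) (Set.Ici R) 0

/-- `τ_∞ = sup_n τ_n`, where `τ_n` is the truncation time of the solution `un n` of the equation
truncated at level `n + 1`. -/
noncomputable def limitTime (j : E →L[ℝ] V) (un : ℕ → ℝ≥0 → Ω → V) (ω : Ω) : WithTop ℝ≥0 :=
  ⨆ n : ℕ, exitTime j (n + 1 : ℝ≥0∞) (un n) ω

end Solutions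

end StochEvol

namespace StochEvol

/-! ### Lebesgue measure on the half-line -/

/-! The cutoff makes the nonlinearities globally Lipschitz along paths. While |w|_{X_s} < 2R, both
the V-norm and the integral of |w|_E² are controlled by R; beyond that level the cutoff vanishes.
Since α, β < 1, Young's inequality replaces |y-x|_E^α ‖y-x‖^(1-α) by a small multiple of |y-x|_E
plus a large multiple of ‖y-x‖. The result is that the squared L²(0,T)-distance of two truncated
nonlinearities is at most η |w₁-w₂|²_{X_T} + C ∫_0^T |w₁-w₂|²_{X_s} ds with η arbitrarily small
(`exists_lintegral_trunc_sub_le`). Combined with the bounds on S this gives a mean-square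
contraction with factor 1/16 up to a Volterra term (`exists_contraction`). An exponential weight in
time absorbs the Volterra term on every horizon (`le_geometric_of_gronwall`), so the Picard
iteration converges without cutting time into short pieces (`exists_mildOn_trunc`).

The rest is localization on sets B of pairs (time, event) that are closed under going back in time.
By a Lenglart inequality for simple processes, an Itô integral vanishes on every event on which its
integrand vanishes (`IsItoIntegral.ae_eq_zero_of_forall_mem`). Hence linear mild equations whose
data agree on B have solutions that agree on B (`MildOn.ae_eq_of_forall_lt`). Multiplying the data
by 1_B and using the contraction again, two processes that solve the truncated equation merely on B
coincide on B (`ae_eq_on_of_mildOn`). Suitable choices of B yield uniqueness, the consistency of the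
u^n, and the fact that each local mild solution is a restriction of their limit
(`IsLocalMildSolution.ae_lt_limitTime`), from which maximality and uniqueness follow. Processes set
to 0 after a stopping time enter here, which is why only left-continuous paths are required in
`IsRegular`.

For continuous paths of finite norm, |u|_{X_t} is continuous in t. So t < τ_n exactly when the norm
at t is below the level (`coe_lt_exitTime_iff`), and finite τ_n lie strictly below τ_∞
(`IsCompatible.lt_iSup_of_eq`).

For the explosion, on ‖x‖ ≤ M both nonlinearities satisfy |Φ(x)|² ≤ η |x|_E² + C, uniformly in the
truncation level. Localizing to the times up to which the V-norm is bounded and absorbing the E-term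
bounds 𝔼|·|²_{X_T} independently of the level (`exists_measure_mul_sq_le`). By Chebyshev, the
probability that the X-norm reaches level n before T while the V-norm stays below M tends to 0.
Continuity on compact intervals then upgrades an infinite supremum to an infinite limsup. -/

lemma measurableEmbedding_coe : MeasurableEmbedding ((↑) : ℝ≥0 → ℝ) :=
  MeasurableEmbedding.subtype_coe measurableSet_Ici

lemma leb_apply (s : Set ℝ≥0) : leb s = volume (((↑) : ℝ≥0 → ℝ) '' s) :=
  measurableEmbedding_coe.comap_apply _ _

lemma coe_image_Ioc (a b : ℝ≥0) :
    ((↑) : ℝ≥0 → ℝ) '' Set.Ioc a b = Set.Ioc (a : ℝ) b := by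
  ext x
  simp only [Set.mem_image, Set.mem_Ioc]
  constructor
  · rintro ⟨y, ⟨h1, h2⟩, rfl⟩
    exact ⟨by exact_mod_cast h1, by exact_mod_cast h2⟩
  · rintro ⟨h1, h2⟩
    exact ⟨⟨x, a.2.trans h1.le⟩, ⟨by exact_mod_cast h1, by exact_mod_cast h2⟩, rfl⟩

lemma coe_image_Iic (b : ℝ≥0) :
    ((↑) : ℝ≥0 → ℝ) '' Set.Iic b = Set.Icc (0 : ℝ) b := by
  ext x
  simp only [Set.mem_image, Set.mem_Iic, Set.mem_Icc]
  constructor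
  · rintro ⟨y, h2, rfl⟩
    exact ⟨y.2, by exact_mod_cast h2⟩
  · rintro ⟨h1, h2⟩
    exact ⟨⟨x, h1⟩, by exact_mod_cast h2, rfl⟩

lemma leb_Ioc (a b : ℝ≥0) : leb (Set.Ioc a b) = ENNReal.ofReal ((b : ℝ) - a) := by
  rw [leb_apply, coe_image_Ioc, Real.volume_Ioc]

lemma leb_Iic (b : ℝ≥0) : leb (Set.Iic b) = b := by
  rw [leb_apply, coe_image_Iic, Real.volume_Icc]; simp

instance : NullSingletonClass leb :=
  ⟨fun x => by rw [leb_apply]; simp⟩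

instance isFiniteMeasure_restrict_leb (T : ℝ≥0) : IsFiniteMeasure (leb.restrict (Set.Iic T)) :=
  ⟨by rw [Measure.restrict_apply_univ, leb_Iic]; exact ENNReal.coe_lt_top⟩

instance : SigmaFinite leb :=
  ⟨⟨{ set := fun n => Set.Iic (n : ℝ≥0)
      set_mem := fun _ => trivial
      finite := fun n => by rw [leb_Iic]; exact ENNReal.coe_lt_top
      spanning := by
        ext x
        obtain ⟨n, hn⟩ := exists_nat_ge x
        simpa using ⟨n, hn⟩ }⟩⟩

/-! ### Stochastic integrals of simple processes -/

section Simple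

variable {Ω X Y : Type*} {mΩ : MeasurableSpace Ω} [NormedAddCommGroup X] [NormedSpace ℝ X]
  [NormedAddCommGroup Y] [NormedSpace ℝ Y] {𝓕 : Filtration ℝ≥0 mΩ} {P : Measure Ω}
  {W : ℝ≥0 → Ω → ℝ}

/-- With g t = 1_{s ≤ t}, the value of a simple process becomes ∑ (g (t_{i+1}) - g (t_i)) c_i, the
same expression as its integral with g = W. Identities proved for arbitrary g then serve both. -/
lemma indicator_Ioc_eq_smul (a b s : ℝ≥0) (h : a ≤ b) (c : X) :
    (Set.Ioc a b).indicator (fun _ => c) s =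
      ((if s ≤ b then (1 : ℝ) else 0) - (if s ≤ a then (1 : ℝ) else 0)) • c := by
  by_cases h1 : s ≤ a
  · have : s ∉ Set.Ioc a b := fun h' => absurd h'.1 (not_lt.2 h1)
    simp [h1, h1.trans h]
  · by_cases h2 : s ≤ b
    · have : s ∈ Set.Ioc a b := ⟨not_le.1 h1, h2⟩
      simp [Set.indicator_of_mem this, h1, h2]
    · have : s ∉ Set.Ioc a b := fun h' => absurd h'.2 h2
      simp [h1, h2]

lemma SimpleProcess.eval_eq (Φ : SimpleProcess X 𝓕) (s : ℝ≥0) (ω : Ω) :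
    Φ.eval s ω = ∑ i ∈ Finset.range Φ.num,
      ((if s ≤ Φ.time (i + 1) then (1 : ℝ) else 0) - (if s ≤ Φ.time i then (1 : ℝ) else 0)) •
        Φ.coeff i ω :=
  Finset.sum_congr rfl fun i _ => indicator_Ioc_eq_smul _ _ _ (Φ.mono (Nat.le_succ i)) _

lemma SimpleProcess.eval_of_mem (Φ : SimpleProcess X 𝓕) {i : ℕ} (hi : i < Φ.num) {s : ℝ≥0}
    (hs : s ∈ Set.Ioc (Φ.time i) (Φ.time (i + 1))) (ω : Ω) : Φ.eval s ω = Φ.coeff i ω := by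
  rw [SimpleProcess.eval, Finset.sum_eq_single_of_mem i (Finset.mem_range.2 hi)]
  · exact Set.indicator_of_mem hs _
  · intro l _ hl
    refine Set.indicator_of_notMem (fun h => ?_) _
    exact Set.disjoint_left.1 (Φ.mono.pairwise_disjoint_on_Ioc_succ hl) h hs

/-- Composition of a simple process with a continuous linear map. -/
def SimpleProcess.map (Φ : SimpleProcess X 𝓕) (L : X →L[ℝ] Y) : SimpleProcess Y 𝓕 where
  num := Φ.num
  time := Φ.time
  mono := Φ.mono
  coeff i ω := L (Φ.coeff i ω)
  measurable i := L.continuous.comp_stronglyMeasurable (Φ.measurable i)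
  bounded := by
    obtain ⟨C, hC⟩ := Φ.bounded
    exact ⟨‖L‖ * C, fun i ω => (L.le_opNorm _).trans
      (mul_le_mul_of_nonneg_left (hC i ω) (norm_nonneg _))⟩

lemma SimpleProcess.map_integral (Φ : SimpleProcess X 𝓕) (L : X →L[ℝ] Y) (ω : Ω) :
    (Φ.map L).integral W ω = L (Φ.integral W ω) := by
  simp [SimpleProcess.integral, SimpleProcess.map, map_sum]

/-- A finite sum of processes `1_{(a i, b i]} c i` is a simple process. -/
lemma exists_simpleProcess {ι : Type*} (s : Finset ι) (a b : ι → ℝ≥0) (c : ι → Ω → X)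
    (hab : ∀ i, a i ≤ b i) (hc : ∀ i, StronglyMeasurable[𝓕 (a i)] (c i))
    (hb : ∃ C : ℝ, ∀ i ω, ‖c i ω‖ ≤ C) :
    ∃ Φ : SimpleProcess X 𝓕, ∀ (g : ℝ≥0 → ℝ) (ω : Ω),
      ∑ i ∈ Finset.range Φ.num, (g (Φ.time (i + 1)) - g (Φ.time i)) • Φ.coeff i ω =
        ∑ i ∈ s, (g (b i) - g (a i)) • c i ω := by
  classical
  obtain ⟨C, hC⟩ := hb
  set T : Finset ℝ≥0 := insert 0 (s.image a ∪ s.image b) with hT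
  have hN : 0 < T.card := Finset.card_pos.2 ⟨0, Finset.mem_insert_self _ _⟩
  -- The mesh lists all endpoints in increasing order and then stays at the last one; `0` is
  -- inserted only to make the set nonempty.
  set t : ℕ → ℝ≥0 := fun i => T.orderEmbOfFin rfl ⟨min i (T.card - 1), by omega⟩ with ht
  have tmono : Monotone t := fun i i' h => by
    refine (T.orderEmbOfFin rfl).monotone ?_
    simp only [Fin.mk_le_mk]
    omega
  have tsurj : ∀ x ∈ T, ∃ i, i < T.card ∧ t i = x := by
    intro x hx
    have : x ∈ Set.range (T.orderEmbOfFin rfl) := by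
      rw [Finset.range_orderEmbOfFin]; exact hx
    obtain ⟨i, rfl⟩ := this
    refine ⟨i, i.2, ?_⟩
    simp only [ht]
    congr 1
    ext
    simp only
    have := i.2
    omega
  have meas : ∀ l, StronglyMeasurable[𝓕 (t l)] (fun ω => ∑ i ∈ s,
      if a i ≤ t l ∧ t (l + 1) ≤ b i then c i ω else 0) := by
    intro l
    refine Finset.stronglyMeasurable_fun_sum _ fun i _ => ?_
    by_cases h : a i ≤ t l ∧ t (l + 1) ≤ b i
    · simp only [h, and_self, if_true]
      exact (hc i).mono (𝓕.mono h.1)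
    · simp only [h, if_false]
      exact stronglyMeasurable_const
  refine ⟨⟨T.card, t, tmono, _, meas, ⟨∑ i ∈ s, |C|, fun l ω => ?_⟩⟩, fun g ω => ?_⟩
  · refine (norm_sum_le _ _).trans (Finset.sum_le_sum fun i _ => ?_)
    split_ifs
    · exact (hC i ω).trans (le_abs_self _)
    · simp
  · simp only [Finset.smul_sum]
    rw [Finset.sum_comm]
    refine Finset.sum_congr rfl fun i hi => ?_
    obtain ⟨p, hp, hp'⟩ := tsurj (a i) (by simp only [hT, Finset.mem_insert, Finset.mem_union]; exact Or.inr (Or.inl (Finset.mem_image_of_mem _ hi)))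
    obtain ⟨q, hq, hq'⟩ : ∃ q, q < T.card ∧ p ≤ q ∧ t q = b i := by
      obtain ⟨q, hq, hq'⟩ := tsurj (b i) (by simp only [hT, Finset.mem_insert, Finset.mem_union]; exact Or.inr (Or.inr (Finset.mem_image_of_mem _ hi)))
      refine ⟨max p q, max_lt hp hq, le_max_left _ _, ?_⟩
      rw [tmono.map_max, hp', hq', max_eq_right (hab i)]
    have key : ∀ l ∈ Finset.range T.card, ((g (t (l + 1)) - g (t l)) •
        if a i ≤ t l ∧ t (l + 1) ≤ b i then c i ω else 0) =
        if l ∈ Finset.Ico p q then (g (t (l + 1)) - g (t l)) • c i ω else 0 := by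
      intro l _
      by_cases hl : l ∈ Finset.Ico p q
      · have h1 := Finset.mem_Ico.1 hl
        have h2 : a i ≤ t l ∧ t (l + 1) ≤ b i :=
          ⟨hp' ▸ tmono h1.1, hq'.2 ▸ tmono h1.2⟩
        rw [if_pos hl, if_pos h2]
      · rw [if_neg hl]
        split_ifs with h
        -- A mesh interval that fits between the endpoints although `l` is outside `[p, q)` is
        -- degenerate, so its increment contributes nothing.
        · have h3 : t (l + 1) = t l := by
            refine le_antisymm ?_ (tmono (Nat.le_succ l))
            rcases not_and_or.1 (fun h' => hl (Finset.mem_Ico.2 h')) with h4 | h4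
            · exact (tmono (by omega : l + 1 ≤ p)).trans (hp' ▸ h.1)
            · exact h.2.trans (hq'.2 ▸ tmono (by omega : q ≤ l))
          rw [h3, sub_self, zero_smul]
        · simp
    rw [Finset.sum_congr rfl key, ← Finset.sum_filter]
    have : Finset.filter (fun l => l ∈ Finset.Ico p q) (Finset.range T.card) = Finset.Ico p q := by
      ext l
      simp only [Finset.mem_filter, Finset.mem_range, Finset.mem_Ico]
      omega
    rw [this, ← Finset.sum_smul, Finset.sum_Ico_sub (fun l => g (t l)) hq'.1, hp', hq'.2]

/-- A common refinement of the two meshes, provided by `exists_simpleProcess`. Its identity holds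
for every g, so one refinement handles values and integrals alike. -/
lemma SimpleProcess.exists_sub (Φ Ψ : SimpleProcess X 𝓕) : ∃ Ξ : SimpleProcess X 𝓕,
    (∀ s ω, Ξ.eval s ω = Φ.eval s ω - Ψ.eval s ω) ∧
    ∀ (W : ℝ≥0 → Ω → ℝ) (ω : Ω), Ξ.integral W ω = Φ.integral W ω - Ψ.integral W ω := by
  obtain ⟨C, hC⟩ := Φ.bounded
  obtain ⟨D, hD⟩ := Ψ.bounded
  obtain ⟨Ξ, hΞ⟩ := exists_simpleProcess (𝓕 := 𝓕) (X := X)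
    ((Finset.range Φ.num).disjSum (Finset.range Ψ.num))
    (Sum.elim Φ.time Ψ.time) (Sum.elim (fun i => Φ.time (i + 1)) (fun i => Ψ.time (i + 1)))
    (Sum.elim Φ.coeff (fun i ω => - Ψ.coeff i ω))
    (by rintro (i | i); exacts [Φ.mono (Nat.le_succ i), Ψ.mono (Nat.le_succ i)])
    (by rintro (i | i); exacts [Φ.measurable i, (Ψ.measurable i).neg])
    ⟨max C D, by
      rintro (i | i) ω
      · exact (hC i ω).trans (le_max_left _ _)
      · simpa using (hD i ω).trans (le_max_right _ _)⟩
  have h : ∀ (g : ℝ≥0 → ℝ) (ω : Ω),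
      ∑ i ∈ Finset.range Ξ.num, (g (Ξ.time (i + 1)) - g (Ξ.time i)) • Ξ.coeff i ω =
      ∑ i ∈ Finset.range Φ.num, (g (Φ.time (i + 1)) - g (Φ.time i)) • Φ.coeff i ω -
      ∑ i ∈ Finset.range Ψ.num, (g (Ψ.time (i + 1)) - g (Ψ.time i)) • Ψ.coeff i ω := by
    intro g ω
    rw [hΞ, Finset.sum_disjSum]
    simp [sub_eq_add_neg]
  refine ⟨Ξ, fun s ω => ?_, fun W ω => h (fun t => W t ω) ω⟩
  simp only [SimpleProcess.eval_eq]
  exact h (fun t => if s ≤ t then (1 : ℝ) else 0) ω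

lemma SimpleProcess.measurable_eval (Φ : SimpleProcess X 𝓕) (ω : Ω) :
    StronglyMeasurable (fun s => Φ.eval s ω) :=
  Finset.stronglyMeasurable_fun_sum _ fun _ _ =>
    stronglyMeasurable_const.indicator measurableSet_Ioc

/-- The quadratic variation `∫_0^∞ |Φ|² ds` of a real simple process. -/
def SimpleProcess.energy (Φ : SimpleProcess ℝ 𝓕) (ω : Ω) : ℝ :=
  ∑ i ∈ Finset.range Φ.num, ((Φ.time (i + 1) : ℝ) - Φ.time i) * Φ.coeff i ω ^ 2

/-- `X` is a mere Banach space without an Itô isometry, so integrals are tested with functionals;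
this pathwise bound links the scalar quadratic variation to the `X`-valued integrand. -/
lemma SimpleProcess.energy_map_le (Φ : SimpleProcess X 𝓕) (L : X →L[ℝ] ℝ) (ω : Ω) :
    ENNReal.ofReal ((Φ.map L).energy ω) ≤ ‖L‖ₑ ^ 2 * ∫⁻ s, ‖Φ.eval s ω‖ₑ ^ 2 ∂leb := by
  have h0 : ∀ i, 0 ≤ ((Φ.time (i + 1) : ℝ) - Φ.time i) := fun i =>
    sub_nonneg.2 (by exact_mod_cast Φ.mono (Nat.le_succ i))
  calc ENNReal.ofReal ((Φ.map L).energy ω)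
      = ∑ i ∈ Finset.range Φ.num, ENNReal.ofReal (((Φ.time (i + 1) : ℝ) - Φ.time i) *
          (L (Φ.coeff i ω)) ^ 2) :=
        ENNReal.ofReal_sum_of_nonneg fun i _ => mul_nonneg (h0 i) (sq_nonneg _)
    _ ≤ ∑ i ∈ Finset.range Φ.num, ∫⁻ s in Set.Ioc (Φ.time i) (Φ.time (i + 1)),
          ‖L‖ₑ ^ 2 * ‖Φ.eval s ω‖ₑ ^ 2 ∂leb := by
        refine Finset.sum_le_sum fun i hi => ?_
        rw [setLIntegral_congr_fun (g := fun _ => ‖L‖ₑ ^ 2 * ‖Φ.coeff i ω‖ₑ ^ 2)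
          measurableSet_Ioc (fun s hs => by
            simp only [Φ.eval_of_mem (Finset.mem_range.1 hi) hs])]
        rw [lintegral_const, Measure.restrict_apply_univ, leb_Ioc, mul_comm,
          ENNReal.ofReal_mul' (h0 i)]
        gcongr
        rw [← mul_pow]
        refine (Real.ofReal_le_enorm _).trans ?_
        rw [enorm_pow]
        gcongr
        exact L.le_opENorm _
    _ = ∫⁻ s in ⋃ i ∈ Finset.range Φ.num, Set.Ioc (Φ.time i) (Φ.time (i + 1)),
          ‖L‖ₑ ^ 2 * ‖Φ.eval s ω‖ₑ ^ 2 ∂leb := by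
        rw [lintegral_biUnion_finset]
        · intro i _ i' _ h
          exact Φ.mono.pairwise_disjoint_on_Ioc_succ h
        · exact fun _ _ => measurableSet_Ioc
    _ ≤ ∫⁻ s, ‖L‖ₑ ^ 2 * ‖Φ.eval s ω‖ₑ ^ 2 ∂leb := setLIntegral_le_lintegral _ _
    _ = _ := lintegral_const_mul _ ((Φ.measurable_eval ω).enorm.pow_const _)

/-- Increments of the Wiener process after time `s` are orthogonal to `𝓕 s`. -/
lemma IsWienerProcess.indepFun (hW : IsWienerProcess W 𝓕 P) {s t : ℝ≥0} (hst : s ≤ t)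
    {Z : Ω → ℝ} (hZ : StronglyMeasurable[𝓕 s] Z) :
    IndepFun (fun ω => W t ω - W s ω) Z P :=
  indep_of_indep_of_le_right (hW.indep s t hst) hZ.measurable.comap_le

lemma IsWienerProcess.hasLaw_sub (hW : IsWienerProcess W 𝓕 P) {s t : ℝ≥0} (hst : s ≤ t) :
    HasLaw (fun ω => W t ω - W s ω) (gaussianReal 0 (t - s)) P := by
  have h := hW.brownian.toIsPreBrownianReal.hasLaw_sub t s
  have h2 : nndist (t : ℝ) s = t - s := by
    ext
    rw [coe_nndist, Real.dist_eq, NNReal.coe_sub hst, abs_of_nonneg]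
    exact sub_nonneg.2 (by exact_mod_cast hst)
  rw [← h2]
  exact h

lemma IsWienerProcess.memLp_sub (hW : IsWienerProcess W 𝓕 P) {s t : ℝ≥0} (hst : s ≤ t) :
    MemLp (fun ω => W t ω - W s ω) 2 P := by
  have h := hW.hasLaw_sub hst
  have h3 := memLp_id_gaussianReal (μ := 0) (v := t - s) 2
  rw [← h.map_eq] at h3
  exact (memLp_map_measure_iff aestronglyMeasurable_id h.aemeasurable).1 h3

lemma IsWienerProcess.integral_sub (hW : IsWienerProcess W 𝓕 P) {s t : ℝ≥0} (hst : s ≤ t) :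
    ∫ ω, (W t ω - W s ω) ∂P = 0 := by
  rw [(hW.hasLaw_sub hst).integral_eq, integral_id_gaussianReal]

lemma IsWienerProcess.integral_sq_sub [IsProbabilityMeasure P] (hW : IsWienerProcess W 𝓕 P)
    {s t : ℝ≥0} (hst : s ≤ t) :
    ∫ ω, (W t ω - W s ω) ^ 2 ∂P = t - s := by
  have h := (hW.hasLaw_sub hst).variance_eq
  rw [variance_id_gaussianReal, variance_of_integral_eq_zero
    (hW.memLp_sub hst).aemeasurable (hW.integral_sub hst)] at h
  rw [h, NNReal.coe_sub hst]

/-- The Itô isometry for real simple processes. -/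
lemma SimpleProcess.memLp_and_integral_sq [IsProbabilityMeasure P] (hW : IsWienerProcess W 𝓕 P)
    {t : ℕ → ℝ≥0} (ht : Monotone t) {c : ℕ → Ω → ℝ} (hc : ∀ i, StronglyMeasurable[𝓕 (t i)] (c i))
    {C : ℝ} (hC : ∀ i ω, ‖c i ω‖ ≤ C) (n : ℕ) :
    StronglyMeasurable[𝓕 (t n)]
        (fun ω => ∑ i ∈ Finset.range n, (W (t (i + 1)) ω - W (t i) ω) * c i ω) ∧
    MemLp (fun ω => ∑ i ∈ Finset.range n, (W (t (i + 1)) ω - W (t i) ω) * c i ω) 2 P ∧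
    ∫ ω, (∑ i ∈ Finset.range n, (W (t (i + 1)) ω - W (t i) ω) * c i ω) ^ 2 ∂P =
      ∫ ω, ∑ i ∈ Finset.range n, ((t (i + 1) : ℝ) - t i) * c i ω ^ 2 ∂P := by
  induction n with
  | zero => simpa using stronglyMeasurable_const
  | succ n ih =>
    obtain ⟨h1, h2, h3⟩ := ih
    have hn : t n ≤ t (n + 1) := ht (Nat.le_succ n)
    have cm : ∀ i, StronglyMeasurable (c i) := fun i => (hc i).mono (𝓕.le _)
    have dW := hW.memLp_sub hn
    have dWm : StronglyMeasurable[𝓕 (t (n + 1))] (fun ω => W (t (n + 1)) ω - W (t n) ω) :=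
      (hW.adapted _).sub ((hW.adapted _).mono (𝓕.mono hn))
    have cb : ∀ i, MemLp (c i) ⊤ P := fun i =>
      memLp_top_of_bound (cm i).aestronglyMeasurable C (.of_forall (hC i))
    have hX : MemLp (fun ω => (W (t (n + 1)) ω - W (t n) ω) * c n ω) 2 P :=
      (cb n).mul dW
    have hSc : MemLp (fun ω => (∑ i ∈ Finset.range n, (W (t (i + 1)) ω - W (t i) ω) * c i ω) *
        c n ω) 2 P := (cb n).mul h2
    have hScm : StronglyMeasurable[𝓕 (t n)] (fun ω => (∑ i ∈ Finset.range n,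
        (W (t (i + 1)) ω - W (t i) ω) * c i ω) * c n ω) := h1.mul (hc n)
    refine ⟨?_, ?_, ?_⟩
    · simp only [Finset.sum_range_succ]
      exact (h1.mono (𝓕.mono hn)).add (dWm.mul ((hc n).mono (𝓕.mono hn)))
    · simp only [Finset.sum_range_succ]
      exact h2.add hX
    · simp only [Finset.sum_range_succ]
      set S : Ω → ℝ := fun ω => ∑ i ∈ Finset.range n, (W (t (i + 1)) ω - W (t i) ω) * c i ω
      have i1 : Integrable (fun ω => S ω ^ 2) P := h2.integrable_sq
      have i3 : Integrable (fun ω => ((W (t (n + 1)) ω - W (t n) ω) * c n ω) ^ 2) P :=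
        hX.integrable_sq
      have i2 : Integrable (fun ω => (W (t (n + 1)) ω - W (t n) ω) * (S ω * c n ω)) P :=
        dW.integrable_mul hSc
      -- Cross term: the increment is centred and independent of `𝓕 (t n)`, for which both the
      -- partial sum and `c n` are measurable.
      have e2 : ∫ ω, (W (t (n + 1)) ω - W (t n) ω) * (S ω * c n ω) ∂P = 0 := by
        rw [(hW.indepFun hn hScm).integral_fun_mul_eq_mul_integral
          dW.aestronglyMeasurable hSc.aestronglyMeasurable, hW.integral_sub hn, zero_mul]
      have e3 : ∫ ω, ((W (t (n + 1)) ω - W (t n) ω) * c n ω) ^ 2 ∂P =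
          ∫ ω, ((t (n + 1) : ℝ) - t n) * c n ω ^ 2 ∂P := by
        have hi := (hW.indepFun hn (hc n)).comp (φ := fun x => x ^ 2) (ψ := fun x => x ^ 2)
          (by fun_prop) (by fun_prop)
        simp only [mul_pow]
        rw [integral_const_mul, ← hW.integral_sq_sub hn]
        exact hi.integral_fun_mul_eq_mul_integral
          (dW.aestronglyMeasurable.pow 2) ((cm n).aestronglyMeasurable.pow 2)
      have hcsq : ∀ i, Integrable (fun ω => ((t (i + 1) : ℝ) - t i) * c i ω ^ 2) P := fun i =>
        (((cb i).mono_exponent le_top : MemLp (c i) 2 P).integrable_sq).const_mul _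
      have e0 : ∀ ω, (S ω + (W (t (n + 1)) ω - W (t n) ω) * c n ω) ^ 2 =
          S ω ^ 2 + 2 * ((W (t (n + 1)) ω - W (t n) ω) * (S ω * c n ω)) +
            ((W (t (n + 1)) ω - W (t n) ω) * c n ω) ^ 2 := fun ω => by ring
      have e1 : ∫ ω, (S ω + (W (t (n + 1)) ω - W (t n) ω) * c n ω) ^ 2 ∂P =
          ∫ ω, S ω ^ 2 ∂P + ∫ ω, ((W (t (n + 1)) ω - W (t n) ω) * c n ω) ^ 2 ∂P := by
        simp only [e0]
        have := integral_add (i1.add (i2.const_mul 2)) i3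
        simp only [Pi.add_apply] at this
        rw [this, integral_add i1 (i2.const_mul 2), integral_const_mul, e2, mul_zero, add_zero]
      rw [integral_add (integrable_finsetSum _ fun i _ => hcsq i) (hcsq n), ← h3, ← e3]
      exact e1

/-- Lenglart's inequality for real simple processes. -/
lemma SimpleProcess.measure_integral_ge_le [IsProbabilityMeasure P] (hW : IsWienerProcess W 𝓕 P)
    (Φ : SimpleProcess ℝ 𝓕) {ε δ : ℝ} (hε : 0 ≤ ε) (hδ : 0 < δ) (A : Set Ω) :
    P (A ∩ {ω | δ ≤ |Φ.integral W ω|}) ≤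
      ENNReal.ofReal (ε / δ ^ 2) + P (A ∩ {ω | ε < Φ.energy ω}) := by
  classical
  obtain ⟨C, hC⟩ := Φ.bounded
  have h0 : ∀ i, 0 ≤ ((Φ.time (i + 1) : ℝ) - Φ.time i) := fun i =>
    sub_nonneg.2 (by exact_mod_cast Φ.mono (Nat.le_succ i))
  set e : ℕ → Ω → ℝ := fun n ω =>
    ∑ i ∈ Finset.range n, ((Φ.time (i + 1) : ℝ) - Φ.time i) * Φ.coeff i ω ^ 2 with he
  have emono : ∀ ω, Monotone (fun n => e n ω) := fun ω => monotone_nat_of_le_succ fun n => by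
    simp only [he, Finset.sum_range_succ]
    exact le_add_of_nonneg_right (mul_nonneg (h0 n) (sq_nonneg _))
  have em : ∀ n, StronglyMeasurable[𝓕 (Φ.time n)] (e (n + 1)) := fun n =>
    Finset.stronglyMeasurable_fun_sum _ fun i hi => ((((Φ.measurable i).mono
      (𝓕.mono (Φ.mono (Nat.lt_succ_iff.1 (Finset.mem_range.1 hi))))).pow 2).const_mul _)
  -- Coefficients are dropped as soon as the energy, including the present step, exceeds ε. That
  -- energy is already known at time `Φ.time i`, so the cut process is adapted and its energy never
  -- exceeds ε.
  set c : ℕ → Ω → ℝ := fun i => {ω | e (i + 1) ω ≤ ε}.indicator (Φ.coeff i) with hc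
  have cm : ∀ i, StronglyMeasurable[𝓕 (Φ.time i)] (c i) := fun i =>
    (Φ.measurable i).indicator (measurableSet_le (em i).measurable measurable_const)
  have cC : ∀ i ω, ‖c i ω‖ ≤ C := fun i ω => (norm_indicator_le_norm_self _ _).trans (hC i ω)
  obtain ⟨-, hm, hi⟩ := SimpleProcess.memLp_and_integral_sq hW Φ.mono cm cC Φ.num
  set I : Ω → ℝ := fun ω =>
    ∑ i ∈ Finset.range Φ.num, (W (Φ.time (i + 1)) ω - W (Φ.time i) ω) * c i ω with hI
  have hle : ∀ n ω, ∑ i ∈ Finset.range n, ((Φ.time (i + 1) : ℝ) - Φ.time i) * c i ω ^ 2 ≤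
      min ε (e n ω) := by
    intro n ω
    induction n with
    | zero => simp [he, hε]
    | succ n ih =>
      rw [Finset.sum_range_succ]
      by_cases h : e (n + 1) ω ≤ ε
      · have : c n ω = Φ.coeff n ω := Set.indicator_of_mem (s := {ω | e (n + 1) ω ≤ ε}) h _
        rw [min_eq_right h, this]
        simp only [he, Finset.sum_range_succ]
        exact add_le_add_left (ih.trans (min_le_right _ _)) _
      · have : c n ω = 0 := Set.indicator_of_notMem (s := {ω | e (n + 1) ω ≤ ε}) h _
        rw [this, min_eq_left (not_le.1 h).le]
        simpa using ih.trans (min_le_left _ _)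
  have hint : ∫ ω, I ω ^ 2 ∂P ≤ ε := by
    rw [hi]
    refine (integral_mono_of_nonneg (.of_forall fun ω => Finset.sum_nonneg fun i _ =>
      mul_nonneg (h0 i) (sq_nonneg _)) (integrable_const ε)
      (.of_forall fun ω => (hle _ ω).trans (min_le_left _ _))).trans ?_
    simp
  have hcheb : P {ω | δ ≤ |I ω|} ≤ ENNReal.ofReal (ε / δ ^ 2) := by
    have h1 := mul_meas_ge_le_integral_of_nonneg (.of_forall fun ω => sq_nonneg (I ω))
      hm.integrable_sq (δ ^ 2)
    have h2 : {ω | δ ≤ |I ω|} = {ω | δ ^ 2 ≤ I ω ^ 2} := by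
      ext ω
      simp only [Set.mem_ofPred_eq]
      rw [← sq_abs (I ω)]
      exact (pow_le_pow_iff_left₀ hδ.le (abs_nonneg _) two_ne_zero).symm
    rw [h2, ← ENNReal.ofReal_toReal (measure_ne_top P _)]
    refine ENNReal.ofReal_le_ofReal ?_
    rw [le_div_iff₀ (by positivity), mul_comm]
    exact h1.trans hint
  refine (measure_mono (t := {ω | δ ≤ |I ω|} ∪ A ∩ {ω | ε < Φ.energy ω}) ?_).trans
    ((measure_union_le _ _).trans (add_le_add_left hcheb _))
  rintro ω ⟨hA, hω⟩
  by_cases h : ε < Φ.energy ω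
  · exact Or.inr ⟨hA, h⟩
  · left
    have : I ω = Φ.integral W ω := by
      simp only [hI, SimpleProcess.integral, smul_eq_mul]
      refine Finset.sum_congr rfl fun i hi => ?_
      congr 1
      refine Set.indicator_of_mem (s := {ω | e (i + 1) ω ≤ ε}) ?_ _
      exact (emono ω (Finset.mem_range.1 hi)).trans (not_lt.1 h)
    simpa [this] using hω

end Simple

/-! ### Itô integrals -/

section Ito

variable {Ω X : Type*} {mΩ : MeasurableSpace Ω} [NormedAddCommGroup X] [NormedSpace ℝ X]
  {𝓕 : Filtration ℝ≥0 mΩ} {P : Measure Ω} {W : ℝ≥0 → Ω → ℝ}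

lemma ae_aestronglyMeasurable_section [SFinite P] {φ : ℝ≥0 → Ω → X}
    (h : AEStronglyMeasurable (Function.uncurry φ) (leb.prod P)) :
    ∀ᵐ ω ∂P, AEStronglyMeasurable (fun s => φ s ω) leb :=
  (h.comp_quasiMeasurePreserving Measure.measurePreserving_swap.quasiMeasurePreserving).prodMk_left

lemma IsItoIntegral.congr [SFinite P] {φ ψ : ℝ≥0 → Ω → X} {I K : Ω → X}
    (h : IsItoIntegral W 𝓕 P φ I) (hφ : ∀ᵐ ω ∂P, ∀ s, φ s ω = ψ s ω) (hI : I =ᵐ[P] K) :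
    IsItoIntegral W 𝓕 P ψ K := by
  obtain ⟨hm, Φ, h1, h2⟩ := h
  refine ⟨hm.congr ?_, Φ, fun ε hε => (h1 ε hε).congr fun n => measure_congr ?_,
    h2.congr_right hI⟩
  · have := Measure.quasiMeasurePreserving_snd (μ := leb) (ν := P) |>.ae hφ
    filter_upwards [this] with p hp using hp p.1
  · filter_upwards [hφ] with ω hω
    change (ε ≤ _) = (ε ≤ _)
    simp_rw [hω]

lemma enorm_add_sq_le {Z : Type*} [NormedAddCommGroup Z] (x y : Z) :
    ‖x + y‖ₑ ^ 2 ≤ 2 * ‖x‖ₑ ^ 2 + 2 * ‖y‖ₑ ^ 2 := by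
  refine (pow_le_pow_left' (enorm_add_le x y) 2).trans ?_
  have := ENNReal.rpow_add_le_mul_rpow_add_rpow ‖x‖ₑ ‖y‖ₑ (p := 2) (by norm_num)
  norm_num at this
  rw [← mul_add]
  exact this

lemma enorm_sub_sq_le {Z : Type*} [NormedAddCommGroup Z] (x y : Z) :
    ‖x - y‖ₑ ^ 2 ≤ 2 * ‖x‖ₑ ^ 2 + 2 * ‖y‖ₑ ^ 2 := by
  rw [sub_eq_add_neg]
  simpa using enorm_add_sq_le x (-y)

lemma IsItoIntegral.sub [SFinite P] {φ ψ : ℝ≥0 → Ω → X} {I K : Ω → X}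
    (hI : IsItoIntegral W 𝓕 P φ I) (hK : IsItoIntegral W 𝓕 P ψ K) :
    IsItoIntegral W 𝓕 P (fun s ω => φ s ω - ψ s ω) (fun ω => I ω - K ω) := by
  obtain ⟨hm, Φ, h1, h2⟩ := hI
  obtain ⟨hm', Ψ, h1', h2'⟩ := hK
  choose Ξ hΞ hΞ' using fun n => (Φ n).exists_sub (Ψ n)
  refine ⟨hm.sub hm', Ξ, fun ε hε => ?_, ?_⟩
  -- Two terms, each multiplied by 2 in ‖x - y‖² ≤ 2‖x‖² + 2‖y‖².
  · have hε4 : 0 < ε / 4 := ENNReal.div_pos hε.ne' (by norm_num)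
    have h0 := (h1 _ hε4).add (h1' _ hε4)
    rw [add_zero] at h0
    refine tendsto_of_tendsto_of_tendsto_of_le_of_le tendsto_const_nhds h0
      (fun _ => zero_le) (fun n => ?_)
    refine le_trans (measure_mono_ae ?_) (measure_union_le _ _)
    filter_upwards [ae_aestronglyMeasurable_section hm] with ω hω hε'
    change _ ∨ _
    by_contra hcon
    push Not at hcon
    obtain ⟨hc1, hc2⟩ := hcon
    simp only [Set.mem_ofPred_eq, not_le] at hc1 hc2
    refine absurd (show ε ≤ _ from hε') (not_le.2 ?_)
    calc ∫⁻ s, ‖(Ξ n).eval s ω - (φ s ω - ψ s ω)‖ₑ ^ 2 ∂leb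
        ≤ ∫⁻ s, (2 * ‖(Φ n).eval s ω - φ s ω‖ₑ ^ 2 + 2 * ‖(Ψ n).eval s ω - ψ s ω‖ₑ ^ 2) ∂leb := by
          refine lintegral_mono fun s => ?_
          rw [hΞ, sub_sub_sub_comm]
          exact enorm_sub_sq_le _ _
      _ = 2 * ∫⁻ s, ‖(Φ n).eval s ω - φ s ω‖ₑ ^ 2 ∂leb +
          2 * ∫⁻ s, ‖(Ψ n).eval s ω - ψ s ω‖ₑ ^ 2 ∂leb := by
          rw [lintegral_add_left', lintegral_const_mul' _ _ (by norm_num),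
            lintegral_const_mul' _ _ (by norm_num)]
          exact ((((Φ n).measurable_eval ω).aestronglyMeasurable.sub hω).enorm.pow_const 2).const_mul _
      _ < 2 * (ε / 4) + 2 * (ε / 4) := by
          gcongr <;> norm_num
      _ = ε := by
          rw [← add_mul]
          norm_num
          exact ENNReal.mul_div_cancel (by norm_num) (by norm_num)
  · intro ε hε
    have hε2 : 0 < ε / 2 := ENNReal.div_pos hε.ne' (by norm_num)
    have h0 := (h2 _ hε2).add (h2' _ hε2)
    rw [add_zero] at h0
    refine tendsto_of_tendsto_of_tendsto_of_le_of_le tendsto_const_nhds h0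
      (fun _ => zero_le) (fun n => (measure_mono fun ω hω => ?_).trans (measure_union_le _ _))
    by_contra hcon
    simp only [Set.mem_union, Set.mem_ofPred_eq, not_or, not_le] at hcon hω
    refine absurd hω (not_le.2 ?_)
    rw [hΞ']
    calc edist ((Φ n).integral W ω - (Ψ n).integral W ω) (I ω - K ω)
        ≤ edist ((Φ n).integral W ω) (I ω) + edist ((Ψ n).integral W ω) (K ω) := by
          rw [edist_eq_enorm_sub, edist_eq_enorm_sub, edist_eq_enorm_sub, sub_sub_sub_comm]
          exact enorm_sub_le
      _ < ε / 2 + ε / 2 := ENNReal.add_lt_add hcon.1 hcon.2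
      _ = ε := ENNReal.add_halves ε

/-- Locality of the Itô integral: it vanishes on every event on which the integrand vanishes. -/
lemma IsItoIntegral.ae_eq_zero_of_forall_mem [IsProbabilityMeasure P]
    [TopologicalSpace.SeparableSpace X] (hW : IsWienerProcess W 𝓕 P) {φ : ℝ≥0 → Ω → X}
    {I : Ω → X} (h : IsItoIntegral W 𝓕 P φ I) {A : Set Ω}
    (hφ : ∀ᵐ ω ∂P, ω ∈ A → ∀ s, φ s ω = 0) : ∀ᵐ ω ∂P, ω ∈ A → I ω = 0 := by
  obtain ⟨-, Φ, h1, h2⟩ := h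
  have key : A.indicator I =ᵐ[P] 0 := by
    -- In a separable space it suffices to test with each functional separately, which brings in the
    -- scalar Lenglart inequality.
    refine ae_eq_zero_of_forall_dual ℝ fun L => ?_
    have hpos : ∀ m : ℕ, P (A ∩ {ω | 2 * (1 / ((m : ℝ) + 1)) ≤ |L (I ω)|}) = 0 := by
      intro m
      set δ : ℝ := 1 / ((m : ℝ) + 1)
      have hδ : 0 < δ := by positivity
      set K : ℝ := ‖L‖ + 1
      have hK : 0 < K := by positivity
      refine le_antisymm (ENNReal.le_of_forall_pos_le_add fun r hr _ => ?_) zero_le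
      -- Makes the Chebyshev term ε / δ² in Lenglart's inequality equal to the prescribed `r`.
      set ε : ℝ := r * δ ^ 2
      have hε : 0 < ε := by positivity
      -- If |L I| ≥ 2δ, then either the approximating integral has |L ∫Φ_n dW| ≥ δ or it is at
      -- distance at least δ / K from I. The first case is bounded by Lenglart's inequality
      -- restricted to `A`.
      have hb : ∀ n, P (A ∩ {ω | 2 * δ ≤ |L (I ω)|}) ≤
          r + (P {ω | ENNReal.ofReal (ε / K ^ 2) ≤ ∫⁻ s, ‖(Φ n).eval s ω - φ s ω‖ₑ ^ 2 ∂leb} +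
            P {ω | ENNReal.ofReal (δ / K) ≤ edist ((Φ n).integral W ω) (I ω)}) := by
        intro n
        have hL := SimpleProcess.measure_integral_ge_le hW ((Φ n).map L) hε.le hδ A
        have hrr : ENNReal.ofReal (ε / δ ^ 2) = r := by
          simp only [ε]
          rw [mul_div_cancel_right₀ _ (by positivity)]
          simp
        rw [hrr] at hL
        rw [← add_assoc]
        refine le_trans (measure_mono (t := (A ∩ {ω | δ ≤ |((Φ n).map L).integral W ω|}) ∪
          {ω | ENNReal.ofReal (δ / K) ≤ edist ((Φ n).integral W ω) (I ω)}) ?_)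
          ((measure_union_le _ _).trans (add_le_add_left (hL.trans (add_le_add_right
            (measure_mono_ae ?_) _)) _))
        · rintro ω ⟨hA, hω⟩
          by_cases hc : δ ≤ |((Φ n).map L).integral W ω|
          · exact Or.inl ⟨hA, hc⟩
          · right
            simp only [Set.mem_ofPred_eq] at hω ⊢
            rw [SimpleProcess.map_integral] at hc
            rw [edist_dist, dist_eq_norm]
            refine ENNReal.ofReal_le_ofReal ?_
            rw [div_le_iff₀ hK]
            have h4 : |L ((Φ n).integral W ω - I ω)| ≤ ‖L‖ * ‖(Φ n).integral W ω - I ω‖ :=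
              L.le_opNorm _
            have h5 : |L (I ω)| - |L ((Φ n).integral W ω)| ≤ |L ((Φ n).integral W ω - I ω)| := by
              rw [map_sub, abs_sub_comm]
              exact abs_sub_abs_le_abs_sub _ _
            have h6 : ‖L‖ * ‖(Φ n).integral W ω - I ω‖ ≤ ‖(Φ n).integral W ω - I ω‖ * K := by
              rw [mul_comm]
              exact mul_le_mul_of_nonneg_left (by simp [K]) (norm_nonneg _)
            linarith [not_le.1 hc]
        · filter_upwards [hφ] with ω hω
          rintro ⟨hA, he⟩
          have he' : ε < ((Φ n).map L).energy ω := he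
          change ENNReal.ofReal (ε / K ^ 2) ≤ _
          have h7 := (Φ n).energy_map_le L ω
          have h8 : ‖L‖ₑ ^ 2 ≤ ENNReal.ofReal (K ^ 2) := by
            rw [← ofReal_norm, ← ENNReal.ofReal_pow (norm_nonneg _)]
            exact ENNReal.ofReal_le_ofReal (pow_le_pow_left₀ (norm_nonneg _) (by simp [K]) 2)
          have h9 : ENNReal.ofReal ε ≤ ENNReal.ofReal (K ^ 2) *
              ∫⁻ s, ‖(Φ n).eval s ω - φ s ω‖ₑ ^ 2 ∂leb := by
            refine (ENNReal.ofReal_le_ofReal he'.le).trans (h7.trans ?_)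
            -- On `A` the limit integrand is zero, so the energy of `Φ n` is dominated by its
            -- squared distance to `φ`.
            simp only [hω hA, sub_zero]
            gcongr
          rw [ENNReal.ofReal_div_of_pos (by positivity)]
          exact ENNReal.div_le_of_le_mul' h9
      have hlim := (h1 (ENNReal.ofReal (ε / K ^ 2)) (by positivity)).add
        (h2 (ENNReal.ofReal (δ / K)) (by positivity))
      have hlim2 := hlim.const_add (r : ℝ≥0∞)
      rw [add_zero, add_zero] at hlim2
      rw [zero_add]
      exact ge_of_tendsto' hlim2 hb
    have hall : ∀ᵐ ω ∂P, ∀ m : ℕ, ¬ (ω ∈ A ∩ {ω | 2 * (1 / ((m : ℝ) + 1)) ≤ |L (I ω)|}) :=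
      ae_all_iff.2 fun m => measure_eq_zero_iff_ae_notMem.1 (hpos m)
    filter_upwards [hall] with ω hω
    by_cases hA : ω ∈ A
    · rw [Set.indicator_of_mem hA]
      by_contra hne
      have hne' : 0 < |L (I ω)| := abs_pos.2 hne
      obtain ⟨m, hm⟩ := exists_nat_one_div_lt (half_pos hne')
      exact hω m ⟨hA, by simp only [Set.mem_ofPred_eq]; linarith⟩
    · simp [Set.indicator_of_notMem hA]
  filter_upwards [key] with ω hω hA
  rwa [Set.indicator_of_mem hA] at hω

end Ito

/-! ### Path norms -/

section PathNorm

variable {E V X : Type*} [NormedAddCommGroup E] [NormedSpace ℝ E]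
  [NormedAddCommGroup V] [NormedSpace ℝ V] [NormedAddCommGroup X] {j : E →L[ℝ] V}

lemma eNormE_apply (hj : Function.Injective j) (e : E) : eNormE j (j e) = ‖e‖ₑ :=
  hj.extend_apply _ _ _

lemma eNormE_of_notMem {v : V} (hv : v ∉ Set.range j) : eNormE j v = ⊤ :=
  Function.extend_apply' _ _ _ hv

lemma onV_apply (hj : Function.Injective j) (Φ : E → X) (e : E) : onV j Φ (j e) = Φ e :=
  hj.extend_apply _ _ _

lemma mem_range_of_eNormE_ne_top {v : V} (h : eNormE j v ≠ ⊤) : v ∈ Set.range j :=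
  by_contra fun hv => h (eNormE_of_notMem hv)

lemma eNormE_zero (hj : Function.Injective j) : eNormE j (0 : V) = 0 := by
  rw [← map_zero j, eNormE_apply hj]; simp

lemma eNormE_add_le (hj : Function.Injective j) (x y : V) :
    eNormE j (x + y) ≤ eNormE j x + eNormE j y := by
  by_cases hx : x ∈ Set.range j
  · by_cases hy : y ∈ Set.range j
    · obtain ⟨a, rfl⟩ := hx
      obtain ⟨b, rfl⟩ := hy
      rw [← map_add, eNormE_apply hj, eNormE_apply hj, eNormE_apply hj]
      exact enorm_add_le _ _
    · simp [eNormE_of_notMem hy]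
  · simp [eNormE_of_notMem hx]

lemma eNormE_neg (hj : Function.Injective j) (x : V) : eNormE j (-x) = eNormE j x := by
  by_cases hx : x ∈ Set.range j
  · obtain ⟨a, rfl⟩ := hx
    rw [← map_neg, eNormE_apply hj, eNormE_apply hj, enorm_neg]
  · rw [eNormE_of_notMem hx, eNormE_of_notMem]
    rintro ⟨a, ha⟩
    exact hx ⟨-a, by rw [map_neg, ha, neg_neg]⟩

lemma add_sq_le_two_mul (a b : ℝ≥0∞) : (a + b) ^ 2 ≤ 2 * a ^ 2 + 2 * b ^ 2 := by
  have := ENNReal.rpow_add_le_mul_rpow_add_rpow a b (p := 2) (by norm_num)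
  norm_num at this
  rw [← mul_add]
  exact this

section Measurability

variable [CompleteSpace E] [SecondCountableTopology E] [MeasurableSpace V] [BorelSpace V]

lemma measurable_eNormE (hj : Function.Injective j) : Measurable (eNormE j) := by
  borelize E
  exact (j.continuous.measurableEmbedding hj).measurable_extend measurable_enorm measurable_const

lemma stronglyMeasurable_onV (hj : Function.Injective j) {Φ : E → X} (hΦ : Continuous Φ) :
    StronglyMeasurable (onV j Φ) := by
  borelize E
  exact (j.continuous.measurableEmbedding hj).stronglyMeasurable_extend hΦ.stronglyMeasurable
    stronglyMeasurable_const

end Measurability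

/-- The square of the norm of `X_T`. -/
noncomputable def xSq (j : E →L[ℝ] V) (w : ℝ≥0 → V) (T : ℝ≥0) : ℝ≥0∞ :=
  (⨆ s ∈ Set.Iic T, ‖w s‖ₑ ^ 2) + ∫⁻ s in Set.Iic T, eNormE j (w s) ^ 2 ∂leb

lemma rpow_half_sq (a : ℝ≥0∞) : (a ^ (1 / 2 : ℝ)) ^ 2 = a := by
  rw [← ENNReal.rpow_natCast, ← ENNReal.rpow_mul]; norm_num

lemma sq_rpow_half (a : ℝ≥0∞) : (a ^ 2) ^ (1 / 2 : ℝ) = a := by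
  rw [← ENNReal.rpow_natCast, ← ENNReal.rpow_mul]; norm_num

lemma le_of_sq_le_sq {a b : ℝ≥0∞} (h : a ^ 2 ≤ b ^ 2) : a ≤ b := by
  have := ENNReal.rpow_le_rpow h (by norm_num : (0 : ℝ) ≤ 1 / 2)
  rwa [sq_rpow_half, sq_rpow_half] at this

lemma xNorm_sq (w : ℝ≥0 → V) (T : ℝ≥0) : xNorm j w T ^ 2 = xSq j w T := rpow_half_sq _

lemma xNorm_eq (w : ℝ≥0 → V) (T : ℝ≥0) : xNorm j w T = xSq j w T ^ (1 / 2 : ℝ) := rfl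

lemma xNorm_lt_top_iff {w : ℝ≥0 → V} {T : ℝ≥0} : xNorm j w T < ⊤ ↔ xSq j w T < ⊤ := by
  rw [← xNorm_sq]
  simp

lemma xSq_mono (w : ℝ≥0 → V) : Monotone (xSq j w) := fun _ _ h =>
  add_le_add (biSup_mono fun _ hs => le_trans hs h)
    (lintegral_mono_set (Set.Iic_subset_Iic.2 h))

lemma xNorm_mono (w : ℝ≥0 → V) : Monotone (xNorm j w) := fun _ _ h =>
  ENNReal.rpow_le_rpow (xSq_mono w h) (by norm_num)

lemma xSq_congr {w w' : ℝ≥0 → V} {T : ℝ≥0} (h : ∀ s ≤ T, w s = w' s) :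
    xSq j w T = xSq j w' T := by
  unfold xSq
  congr 1
  · exact biSup_congr fun s hs => by rw [h s hs]
  · exact setLIntegral_congr_fun measurableSet_Iic fun s hs => by simp only [h s hs]

lemma xNorm_congr {w w' : ℝ≥0 → V} {T : ℝ≥0} (h : ∀ s ≤ T, w s = w' s) :
    xNorm j w T = xNorm j w' T := by rw [xNorm_eq, xNorm_eq, xSq_congr h]

lemma enorm_sq_le_xSq (w : ℝ≥0 → V) {s T : ℝ≥0} (h : s ≤ T) : ‖w s‖ₑ ^ 2 ≤ xSq j w T :=
  le_add_right (le_iSup₂ (f := fun s (_ : s ∈ Set.Iic T) => ‖w s‖ₑ ^ 2) s h)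

lemma enorm_le_xNorm (w : ℝ≥0 → V) {s T : ℝ≥0} (h : s ≤ T) : ‖w s‖ₑ ≤ xNorm j w T :=
  le_of_sq_le_sq (by rw [xNorm_sq]; exact enorm_sq_le_xSq w h)

lemma lintegral_eNormE_le_xSq (w : ℝ≥0 → V) (T : ℝ≥0) :
    ∫⁻ s in Set.Iic T, eNormE j (w s) ^ 2 ∂leb ≤ xSq j w T := le_add_self

lemma eq_zero_of_xSq_eq_zero {w : ℝ≥0 → V} {T : ℝ≥0} (h : xSq j w T = 0) {s : ℝ≥0} (hs : s ≤ T) :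
    w s = 0 := by
  have := (enorm_sq_le_xSq w hs).trans h.le
  simpa using this

lemma xSq_zero (hj : Function.Injective j) (T : ℝ≥0) : xSq j (fun _ => (0 : V)) T = 0 := by
  simp [xSq, eNormE_zero hj]

lemma xSq_neg (hj : Function.Injective j) (w : ℝ≥0 → V) (T : ℝ≥0) :
    xSq j (fun s => - w s) T = xSq j w T := by
  simp [xSq, eNormE_neg hj]

variable [CompleteSpace E] [SecondCountableTopology E] [MeasurableSpace V] [BorelSpace V]

/-- The crude factor 2 has an advantage over the triangle inequality: only one of the two paths has
to be measurable. -/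
lemma xSq_add_le (hj : Function.Injective j) {w z : ℝ≥0 → V} {T : ℝ≥0} (hw : Measurable w) :
    xSq j (fun s => w s + z s) T ≤ 2 * xSq j w T + 2 * xSq j z T := by
  have h1 : (⨆ s ∈ Set.Iic T, ‖w s + z s‖ₑ ^ 2) ≤
      2 * (⨆ s ∈ Set.Iic T, ‖w s‖ₑ ^ 2) + 2 * (⨆ s ∈ Set.Iic T, ‖z s‖ₑ ^ 2) := by
    refine iSup₂_le fun s hs => (enorm_add_sq_le _ _).trans ?_
    gcongr
    · exact le_iSup₂ (f := fun s (_ : s ∈ Set.Iic T) => ‖w s‖ₑ ^ 2) s hs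
    · exact le_iSup₂ (f := fun s (_ : s ∈ Set.Iic T) => ‖z s‖ₑ ^ 2) s hs
  have h2 : ∫⁻ s in Set.Iic T, eNormE j (w s + z s) ^ 2 ∂leb ≤
      2 * (∫⁻ s in Set.Iic T, eNormE j (w s) ^ 2 ∂leb) +
        2 * (∫⁻ s in Set.Iic T, eNormE j (z s) ^ 2 ∂leb) := by
    rw [← lintegral_const_mul' _ _ (by norm_num), ← lintegral_const_mul' _ _ (by norm_num),
      ← lintegral_add_left (f := fun s => 2 * eNormE j (w s) ^ 2)
        ((((measurable_eNormE hj).comp hw).pow_const 2).const_mul 2)]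
    exact lintegral_mono fun s =>
      (pow_le_pow_left' (eNormE_add_le hj _ _) 2).trans (add_sq_le_two_mul _ _)
  refine (add_le_add h1 h2).trans_eq ?_
  simp only [xSq]
  ring

lemma xSq_sub_le (hj : Function.Injective j) {w z : ℝ≥0 → V} {T : ℝ≥0} (hw : Measurable w) :
    xSq j (fun s => w s - z s) T ≤ 2 * xSq j w T + 2 * xSq j z T := by
  simp only [sub_eq_add_neg]
  rw [← xSq_neg hj z]
  exact xSq_add_le hj hw

/-- The triangle inequality in `X_T`. -/
lemma xNorm_add_le (hj : Function.Injective j) {w z : ℝ≥0 → V} {T : ℝ≥0} (hw : Measurable w)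
    (hz : Measurable z) :
    xNorm j (fun s => w s + z s) T ≤ xNorm j w T + xNorm j z T := by
  set S : (ℝ≥0 → V) → ℝ≥0∞ := fun w => (⨆ s ∈ Set.Iic T, ‖w s‖ₑ ^ 2) ^ (1 / 2 : ℝ) with hS
  set I : (ℝ≥0 → V) → ℝ≥0∞ :=
    fun w => (∫⁻ s in Set.Iic T, eNormE j (w s) ^ 2 ∂leb) ^ (1 / 2 : ℝ) with hI
  have hN : ∀ w, xNorm j w T = (S w ^ 2 + I w ^ 2) ^ (1 / 2 : ℝ) := fun w => by
    simp only [hS, hI, rpow_half_sq]; rfl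
  have hle : ∀ w : ℝ≥0 → V, ∀ s ∈ Set.Iic T, ‖w s‖ₑ ≤ S w := fun w s hs =>
    le_of_sq_le_sq (by
      simp only [hS, rpow_half_sq]
      exact le_iSup₂ (f := fun s (_ : s ∈ Set.Iic T) => ‖w s‖ₑ ^ 2) s hs)
  have h1 : S (fun s => w s + z s) ≤ S w + S z := by
    refine le_of_sq_le_sq ?_
    simp only [hS, rpow_half_sq]
    refine iSup₂_le fun s hs => pow_le_pow_left' ?_ 2
    exact (enorm_add_le _ _).trans (add_le_add (hle w s hs) (hle z s hs))
  have h2 : I (fun s => w s + z s) ≤ I w + I z := by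
    have h3 := ENNReal.lintegral_Lp_add_le (μ := leb.restrict (Set.Iic T)) (p := 2)
      ((measurable_eNormE hj).comp hw).aemeasurable ((measurable_eNormE hj).comp hz).aemeasurable
      (by norm_num)
    simp only [Pi.add_apply, Function.comp_apply, ENNReal.rpow_ofNat] at h3
    refine le_trans (ENNReal.rpow_le_rpow (lintegral_mono fun s => ?_) (by norm_num)) h3
    exact pow_le_pow_left' (eNormE_add_le hj _ _) 2
  -- The norm of `X_T` is the Euclidean norm of the pair (supremum part, L² part), so Minkowski's
  -- inequality in the plane combines `h1` and `h2`.
  have h4 := ENNReal.Lp_add_le Finset.univ ![S w, I w] ![S z, I z] (p := 2) (by norm_num)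
  simp only [Fin.sum_univ_two, Matrix.cons_val_zero, Matrix.cons_val_one, ENNReal.rpow_ofNat] at h4
  rw [hN, hN, hN]
  refine le_trans (ENNReal.rpow_le_rpow ?_ (by norm_num)) h4
  gcongr

end PathNorm

/-! ### Regular processes -/

section Regular

variable {E V X Ω : Type*} [NormedAddCommGroup E] [NormedSpace ℝ E]
  [NormedAddCommGroup V] [NormedSpace ℝ V] [NormedAddCommGroup X] {j : E →L[ℝ] V}
  {mΩ : MeasurableSpace Ω} {𝓕 : Filtration ℝ≥0 mΩ} {P : Measure Ω}

/-- Grid points approach `s` from the left, so that left-continuity is enough for approximation by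
step processes. -/
lemma tendsto_floor_div (s : ℝ≥0) :
    Tendsto (fun n : ℕ => (⌊s * (n + 1)⌋₊ : ℝ≥0) / (n + 1)) atTop (𝓝[≤] s) := by
  refine tendsto_nhdsWithin_iff.2 ⟨?_, .of_forall fun n => ?_⟩
  · rw [← NNReal.tendsto_coe]
    have h1 : Tendsto (fun n : ℕ => (s : ℝ) - 1 / ((n : ℝ) + 1)) atTop (𝓝 (s - 0)) :=
      tendsto_const_nhds.sub tendsto_one_div_add_atTop_nhds_zero_nat
    rw [sub_zero] at h1
    refine tendsto_of_tendsto_of_tendsto_of_le_of_le h1 tendsto_const_nhds (fun n => ?_)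
      fun n => ?_
    · have hp : (0 : ℝ) < n + 1 := by positivity
      push_cast
      rw [le_div_iff₀ hp, sub_mul, one_div, inv_mul_cancel₀ hp.ne']
      have := (Nat.lt_floor_add_one (s * (n + 1) : ℝ≥0)).le
      have h2 : (s : ℝ) * (n + 1) ≤ (⌊s * (n + 1)⌋₊ : ℝ) + 1 := by exact_mod_cast this
      linarith
    · have hp : (0 : ℝ≥0) < n + 1 := by positivity
      have : (⌊s * (n + 1)⌋₊ : ℝ≥0) / (n + 1) ≤ s := by
        rw [div_le_iff₀ hp]
        exact Nat.floor_le zero_le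
      exact_mod_cast this
  · have hp : (0 : ℝ≥0) < n + 1 := by positivity
    rw [Set.mem_Iic, div_le_iff₀ hp]
    exact Nat.floor_le zero_le

/-- A left-continuous process is jointly measurable. -/
lemma measurable_uncurry_of_leftContinuous {m : MeasurableSpace Ω} {Z : Type*}
    [TopologicalSpace Z] [TopologicalSpace.PseudoMetrizableSpace Z] [MeasurableSpace Z]
    [BorelSpace Z] {w : ℝ≥0 → Ω → Z} (hm : ∀ t, Measurable (w t))
    (hc : ∀ ω t, ContinuousWithinAt (fun s => w s ω) (Set.Iic t) t) :
    Measurable (Function.uncurry w) := by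
  refine measurable_of_tendsto_metrizable (f := fun (n : ℕ) (p : ℝ≥0 × Ω) =>
    w ((⌊p.1 * (n + 1)⌋₊ : ℝ≥0) / (n + 1)) p.2) (fun n => ?_) ?_
  · have h1 : Measurable (fun p : ℕ × Ω => w ((p.1 : ℝ≥0) / (n + 1)) p.2) :=
      measurable_from_prod_countable_right fun i =>
      hm ((i : ℝ≥0) / (n + 1))
    have h2 : Measurable (fun p : ℝ≥0 × Ω => (⌊p.1 * (n + 1)⌋₊, p.2)) :=
      (Nat.measurable_floor.comp (measurable_fst.mul_const _)).prodMk measurable_snd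
    exact h1.comp h2
  · rw [tendsto_pi_nhds]
    rintro ⟨s, ω⟩
    exact (hc ω s).tendsto.comp (tendsto_floor_div s)

/-- By left-continuity the value at s > 0 is a limit along points of `D` below s; nothing lies below
0, so 0 must belong to `D`. For countable `D` the right side is jointly measurable in `T` and the
path. -/
lemma iSup_enorm_sq_eq {D : Set ℝ≥0} (hD : Dense D) (h0 : 0 ∈ D) {w : ℝ≥0 → V}
    (hc : ∀ t, ContinuousWithinAt w (Set.Iic t) t) (T : ℝ≥0) :
    (⨆ s ∈ Set.Iic T, ‖w s‖ₑ ^ 2) = ⨆ q ∈ D, if q ≤ T then ‖w q‖ₑ ^ 2 else 0 := by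
  apply le_antisymm
  · refine iSup₂_le fun s hs => ?_
    rcases eq_or_ne s 0 with rfl | hs0
    · refine le_trans ?_ (le_iSup₂ (f := fun q (_ : q ∈ D) => if q ≤ T then ‖w q‖ₑ ^ 2 else 0) 0 h0)
      simp
    · have hcl : s ∈ closure (Set.Iio s ∩ D) := by
        have h1 := hD.open_subset_closure_inter (isOpen_Iio (a := s))
        have h2 := closure_mono h1
        rw [closure_closure, closure_Iio' ⟨0, pos_iff_ne_zero.2 hs0⟩] at h2
        exact h2 (Set.self_mem_Iic)
      have hclosed : IsClosed {x : V | ‖x‖ₑ ^ 2 ≤ ⨆ q ∈ D, if q ≤ T then ‖w q‖ₑ ^ 2 else 0} :=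
        isClosed_le (by fun_prop) continuous_const
      have h3 : ContinuousWithinAt w (Set.Iio s ∩ D) s :=
        (hc s).mono (fun x hx => le_of_lt (Set.mem_Iio.1 hx.1))
      have h4 := h3.mem_closure hcl (t := {x : V | ‖x‖ₑ ^ 2 ≤ ⨆ q ∈ D, if q ≤ T then ‖w q‖ₑ ^ 2 else 0})
        (fun q hq => by
          have hqT : q ≤ T := le_of_lt (lt_of_lt_of_le hq.1 hs)
          refine le_trans ?_
            (le_iSup₂ (f := fun q (_ : q ∈ D) => if q ≤ T then ‖w q‖ₑ ^ 2 else 0) q hq.2)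
          simp [hqT])
      rwa [hclosed.closure_eq] at h4
  · refine iSup₂_le fun q hq => ?_
    split_ifs with h
    · exact le_iSup₂ (f := fun s (_ : s ∈ Set.Iic T) => ‖w s‖ₑ ^ 2) q h
    · exact zero_le

section

variable [CompleteSpace E] [SecondCountableTopology E] [MeasurableSpace V] [BorelSpace V]

lemma measurable_uncurry_xSq (hj : Function.Injective j) {m : MeasurableSpace Ω}
    {w : ℝ≥0 → Ω → V} (hm : ∀ t, Measurable (w t))
    (hc : ∀ ω t, ContinuousWithinAt (fun s => w s ω) (Set.Iic t) t) :
    Measurable (fun p : ℝ≥0 × Ω => xSq j (fun s => w s p.2) p.1) := by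
  obtain ⟨D₀, hD₀, hD₀'⟩ := TopologicalSpace.exists_countable_dense ℝ≥0
  have hD : (insert 0 D₀).Countable := hD₀.insert 0
  have hD' : Dense (insert 0 D₀) := hD₀'.mono (Set.subset_insert _ _)
  simp only [xSq]
  refine Measurable.add ?_ ?_
  · simp only [iSup_enorm_sq_eq hD' (Set.mem_insert _ _) (hc _)]
    refine Measurable.biSup _ hD fun q _ => ?_
    refine Measurable.ite (measurableSet_le measurable_const measurable_fst) ?_ measurable_const
    exact ((hm q).comp measurable_snd).enorm.pow_const 2
  · have h1 : ∀ p : ℝ≥0 × Ω, ∫⁻ s in Set.Iic p.1, eNormE j (w s p.2) ^ 2 ∂leb =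
        ∫⁻ s, (if s ≤ p.1 then eNormE j (w s p.2) ^ 2 else 0) ∂leb := fun p => by
      rw [← lintegral_indicator measurableSet_Iic]
      rfl
    simp only [h1]
    refine Measurable.lintegral_prod_right' (f := fun q : (ℝ≥0 × Ω) × ℝ≥0 =>
      if q.2 ≤ q.1.1 then eNormE j (w q.2 q.1.2) ^ 2 else 0) ?_
    refine Measurable.ite (measurableSet_le (by fun_prop) (by fun_prop)) ?_ measurable_const
    refine ((measurable_eNormE hj).comp ?_).pow_const 2
    exact (measurable_uncurry_of_leftContinuous hm hc).comp
      (measurable_snd.prodMk (measurable_snd.comp measurable_fst))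

end

lemma continuousWithinAt_comp_min {w : ℝ≥0 → V} (hc : ∀ t, ContinuousWithinAt w (Set.Iic t) t)
    (T t : ℝ≥0) : ContinuousWithinAt (fun s => w (min s T)) (Set.Iic t) t :=
  (hc (min t T)).comp (t := Set.Iic (min t T)) (by fun_prop)
    fun _ hs => Set.mem_Iic.2 (min_le_min_right _ hs)

/-- Progressive measurability in disguise: `m` plays the role of `𝓕 t`, and the path stopped at `t`
involves only values known at that time. -/
lemma measurable_pair_of_leftContinuous [CompleteSpace E] [SecondCountableTopology E]
    [MeasurableSpace V] [BorelSpace V] {m : MeasurableSpace Ω} (hj : Function.Injective j)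
    {u : ℝ≥0 → Ω → V} (t : ℝ≥0) (hm : ∀ s, Measurable (u (min s t)))
    (hc : ∀ ω t, ContinuousWithinAt (fun s => u s ω) (Set.Iic t) t) :
    Measurable (fun p : Set.Iic t × Ω => (u p.1 p.2, xSq j (fun s => u s p.2) p.1)) := by
  have hc' : ∀ ω s, ContinuousWithinAt (fun r => u (min r t) ω) (Set.Iic s) s := fun ω s =>
    continuousWithinAt_comp_min (hc ω) t s
  have h1 := measurable_uncurry_of_leftContinuous hm hc'
  have h2 := measurable_uncurry_xSq hj hm hc'
  have h3 : Measurable (fun p : Set.Iic t × Ω => ((p.1 : ℝ≥0), p.2)) :=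
    (measurable_subtype_coe.comp measurable_fst).prodMk measurable_snd
  have h4 := (h1.comp h3).prodMk (h2.comp h3)
  convert h4 using 1
  ext p : 1
  have hp : (p.1 : ℝ≥0) ≤ t := p.1.2
  refine Prod.ext ?_ ?_
  · simp [Function.uncurry, min_eq_left hp]
  · exact xSq_congr fun s hs => by rw [min_eq_left (hs.trans hp)]

/-- A process with left-continuous paths that is adapted and whose paths have finite `X_T`-norm
for all `T`. -/
structure IsRegular (j : E →L[ℝ] V) (𝓕 : Filtration ℝ≥0 mΩ) (u : ℝ≥0 → Ω → V) : Prop where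
  adapted : StronglyAdapted 𝓕 u
  leftCont : ∀ ω t, ContinuousWithinAt (fun s => u s ω) (Set.Iic t) t
  finite : ∀ ω T, xSq j (fun s => u s ω) T < ⊤

namespace IsRegular

lemma zero (hj : Function.Injective j) : IsRegular j 𝓕 (fun _ _ => (0 : V)) where
  adapted _ := stronglyMeasurable_const
  leftCont _ _ := continuousWithinAt_const
  finite ω T := by rw [xSq_zero hj]; exact ENNReal.zero_lt_top

variable [MeasurableSpace V] [BorelSpace V] {u v : ℝ≥0 → Ω → V}

lemma measurable_uncurry (hu : IsRegular j 𝓕 u) : Measurable (Function.uncurry u) :=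
  measurable_uncurry_of_leftContinuous (fun t => ((hu.adapted t).mono (𝓕.le t)).measurable)
    hu.leftCont

lemma measurable_path (hu : IsRegular j 𝓕 u) (ω : Ω) : Measurable (fun s => u s ω) :=
  hu.measurable_uncurry.comp (measurable_prodMk_right (y := ω))

variable [CompleteSpace E] [SecondCountableTopology E]

lemma measurable_uncurry_xSq (hj : Function.Injective j) (hu : IsRegular j 𝓕 u) :
    Measurable (fun p : ℝ≥0 × Ω => xSq j (fun s => u s p.2) p.1) :=
  StochEvol.measurable_uncurry_xSq hj
    (fun t => ((hu.adapted t).mono (𝓕.le t)).measurable) hu.leftCont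

lemma measurable_xSq (hj : Function.Injective j) (hu : IsRegular j 𝓕 u) (T : ℝ≥0) :
    Measurable (fun ω => xSq j (fun s => u s ω) T) := by
  have h : Measurable (fun p : ℝ≥0 × Ω => xSq j (fun s => u s p.2) p.1) :=
    hu.measurable_uncurry_xSq hj
  exact Measurable.comp (f := fun ω : Ω => (T, ω)) h measurable_prodMk_left

lemma sub (hj : Function.Injective j) (hu : IsRegular j 𝓕 u) (hv : IsRegular j 𝓕 v) :
    IsRegular j 𝓕 (fun s ω => u s ω - v s ω) := by
  refine ⟨fun t => ?_, fun ω t => ?_, fun ω T => ?_⟩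
  · exact StronglyMeasurable.sub (hu.adapted t) (hv.adapted t)
  · exact ContinuousWithinAt.sub (hu.leftCont ω t) (hv.leftCont ω t)
  · have h := xSq_sub_le (z := fun s => v s ω) (T := T) hj (hu.measurable_path ω)
    refine h.trans_lt (ENNReal.add_lt_top.2 ⟨?_, ?_⟩)
    · exact ENNReal.mul_lt_top (by simp) (hu.finite ω T)
    · exact ENNReal.mul_lt_top (by simp) (hv.finite ω T)

/-- The value of a regular process and the norm of its path up to the present are jointly
progressive. -/
lemma measurable_pair (hj : Function.Injective j) (hu : IsRegular j 𝓕 u) (t : ℝ≥0) :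
    Measurable[Subtype.instMeasurableSpace.prod (𝓕 t)] (fun p : Set.Iic t × Ω =>
      (u p.1 p.2, xSq j (fun s => u s p.2) p.1)) :=
  @measurable_pair_of_leftContinuous E V Ω _ _ _ _ j _ _ _ _ (𝓕 t) hj u t
    (fun s => ((hu.adapted _).mono (𝓕.mono (min_le_right s t))).measurable) hu.leftCont

end IsRegular

end Regular

/-! ### Estimates for the truncated nonlinearities -/

section Estimates

/-- Young's inequality, by distinguishing d ≤ δx and d ≥ δx with the threshold fixed by δ^(2(1-α)) =
η. That η may be arbitrarily small is where α < 1 is used. -/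
lemma exists_rpow_mul_rpow_sq_le {α η : ℝ} (hα : 0 ≤ α) (hα1 : α < 1) (hη : 0 < η) :
    ∃ C : ℝ, 0 ≤ C ∧ ∀ x d : ℝ, 0 ≤ x → 0 ≤ d →
      (x ^ α * d ^ (1 - α)) ^ 2 ≤ η * x ^ 2 + C * d ^ 2 := by
  have hα' : 0 < 1 - α := by linarith
  set δ : ℝ := η ^ (1 / (2 * (1 - α))) with hδ
  have hδ0 : 0 < δ := Real.rpow_pos_of_pos hη _
  have hδ2 : (δ ^ (1 - α)) ^ 2 = η := by
    rw [← Real.rpow_natCast, ← Real.rpow_mul hδ0.le, hδ, ← Real.rpow_mul hη.le]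
    have : 1 / (2 * (1 - α)) * ((1 - α) * ((2 : ℕ) : ℝ)) = 1 := by
      push_cast
      field_simp
    rw [this, Real.rpow_one]
  refine ⟨((1 / δ) ^ α) ^ 2, by positivity, fun x d hx hd => ?_⟩
  rcases le_total d (δ * x) with h | h
  · have h1 : x ^ α * d ^ (1 - α) ≤ δ ^ (1 - α) * x := by
      calc x ^ α * d ^ (1 - α) ≤ x ^ α * (δ * x) ^ (1 - α) := by gcongr
        _ = δ ^ (1 - α) * (x ^ α * x ^ (1 - α)) := by
          rw [Real.mul_rpow hδ0.le hx]; ring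
        _ = δ ^ (1 - α) * x := by
          rw [← Real.rpow_add_of_nonneg hx hα hα'.le, add_sub_cancel, Real.rpow_one]
    calc (x ^ α * d ^ (1 - α)) ^ 2 ≤ (δ ^ (1 - α) * x) ^ 2 := by gcongr
      _ = η * x ^ 2 := by rw [mul_pow, hδ2]
      _ ≤ _ := le_add_of_nonneg_right (by positivity)
  · have hx' : x ≤ 1 / δ * d := by
      rw [one_div, inv_mul_eq_div, le_div_iff₀ hδ0, mul_comm]; exact h
    have h1 : x ^ α * d ^ (1 - α) ≤ (1 / δ) ^ α * d := by
      calc x ^ α * d ^ (1 - α) ≤ (1 / δ * d) ^ α * d ^ (1 - α) := by gcongr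
        _ = (1 / δ) ^ α * (d ^ α * d ^ (1 - α)) := by
          rw [Real.mul_rpow (by positivity) hd]; ring
        _ = (1 / δ) ^ α * d := by
          rw [← Real.rpow_add_of_nonneg hd hα hα'.le, add_sub_cancel, Real.rpow_one]
    calc (x ^ α * d ^ (1 - α)) ^ 2 ≤ ((1 / δ) ^ α * d) ^ 2 := by gcongr
      _ = ((1 / δ) ^ α) ^ 2 * d ^ 2 := by rw [mul_pow]
      _ ≤ _ := le_add_of_nonneg_left (by positivity)

lemma exists_mul_rpow_mul_rpow_sq_le {α η K : ℝ} (hα : 0 ≤ α) (hα1 : α < 1) (hη : 0 < η)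
    (hK : 0 ≤ K) :
    ∃ C : ℝ, 0 ≤ C ∧ ∀ x d : ℝ, 0 ≤ x → 0 ≤ d →
      K * (x ^ α * d ^ (1 - α)) ^ 2 ≤ η * x ^ 2 + C * d ^ 2 := by
  obtain ⟨C, hC, h⟩ := exists_rpow_mul_rpow_sq_le hα hα1 (η := η / (K + 1)) (by positivity)
  refine ⟨K * C, by positivity, fun x d hx hd => ?_⟩
  have h1 := mul_le_mul_of_nonneg_left (h x d hx hd) hK
  have h2 : K * (η / (K + 1)) ≤ η := by
    rw [mul_div_assoc', div_le_iff₀ (by positivity)]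
    nlinarith
  calc _ ≤ _ := h1
    _ = K * (η / (K + 1)) * x ^ 2 + K * C * d ^ 2 := by ring
    _ ≤ _ := by gcongr

lemma add_sq_le_real (a b : ℝ) : (a + b) ^ 2 ≤ 2 * a ^ 2 + 2 * b ^ 2 := by
  nlinarith [sq_nonneg (a - b)]

namespace IsCutoff

variable {θ : ℝ → ℝ}

/-- A smooth function is Lipschitz on the compact interval [0, 2], and the cutoff is constant from 2
on, so θ x = θ (min x 2). -/
lemma exists_lipschitz (hθ : IsCutoff θ) :
    ∃ L : ℝ, 0 ≤ L ∧ ∀ x y, 0 ≤ x → 0 ≤ y → |θ x - θ y| ≤ L * |x - y| := by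
  obtain ⟨K, hK⟩ := (hθ.smooth.mono (Set.Icc_subset_Ici_self (a := (2 : ℝ)) (b := 0))
    ).exists_lipschitzOnWith (by simp) (convex_Icc _ _) isCompact_Icc
  have h1 : ∀ x y, 0 ≤ x → 0 ≤ y → θ x = θ (min x 2) ∧ θ y = θ (min y 2) := by
    have : ∀ x, 0 ≤ x → θ x = θ (min x 2) := fun x hx => by
      rcases le_total x 2 with h | h
      · rw [min_eq_left h]
      · rw [min_eq_right h, (hθ.eq_zero_iff x hx).2 h, (hθ.eq_zero_iff 2 (by norm_num)).2 le_rfl]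
    exact fun x y hx hy => ⟨this x hx, this y hy⟩
  refine ⟨K, K.2, fun x y hx hy => ?_⟩
  obtain ⟨e1, e2⟩ := h1 x y hx hy
  rw [e1, e2]
  have h2 := hK.dist_le_mul (min x 2) ⟨le_min hx (by norm_num), min_le_right _ _⟩ (min y 2)
    ⟨le_min hy (by norm_num), min_le_right _ _⟩
  rw [Real.dist_eq, Real.dist_eq] at h2
  refine h2.trans (mul_le_mul_of_nonneg_left ?_ K.2)
  simpa using abs_min_sub_min_le_max x 2 y 2

/-- Nothing is known about `θ` on negative numbers; this modification is continuous on the whole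
line and serves measurability arguments. -/
lemma continuous_max (hθ : IsCutoff θ) : Continuous (fun x => θ (max x 0)) :=
  hθ.smooth.continuousOn.comp_continuous (by fun_prop) fun x => Set.mem_Ici.2 (le_max_right _ _)

lemma eq_zero (hθ : IsCutoff θ) {N R : ℝ} (hR : 0 < R) (hN : 2 * R ≤ N) : θ (N / R) = 0 := by
  have h2 : 2 ≤ N / R := by rwa [le_div_iff₀ hR]
  exact (hθ.eq_zero_iff _ (by linarith)).2 h2

lemma eq_one (hθ : IsCutoff θ) {N R : ℝ} (hR : 0 < R) (h0 : 0 ≤ N) (hN : N ≤ R) :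
    θ (N / R) = 1 :=
  (hθ.eq_one_iff _ (by positivity)).2 ((div_le_one hR).2 hN)

lemma abs_le_one (hθ : IsCutoff θ) {x : ℝ} (hx : 0 ≤ x) : |θ x| ≤ 1 := by
  rw [abs_of_nonneg (hθ.mem_Icc x hx).1]
  exact (hθ.mem_Icc x hx).2

end IsCutoff

namespace PolyLocallyLipschitz

variable {E V X : Type*} [NormedAddCommGroup E] [NormedSpace ℝ E]
  [NormedAddCommGroup V] [NormedSpace ℝ V] [NormedAddCommGroup X]
  {j : E →L[ℝ] V} {Φ : E → X} {θ : ℝ → ℝ}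

/-- As y tends to x, the first term vanishes through ‖j (y - x)‖ and the second through its power 1
- α > 0. Continuity is what makes `onV j Φ` measurable. -/
lemma continuous (hΦ : PolyLocallyLipschitz j Φ) : Continuous Φ := by
  obtain ⟨-, p, α, C, hp, hα, hα1, hC, h⟩ := hΦ
  refine continuous_iff_continuousAt.2 fun x => tendsto_iff_norm_sub_tendsto_zero.2 ?_
  have hcont : Continuous (fun y : E => C * (‖j (y - x)‖ * ‖j y‖ ^ (p - α) * ‖y‖ ^ α
      + ‖y - x‖ ^ α * ‖j (y - x)‖ ^ (1 - α) * ‖j x‖ ^ p)) := by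
    refine continuous_const.mul (((Continuous.mul (by fun_prop) ?_).mul ?_).add
      ((Continuous.mul ?_ ?_).mul continuous_const))
    · exact (by fun_prop : Continuous fun y : E => ‖j y‖).rpow_const fun _ => Or.inr (by linarith)
    · exact continuous_norm.rpow_const fun _ => Or.inr hα
    · exact (by fun_prop : Continuous fun y : E => ‖y - x‖).rpow_const fun _ => Or.inr hα
    · exact (by fun_prop : Continuous fun y : E => ‖j (y - x)‖).rpow_const
        fun _ => Or.inr (by linarith)
  have h0 := hcont.tendsto x
  simp only [sub_self, map_zero, norm_zero, zero_mul, zero_add] at h0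
  rw [Real.zero_rpow (by linarith : 1 - α ≠ 0), mul_zero, zero_mul, mul_zero] at h0
  exact squeeze_zero (fun _ => norm_nonneg _) (fun y => h x y) h0

/-- The condition at x = 0 gives ‖Φ e‖ ≤ C ‖j e‖^(1+p-α) ‖e‖^α, which is sublinear in ‖e‖, so
Young's inequality applies with d = 1. -/
lemma exists_norm_sq_le (hΦ : PolyLocallyLipschitz j Φ) {M η : ℝ} (hM : 0 ≤ M) (hη : 0 < η) :
    ∃ C : ℝ, 0 ≤ C ∧ ∀ e, ‖j e‖ ≤ M → ‖Φ e‖ ^ 2 ≤ η * ‖e‖ ^ 2 + C := by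
  obtain ⟨h0, p, α, C, hp, hα, hα1, hC, h⟩ := hΦ
  obtain ⟨D, hD, hD'⟩ := exists_mul_rpow_mul_rpow_sq_le hα hα1 hη
    (K := (C * (M * M ^ (p - α))) ^ 2) (by positivity)
  refine ⟨D, hD, fun e he => ?_⟩
  have h1 := h 0 e
  have hp0 : (0 : ℝ) ^ p = 0 := Real.zero_rpow (by linarith)
  simp only [h0, sub_zero, map_zero, norm_zero, hp0, mul_zero, add_zero] at h1
  have h2 : ‖Φ e‖ ≤ C * (M * M ^ (p - α)) * ‖e‖ ^ α := by
    have hpα : 0 ≤ p - α := by linarith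
    calc ‖Φ e‖ ≤ _ := h1
      _ ≤ C * (M * M ^ (p - α) * ‖e‖ ^ α) := by gcongr
      _ = _ := by ring
  have h3 := hD' ‖e‖ 1 (norm_nonneg _) zero_le_one
  rw [Real.one_rpow, mul_one, one_pow, mul_one, ← mul_pow] at h3
  exact (pow_le_pow_left₀ (norm_nonneg _) h2 2).trans h3

/-- Pointwise Lipschitz estimate for the truncated nonlinearity. -/
lemma exists_cutoff_sub_sq_le [NormedSpace ℝ X] (hΦ : PolyLocallyLipschitz j Φ) (hθ : IsCutoff θ)
    {R η : ℝ} (hR : 0 < R) (hη : 0 < η) :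
    ∃ C : ℝ, 0 ≤ C ∧ ∀ (e₁ e₂ : E) (N₁ N₂ d : ℝ), 0 ≤ N₁ → 0 ≤ N₂ → 0 ≤ d →
      ‖j e₁‖ ≤ N₁ → ‖j e₂‖ ≤ N₂ → |N₁ - N₂| ≤ d → ‖j (e₁ - e₂)‖ ≤ d →
      ‖θ (N₁ / R) • Φ e₁ - θ (N₂ / R) • Φ e₂‖ ^ 2 ≤
        d ^ 2 * (η * ((if N₁ < 2 * R then ‖e₁‖ ^ 2 else 0) +
          (if N₂ < 2 * R then ‖e₂‖ ^ 2 else 0))) + η * ‖e₁ - e₂‖ ^ 2 + C * d ^ 2 := by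
  obtain ⟨L, hL, hLip⟩ := hθ.exists_lipschitz
  -- `L / R` is the Lipschitz constant of N ↦ θ (N / R); the 2 comes from squaring a sum.
  set K : ℝ := 2 * (L / R) ^ 2 with hK
  have hK0 : 0 ≤ K := by positivity
  obtain ⟨C₁, hC₁, hgrow⟩ := hΦ.exists_norm_sq_le (M := 2 * R) (η := η / (K + 1)) (by positivity)
    (by positivity)
  obtain ⟨-, p, α, C₀, hp, hα, hα1, hC₀, h⟩ := hΦ
  have hpα : 0 ≤ p - α := by linarith
  -- The factor 4 here and below comes from squaring a sum twice; below the level 2R the powers of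
  -- the V-norms are bounded by powers of 2R.
  obtain ⟨C₂, hC₂, hY₂⟩ := exists_mul_rpow_mul_rpow_sq_le hα hα1 hη
    (K := 4 * (C₀ * (2 * R) ^ (p - α)) ^ 2) (by positivity)
  obtain ⟨C₃, hC₃, hY₃⟩ := exists_mul_rpow_mul_rpow_sq_le hα hα1 hη
    (K := 4 * (C₀ * (2 * R) ^ p) ^ 2) (by positivity)
  have hgrow' : ∀ e, ‖j e‖ ≤ 2 * R → K * ‖Φ e‖ ^ 2 ≤ η * ‖e‖ ^ 2 + K * C₁ := fun e he => by
    have h1 := mul_le_mul_of_nonneg_left (hgrow e he) hK0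
    have h2 : K * (η / (K + 1)) ≤ η := by
      rw [mul_div_assoc', div_le_iff₀ (by positivity)]
      nlinarith
    calc _ ≤ _ := h1
      _ = K * (η / (K + 1)) * ‖e‖ ^ 2 + K * C₁ := by ring
      _ ≤ _ := by gcongr
  have hθd : ∀ N₁ N₂ d : ℝ, 0 ≤ N₁ → 0 ≤ N₂ → |N₁ - N₂| ≤ d →
      |θ (N₁ / R) - θ (N₂ / R)| ≤ L / R * d := fun N₁ N₂ d h1 h2 h3 => by
    refine (hLip _ _ (by positivity) (by positivity)).trans ?_
    rw [← sub_div, abs_div, abs_of_pos hR, mul_div_assoc', mul_comm L, mul_div_assoc, mul_comm]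
    gcongr
  -- the contribution of the difference of the cutoff factors
  have hcut : ∀ (e : E) (N₁ N₂ d : ℝ), 0 ≤ N₁ → 0 ≤ N₂ → |N₁ - N₂| ≤ d → ‖j e‖ ≤ 2 * R →
      2 * ‖(θ (N₁ / R) - θ (N₂ / R)) • Φ e‖ ^ 2 ≤ d ^ 2 * (η * ‖e‖ ^ 2 + K * C₁) := by
    intro e N₁ N₂ d h1 h2 h3 he
    have hd : 0 ≤ d := (abs_nonneg _).trans h3
    calc 2 * ‖(θ (N₁ / R) - θ (N₂ / R)) • Φ e‖ ^ 2
        = 2 * (|θ (N₁ / R) - θ (N₂ / R)| ^ 2 * ‖Φ e‖ ^ 2) := by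
          rw [norm_smul, mul_pow, Real.norm_eq_abs]
      _ ≤ 2 * ((L / R * d) ^ 2 * ‖Φ e‖ ^ 2) := by
          gcongr
          exact hθd _ _ _ h1 h2 h3
      _ = d ^ 2 * (K * ‖Φ e‖ ^ 2) := by rw [hK]; ring
      _ ≤ _ := by gcongr; exact hgrow' e he
  refine ⟨K * C₁ + C₂ + C₃, by positivity, fun e₁ e₂ N₁ N₂ d hN₁ hN₂ hd he₁ he₂ hN hde => ?_⟩
  by_cases l₁ : N₁ < 2 * R
  · by_cases l₂ : N₂ < 2 * R
    · rw [if_pos l₁, if_pos l₂]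
      -- The difference of cutoffs is paid for by the growth of Φ at e₂, the difference of values by
      -- the Lipschitz condition. Bare E-norms are thus multiplied by d² and occur only at points
      -- with N < 2R.
      have e : θ (N₁ / R) • Φ e₁ - θ (N₂ / R) • Φ e₂ =
          (θ (N₁ / R) - θ (N₂ / R)) • Φ e₂ + θ (N₁ / R) • (Φ e₁ - Φ e₂) := by
        rw [sub_smul, smul_sub]; abel
      have h1 := hcut e₂ N₁ N₂ d hN₁ hN₂ hN (he₂.trans l₂.le)
      have h2 : ‖θ (N₁ / R) • (Φ e₁ - Φ e₂)‖ ≤ C₀ * (2 * R) ^ (p - α) * (‖e₁‖ ^ α * d) +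
          C₀ * (2 * R) ^ p * (‖e₁ - e₂‖ ^ α * d ^ (1 - α)) := by
        rw [norm_smul]
        have : ‖θ (N₁ / R)‖ ≤ 1 := hθ.abs_le_one (by positivity)
        calc _ ≤ 1 * ‖Φ e₁ - Φ e₂‖ := by gcongr
          _ ≤ C₀ * (‖j (e₁ - e₂)‖ * ‖j e₁‖ ^ (p - α) * ‖e₁‖ ^ α
                + ‖e₁ - e₂‖ ^ α * ‖j (e₁ - e₂)‖ ^ (1 - α) * ‖j e₂‖ ^ p) := by
              rw [one_mul]; exact h e₂ e₁
          _ ≤ C₀ * (d * (2 * R) ^ (p - α) * ‖e₁‖ ^ α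
                + ‖e₁ - e₂‖ ^ α * d ^ (1 - α) * (2 * R) ^ p) := by
              have := he₁.trans l₁.le
              have := he₂.trans l₂.le
              gcongr
          _ = _ := by ring
      have h3 := hY₂ ‖e₁‖ 1 (norm_nonneg _) zero_le_one
      rw [Real.one_rpow, mul_one, one_pow, mul_one] at h3
      have h4 := hY₃ ‖e₁ - e₂‖ d (norm_nonneg _) hd
      calc ‖θ (N₁ / R) • Φ e₁ - θ (N₂ / R) • Φ e₂‖ ^ 2
          ≤ (‖(θ (N₁ / R) - θ (N₂ / R)) • Φ e₂‖ + ‖θ (N₁ / R) • (Φ e₁ - Φ e₂)‖) ^ 2 := by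
            rw [e]; gcongr; exact norm_add_le _ _
        _ ≤ 2 * ‖(θ (N₁ / R) - θ (N₂ / R)) • Φ e₂‖ ^ 2 +
              2 * ‖θ (N₁ / R) • (Φ e₁ - Φ e₂)‖ ^ 2 := add_sq_le_real _ _
        _ ≤ d ^ 2 * (η * ‖e₂‖ ^ 2 + K * C₁) +
              2 * (2 * (C₀ * (2 * R) ^ (p - α) * (‖e₁‖ ^ α * d)) ^ 2 +
                2 * (C₀ * (2 * R) ^ p * (‖e₁ - e₂‖ ^ α * d ^ (1 - α))) ^ 2) := by
            gcongr
            exact (pow_le_pow_left₀ (norm_nonneg _) h2 2).trans (add_sq_le_real _ _)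
        _ = d ^ 2 * (η * ‖e₂‖ ^ 2 + K * C₁) +
              d ^ 2 * (4 * (C₀ * (2 * R) ^ (p - α)) ^ 2 * (‖e₁‖ ^ α) ^ 2) +
              4 * (C₀ * (2 * R) ^ p) ^ 2 * (‖e₁ - e₂‖ ^ α * d ^ (1 - α)) ^ 2 := by ring
        _ ≤ d ^ 2 * (η * ‖e₂‖ ^ 2 + K * C₁) + d ^ 2 * (η * ‖e₁‖ ^ 2 + C₂) +
              (η * ‖e₁ - e₂‖ ^ 2 + C₃ * d ^ 2) := by gcongr
        _ = _ := by ring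
    -- The second cutoff is zero, so the surviving factor θ(N₁/R) is itself a difference of cutoffs,
    -- bounded by (L/R) d.
    · rw [hθ.eq_zero hR (not_lt.1 l₂), if_pos l₁, if_neg l₂, zero_smul, sub_zero]
      have h1 := hcut e₁ N₁ N₂ d hN₁ hN₂ hN (he₁.trans l₁.le)
      rw [hθ.eq_zero hR (not_lt.1 l₂), sub_zero] at h1
      have : 0 ≤ η * ‖e₁ - e₂‖ ^ 2 + (C₂ + C₃) * d ^ 2 := by positivity
      nlinarith [sq_nonneg ‖θ (N₁ / R) • Φ e₁‖]
  · by_cases l₂ : N₂ < 2 * R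
    · rw [hθ.eq_zero hR (not_lt.1 l₁), if_neg l₁, if_pos l₂, zero_smul, zero_sub, norm_neg]
      have h1 := hcut e₂ N₁ N₂ d hN₁ hN₂ hN (he₂.trans l₂.le)
      rw [hθ.eq_zero hR (not_lt.1 l₁), zero_sub, neg_smul, norm_neg] at h1
      have : 0 ≤ η * ‖e₁ - e₂‖ ^ 2 + (C₂ + C₃) * d ^ 2 := by positivity
      nlinarith [sq_nonneg ‖θ (N₂ / R) • Φ e₂‖]
    · rw [hθ.eq_zero hR (not_lt.1 l₁), hθ.eq_zero hR (not_lt.1 l₂), if_neg l₁, if_neg l₂]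
      simp only [zero_smul, sub_self, norm_zero]
      rw [zero_pow two_ne_zero]
      positivity

end PolyLocallyLipschitz

/-- An integral over an initial segment of time is the supremum of the integrals over `[0, t]`. -/
lemma setLIntegral_le_of_isLowerSet {L : Set ℝ≥0} (hL : IsLowerSet L) (g : ℝ≥0 → ℝ≥0∞) {c : ℝ≥0∞}
    (h : ∀ t ∈ L, ∫⁻ s in Set.Iic t, g s ∂leb ≤ c) : ∫⁻ s in L, g s ∂leb ≤ c := by
  obtain ⟨D, hD, hD'⟩ := TopologicalSpace.exists_countable_dense ℝ≥0
  set ι := {q : ℝ≥0 // q ∈ D ∩ L}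
  have : Countable ι := (hD.mono Set.inter_subset_left).to_subtype
  -- Only a maximum of `L` can escape the intervals ending at points of the countable set, and a
  -- single point is null.
  have hsub : (L \ ⋃ q : ι, Set.Iic (q : ℝ≥0)).Subsingleton := by
    intro x hx y hy
    by_contra hne
    wlog hxy : x < y generalizing x y
    · exact this hy hx (Ne.symm hne) (lt_of_le_of_ne (not_lt.1 hxy) (Ne.symm hne))
    obtain ⟨q, hq, hq'⟩ := hD'.exists_between hxy
    exact hx.2 (Set.mem_iUnion.2 ⟨⟨q, hq, hL hq'.2.le hy.1⟩, hq'.1.le⟩)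
  have hnull : leb (L \ ⋃ q : ι, Set.Iic (q : ℝ≥0)) = 0 := hsub.measure_zero leb
  have hle : ∫⁻ s in L, g s ∂leb ≤ ∫⁻ s in ⋃ q : ι, Set.Iic (q : ℝ≥0), g s ∂leb :=
    lintegral_mono' (Measure.restrict_mono_ae (ae_le_set.2 hnull)) le_rfl
  refine hle.trans ?_
  rw [setLIntegral_iUnion_of_directed]
  · exact iSup_le fun q => h q q.2.2
  · intro a b
    rcases le_total (a : ℝ≥0) b with h | h
    · exact ⟨b, Set.Iic_subset_Iic.2 h, subset_rfl⟩
    · exact ⟨a, subset_rfl, Set.Iic_subset_Iic.2 h⟩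

/-! ### Truncated nonlinearities along paths -/

section Trunc

variable {E V X Ω : Type*} [NormedAddCommGroup E] [NormedSpace ℝ E]
  [NormedAddCommGroup V] [NormedSpace ℝ V] [NormedAddCommGroup X] [NormedSpace ℝ X]
  {j : E →L[ℝ] V} {Φ : E → X} {θ : ℝ → ℝ}
  {mΩ : MeasurableSpace Ω} {𝓕 : Filtration ℝ≥0 mΩ}

/-- The nonlinearity truncated at level `R`, along a path. -/
noncomputable def trunc (j : E →L[ℝ] V) (θ : ℝ → ℝ) (R : ℝ) (Φ : E → X) (w : ℝ≥0 → V) (r : ℝ≥0) :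
    X :=
  θ ((xNorm j w r).toReal / R) • onV j Φ (w r)

lemma trunc_eq_onV (hθ : IsCutoff θ) {R : ℝ} (hR : 0 < R) {w : ℝ≥0 → V} {r : ℝ≥0}
    (h : xNorm j w r ≤ ENNReal.ofReal R) : trunc j θ R Φ w r = onV j Φ (w r) := by
  rw [trunc, hθ.eq_one hR ENNReal.toReal_nonneg (ENNReal.toReal_le_of_le_ofReal hR.le h), one_smul]

/-- Because |θ| ≤ 1, the constant is the same for all truncation levels `R`, as the explosion
argument requires. Outside `E` the right side is infinite, since η > 0. -/
lemma exists_enorm_trunc_sq_le (hj : Function.Injective j) (hΦ : PolyLocallyLipschitz j Φ)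
    (hθ : IsCutoff θ) (M : ℝ≥0) {η : ℝ≥0} (hη : 0 < η) :
    ∃ C : ℝ≥0, ∀ (R : ℝ), 0 < R → ∀ (w : ℝ≥0 → V) (s : ℝ≥0), ‖w s‖ₑ ≤ M →
      ‖trunc j θ R Φ w s‖ₑ ^ 2 ≤ η * eNormE j (w s) ^ 2 + C := by
  obtain ⟨C, hC, h⟩ := hΦ.exists_norm_sq_le M.2 (NNReal.coe_pos.2 hη)
  refine ⟨C.toNNReal, fun R hR w s hs => ?_⟩
  by_cases hr : w s ∈ Set.range j
  · obtain ⟨e, he⟩ := hr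
    rw [trunc, ← he, onV_apply hj, eNormE_apply hj]
    rw [← he] at hs
    have h1 : ‖j e‖ ≤ M := by
      have : ‖j e‖₊ ≤ M := by exact_mod_cast hs
      exact this
    have h2 := h e h1
    have h3 : ‖θ ((xNorm j w s).toReal / R) • Φ e‖ ^ 2 ≤ η * ‖e‖ ^ 2 + C := by
      refine le_trans (pow_le_pow_left₀ (norm_nonneg _) ?_ 2) h2
      rw [norm_smul]
      refine mul_le_of_le_one_left (norm_nonneg _) (hθ.abs_le_one (by positivity))
    calc ‖θ ((xNorm j w s).toReal / R) • Φ e‖ₑ ^ 2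
        = ENNReal.ofReal (‖θ ((xNorm j w s).toReal / R) • Φ e‖ ^ 2) := by
          rw [ENNReal.ofReal_pow (norm_nonneg _), ofReal_norm]
      _ ≤ ENNReal.ofReal (η * ‖e‖ ^ 2 + C) := ENNReal.ofReal_le_ofReal h3
      _ = _ := by
          rw [ENNReal.ofReal_add (by positivity) hC, ENNReal.ofReal_mul (p := (η : ℝ)) η.2,
            ENNReal.ofReal_pow (norm_nonneg _), ofReal_norm, ENNReal.ofReal_coe_nnreal]
          rfl
  · have : η * eNormE j (w s) ^ 2 = ⊤ := by
      rw [eNormE_of_notMem hr, ENNReal.top_pow two_ne_zero, ENNReal.mul_top]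
      simpa using hη.ne'
    rw [this, top_add]
    exact le_top

section

variable [CompleteSpace E] [SecondCountableTopology E] [MeasurableSpace V] [BorelSpace V]
  [SecondCountableTopology V]

lemma ae_eNormE_ne_top (hj : Function.Injective j) {w : ℝ≥0 → V} {T : ℝ≥0} (hw : Measurable w)
    (hT : xSq j w T < ⊤) : ∀ᵐ s ∂leb.restrict (Set.Iic T), eNormE j (w s) ≠ ⊤ := by
  have h1 : ∫⁻ s in Set.Iic T, eNormE j (w s) ^ 2 ∂leb ≠ ⊤ :=
    ((lintegral_eNormE_le_xSq w T).trans_lt hT).ne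
  filter_upwards [ae_lt_top ((((measurable_eNormE hj).comp hw).pow_const 2)) h1] with s hs h
  simp [h] at hs

/-- The times with norm below 2R form an initial segment, and over each [0, t] inside it the
E-integral is part of |w|²_{X_t} < (2R)². -/
lemma lintegral_below_level_le {w : ℝ≥0 → V} {T : ℝ≥0} {R : ℝ} (hT : xSq j w T < ⊤) :
    ∫⁻ s in Set.Iic T, (if (xNorm j w s).toReal < 2 * R then eNormE j (w s) ^ 2 else 0) ∂leb ≤
      ENNReal.ofReal ((2 * R) ^ 2) := by
  set L : Set ℝ≥0 := {s | s ≤ T ∧ (xNorm j w s).toReal < 2 * R} with hLdef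
  have hfin : ∀ s ≤ T, xNorm j w s ≠ ⊤ := fun s hs =>
    (xNorm_lt_top_iff.2 ((xSq_mono w hs).trans_lt hT)).ne
  have hL : IsLowerSet L := fun a b hba ha => ⟨hba.trans ha.1,
    (ENNReal.toReal_mono (hfin a ha.1) (xNorm_mono w hba)).trans_lt ha.2⟩
  have hLm : MeasurableSet L := hL.ordConnected.measurableSet
  have h1 : ∫⁻ s in Set.Iic T,
      (if (xNorm j w s).toReal < 2 * R then eNormE j (w s) ^ 2 else 0) ∂leb =
      ∫⁻ s in L, eNormE j (w s) ^ 2 ∂leb := by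
    rw [← lintegral_indicator measurableSet_Iic, ← lintegral_indicator hLm]
    refine lintegral_congr fun s => ?_
    by_cases hs : s ≤ T <;> by_cases hs' : (xNorm j w s).toReal < 2 * R <;>
      simp [Set.indicator_apply, hLdef, hs, hs']
  rw [h1]
  refine setLIntegral_le_of_isLowerSet hL _ fun t ht => ?_
  refine (lintegral_eNormE_le_xSq w t).trans ?_
  rw [← xNorm_sq, ← ENNReal.ofReal_toReal (hfin t ht.1), ← ENNReal.ofReal_pow
    ENNReal.toReal_nonneg]
  exact ENNReal.ofReal_le_ofReal (pow_le_pow_left₀ ENNReal.toReal_nonneg ht.2.le 2)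

/-- The bound is independent of the path: growth below level 2R, zero above. Truncated data are
therefore square integrable in ω whatever the moments of the process. -/
lemma exists_lintegral_trunc_le (hj : Function.Injective j) (hΦ : PolyLocallyLipschitz j Φ)
    (hθ : IsCutoff θ) {R : ℝ} (hR : 0 < R) (T : ℝ≥0) :
    ∃ C : ℝ≥0, ∀ w : ℝ≥0 → V, xSq j w T < ⊤ →
      ∫⁻ s in Set.Iic T, ‖trunc j θ R Φ w s‖ₑ ^ 2 ∂leb ≤ C := by
  obtain ⟨C, hC⟩ := exists_enorm_trunc_sq_le hj hΦ hθ (2 * R).toNNReal (η := 1) one_pos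
  refine ⟨((2 * R) ^ 2).toNNReal + C * T, fun w hT => ?_⟩
  calc ∫⁻ s in Set.Iic T, ‖trunc j θ R Φ w s‖ₑ ^ 2 ∂leb
      ≤ ∫⁻ s in Set.Iic T, ((if (xNorm j w s).toReal < 2 * R then eNormE j (w s) ^ 2 else 0) + C)
          ∂leb := by
        refine setLIntegral_mono' measurableSet_Iic fun s hs => ?_
        by_cases h : (xNorm j w s).toReal < 2 * R
        · rw [if_pos h]
          have := hC R hR w s ((enorm_le_xNorm w le_rfl).trans (by
            rw [← ENNReal.ofReal_toReal
              (xNorm_lt_top_iff.2 ((xSq_mono w hs).trans_lt hT)).ne]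
            exact ENNReal.ofReal_le_ofReal h.le))
          rwa [ENNReal.coe_one, one_mul] at this
        · rw [trunc, hθ.eq_zero hR (not_lt.1 h), zero_smul]
          simp
    _ = ∫⁻ s in Set.Iic T, (if (xNorm j w s).toReal < 2 * R then eNormE j (w s) ^ 2 else 0) ∂leb +
          C * T := by
        rw [lintegral_add_right _ measurable_const, setLIntegral_const, leb_Iic]
    _ ≤ _ := by
        rw [ENNReal.coe_add, ENNReal.coe_mul]
        exact add_le_add_left (lintegral_below_level_le hT) _

/-- Lipschitz estimate in `L²(0, T)` for the truncated nonlinearity. -/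
lemma exists_lintegral_trunc_sub_le (hj : Function.Injective j) (hΦ : PolyLocallyLipschitz j Φ)
    (hθ : IsCutoff θ) {R : ℝ} (hR : 0 < R) {η : ℝ≥0} (hη : 0 < η) :
    ∃ C : ℝ≥0, ∀ (w₁ w₂ z : ℝ≥0 → V) (T : ℝ≥0), Measurable w₁ → Measurable w₂ →
      (∀ s ≤ T, w₁ s - w₂ s = z s) → xSq j w₁ T < ⊤ → xSq j w₂ T < ⊤ →
      ∫⁻ s in Set.Iic T, ‖trunc j θ R Φ w₁ s - trunc j θ R Φ w₂ s‖ₑ ^ 2 ∂leb ≤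
        η * xSq j z T + C * ∫⁻ s in Set.Iic T, xSq j z s ∂leb := by
  -- The total coefficient of `xSq j z T` is κ (2 (2R)² + 1): one (2R)² for each path, and 1 for the
  -- E-norm of `z`.
  set κ : ℝ≥0 := η / (2 * ((2 * R) ^ 2).toNNReal + 1) with hκ
  have hκ0 : 0 < κ := by positivity
  obtain ⟨C, hC, h⟩ := hΦ.exists_cutoff_sub_sq_le hθ hR (NNReal.coe_pos.2 hκ0)
  refine ⟨C.toNNReal, fun w₁ w₂ z T hw₁ hw₂ hz hT₁ hT₂ => ?_⟩
  set I : (ℝ≥0 → V) → ℝ≥0 → ℝ≥0∞ := fun w s =>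
    if (xNorm j w s).toReal < 2 * R then eNormE j (w s) ^ 2 else 0 with hI
  -- `z` need only be the difference up to time `T`; in the localized argument it is a global
  -- process that agrees with the difference on part of the time axis.
  have hzm : xSq j z T = xSq j (fun s => w₁ s - w₂ s) T := xSq_congr fun s hs => (hz s hs).symm
  have hzT : xSq j z T < ⊤ := by
    rw [hzm]
    exact (xSq_sub_le hj hw₁).trans_lt (ENNReal.add_lt_top.2
      ⟨ENNReal.mul_lt_top (by simp) hT₁, ENNReal.mul_lt_top (by simp) hT₂⟩)
  have hfin : ∀ {w : ℝ≥0 → V}, xSq j w T < ⊤ → ∀ s ≤ T, xNorm j w s ≠ ⊤ := fun hT s hs =>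
    (xNorm_lt_top_iff.2 ((xSq_mono _ hs).trans_lt hT)).ne
  have hpt : ∀ᵐ s ∂leb.restrict (Set.Iic T),
      ‖trunc j θ R Φ w₁ s - trunc j θ R Φ w₂ s‖ₑ ^ 2 ≤
        xSq j z T * (κ * (I w₁ s + I w₂ s)) + κ * eNormE j (z s) ^ 2 +
          C.toNNReal * xSq j z s := by
    filter_upwards [ae_eNormE_ne_top hj hw₁ hT₁, ae_eNormE_ne_top hj hw₂ hT₂,
      ae_restrict_mem measurableSet_Iic] with s h1 h2 hs
    obtain ⟨e₁, he₁⟩ := mem_range_of_eNormE_ne_top h1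
    obtain ⟨e₂, he₂⟩ := mem_range_of_eNormE_ne_top h2
    have hze : z s = j (e₁ - e₂) := by rw [← hz s hs, map_sub, he₁, he₂]
    have f1 := hfin hT₁ s hs
    have f2 := hfin hT₂ s hs
    have f3 := hfin hzT s hs
    have hnorm : ∀ {x : V} {w : ℝ≥0 → V}, x = w s → xNorm j w s ≠ ⊤ →
        ‖x‖ ≤ (xNorm j w s).toReal := by
      rintro x w rfl hw
      rw [← toReal_enorm]
      exact ENNReal.toReal_mono hw (enorm_le_xNorm w le_rfl)
    have hzN : xNorm j z s = xNorm j (fun r => w₁ r - w₂ r) s :=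
      xNorm_congr fun r hr => (hz r (hr.trans hs)).symm
    have hN1 : xNorm j w₁ s ≤ xNorm j w₂ s + xNorm j z s := by
      rw [hzN]
      have := xNorm_add_le hj (T := s) (z := fun r => w₁ r - w₂ r) hw₂ (hw₁.sub hw₂)
      simpa only [add_sub_cancel] using this
    have hN2 : xNorm j w₂ s ≤ xNorm j w₁ s + xNorm j z s := by
      rw [hzN]
      have := xNorm_add_le hj (T := s) (z := fun r => w₂ r - w₁ r) hw₁ (hw₂.sub hw₁)
      simp only [add_sub_cancel] at this
      rwa [xNorm_eq (fun r => w₂ r - w₁ r), ← xSq_neg hj, ← xNorm_eq,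
        funext fun r => neg_sub (w₂ r) (w₁ r)] at this
    have hN : |(xNorm j w₁ s).toReal - (xNorm j w₂ s).toReal| ≤ (xNorm j z s).toReal := by
      have a1 := ENNReal.toReal_mono (ENNReal.add_ne_top.2 ⟨f2, f3⟩) hN1
      have a2 := ENNReal.toReal_mono (ENNReal.add_ne_top.2 ⟨f1, f3⟩) hN2
      rw [ENNReal.toReal_add f2 f3] at a1
      rw [ENNReal.toReal_add f1 f3] at a2
      rw [abs_le]
      constructor <;> linarith
    have key := h e₁ e₂ _ _ _ ENNReal.toReal_nonneg ENNReal.toReal_nonneg ENNReal.toReal_nonneg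
      (hnorm he₁ f1) (hnorm he₂ f2) hN (hnorm hze.symm f3)
    have hsq : ∀ {w : ℝ≥0 → V}, xNorm j w s ≠ ⊤ →
        ENNReal.ofReal ((xNorm j w s).toReal ^ 2) = xSq j w s := fun hw => by
      rw [ENNReal.ofReal_pow ENNReal.toReal_nonneg, ENNReal.ofReal_toReal hw, xNorm_sq]
    have hif : ∀ {w : ℝ≥0 → V} {e : E}, j e = w s →
        ENNReal.ofReal (if (xNorm j w s).toReal < 2 * R then ‖e‖ ^ 2 else 0) = I w s := by
      intro w e he
      simp only [hI]
      split_ifs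
      · rw [← he, eNormE_apply hj, ENNReal.ofReal_pow (norm_nonneg _), ofReal_norm]
      · simp
    have i0 : ∀ (w : ℝ≥0 → V) (e : E),
        0 ≤ if (xNorm j w s).toReal < 2 * R then ‖e‖ ^ 2 else 0 := fun w e => by
      split_ifs <;> positivity
    have hRHS := ENNReal.ofReal_le_ofReal key
    rw [ENNReal.ofReal_add (by have := i0 w₁ e₁; have := i0 w₂ e₂; positivity) (by positivity),
      ENNReal.ofReal_add (by have := i0 w₁ e₁; have := i0 w₂ e₂; positivity) (by positivity),
      ENNReal.ofReal_mul (by positivity), ENNReal.ofReal_mul (by positivity),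
      ENNReal.ofReal_mul (by positivity), ENNReal.ofReal_mul (by positivity),
      ENNReal.ofReal_add (i0 _ _) (i0 _ _), hsq f3, hif he₁, hif he₂,
      ENNReal.ofReal_pow (norm_nonneg _), ENNReal.ofReal_pow (norm_nonneg _), ofReal_norm,
      ofReal_norm, ENNReal.ofReal_coe_nnreal, ← eNormE_apply hj (e₁ - e₂), ← hze] at hRHS
    rw [trunc, trunc, ← he₁, ← he₂, onV_apply hj, onV_apply hj]
    refine hRHS.trans ?_
    gcongr
    · exact xSq_mono z hs
    · exact le_rfl
  have hmI : ∀ {w : ℝ≥0 → V}, Measurable w → Measurable (I w) := fun {w} hw => by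
    refine Measurable.ite (measurableSet_lt ?_ measurable_const)
      (((measurable_eNormE hj).comp hw).pow_const 2) measurable_const
    exact (xNorm_mono w).measurable.ennreal_toReal
  calc ∫⁻ s in Set.Iic T, ‖trunc j θ R Φ w₁ s - trunc j θ R Φ w₂ s‖ₑ ^ 2 ∂leb
      ≤ ∫⁻ s in Set.Iic T, (xSq j z T * (κ * (I w₁ s + I w₂ s)) + κ * eNormE j (z s) ^ 2 +
          C.toNNReal * xSq j z s) ∂leb := lintegral_mono_ae hpt
    _ = xSq j z T * (κ * (∫⁻ s in Set.Iic T, I w₁ s ∂leb + ∫⁻ s in Set.Iic T, I w₂ s ∂leb)) +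
          κ * ∫⁻ s in Set.Iic T, eNormE j (z s) ^ 2 ∂leb +
          C.toNNReal * ∫⁻ s in Set.Iic T, xSq j z s ∂leb := by
        rw [lintegral_add_right _ ((xSq_mono z).measurable.const_mul _),
          lintegral_add_left (f := fun s => xSq j z T * (κ * (I w₁ s + I w₂ s)))
            ((((hmI hw₁).add (hmI hw₂)).const_mul _).const_mul _),
          lintegral_const_mul' _ _ hzT.ne, lintegral_const_mul' _ _ ENNReal.coe_ne_top,
          lintegral_add_left (hmI hw₁), lintegral_const_mul' _ _ ENNReal.coe_ne_top,
          lintegral_const_mul' _ _ ENNReal.coe_ne_top]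
    _ ≤ xSq j z T * (κ * (ENNReal.ofReal ((2 * R) ^ 2) + ENNReal.ofReal ((2 * R) ^ 2))) +
          κ * xSq j z T + C.toNNReal * ∫⁻ s in Set.Iic T, xSq j z s ∂leb := by
        gcongr
        · exact lintegral_below_level_le hT₁
        · exact lintegral_below_level_le hT₂
        · exact lintegral_eNormE_le_xSq z T
    _ = η * xSq j z T + C.toNNReal * ∫⁻ s in Set.Iic T, xSq j z s ∂leb := by
        congr 1
        have : (η : ℝ≥0∞) = κ * (2 * ((2 * R) ^ 2).toNNReal + 1) := by
          rw [hκ]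
          norm_cast
          field_simp
        rw [this, ENNReal.ofReal]
        ring

lemma IsRegular.stronglyProgressive_trunc (hj : Function.Injective j) {u : ℝ≥0 → Ω → V}
    (hu : IsRegular j 𝓕 u) (hΦ : PolyLocallyLipschitz j Φ) (hθ : IsCutoff θ) {R : ℝ}
    (hR : 0 < R) :
    IsStronglyProgressive 𝓕 (fun r ω => trunc j θ R Φ (fun s => u s ω) r) := by
  intro t
  have h1 : StronglyMeasurable (fun p : V × ℝ≥0∞ =>
      θ (max ((p.2 ^ (1 / 2 : ℝ)).toReal / R) 0) • onV j Φ p.1) := by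
    refine StronglyMeasurable.smul (Measurable.stronglyMeasurable ?_)
      ((stronglyMeasurable_onV hj hΦ.continuous).comp_measurable measurable_fst)
    exact hθ.continuous_max.measurable.comp
      (((measurable_snd.pow_const _).ennreal_toReal).div_const _)
  have h2 := h1.comp_measurable (hu.measurable_pair hj t)
  convert h2 using 2 with p
  simp only [Function.comp_apply, trunc, xNorm_eq]
  rw [max_eq_left (by positivity)]

end

end Trunc

end Estimates

/-! ### Deterministic and stochastic convolutions -/

/-- Since `Q` determines the value at each time, solutions on different horizons agree where both
exist, and the diagonal `w t t` is locally one of them. -/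
lemma exists_continuous_of_forall_Iic {V : Type*} [TopologicalSpace V] {Q : ℝ≥0 → V → Prop}
    (huniq : ∀ t a b, Q t a → Q t b → a = b)
    (h : ∀ T : ℝ≥0, 0 < T → ∃ w : ℝ≥0 → V, ContinuousOn w (Set.Iic T) ∧ ∀ t ≤ T, Q t (w t)) :
    ∃ w : ℝ≥0 → V, Continuous w ∧ ∀ t, Q t (w t) := by
  have hp : ∀ t : ℝ≥0, 0 < t + 1 := fun t => by positivity
  have hlt : ∀ t : ℝ≥0, t < t + 1 := fun t => lt_add_of_pos_right _ one_pos
  choose w hw hQ using fun t : ℝ≥0 => h (t + 1) (hp t)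
  refine ⟨fun t => w t t, continuous_iff_continuousAt.2 fun t => ?_, fun t => hQ t t (hlt t).le⟩
  have h1 : ContinuousAt (w t) t := (hw t).continuousAt (Iic_mem_nhds (hlt t))
  refine h1.congr ?_
  filter_upwards [Iic_mem_nhds (hlt t)] with s hs
  exact huniq s _ _ (hQ t s hs) (hQ s s (hlt s).le)

section Convolution

variable {E V H Ω : Type*}
  [NormedAddCommGroup E] [NormedSpace ℝ E] [NormedAddCommGroup V] [NormedSpace ℝ V]
  [NormedAddCommGroup H] [NormedSpace ℝ H] {mΩ : MeasurableSpace Ω}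
  {j : E →L[ℝ] V} {k : V →L[ℝ] H} {S : ℝ≥0 → H →L[ℝ] H} {W : ℝ≥0 → Ω → ℝ}
  {𝓕 : Filtration ℝ≥0 mΩ} {P : Measure Ω}

lemma eLpNorm_two_sq {α X : Type*} [MeasurableSpace α] [NormedAddCommGroup X] (μ : Measure α)
    (f : α → X) : eLpNorm f 2 μ ^ 2 = ∫⁻ s, ‖f s‖ₑ ^ 2 ∂μ := by
  rw [eLpNorm_eq_lintegral_rpow_enorm_toReal (by norm_num) (by norm_num)]
  simp only [ENNReal.toReal_ofNat, ENNReal.rpow_ofNat]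
  exact rpow_half_sq _

/-- The horizons glue because `k` is injective. The constant is uniform in `T`, so it can be fixed
before η is chosen in the contraction. -/
lemma exists_conv_path (hk : Function.Injective k) (hS : SemigroupAssumption j k S W 𝓕 P) :
    ∃ C : ℝ≥0, ∀ f : ℝ≥0 → H, (∀ T, MemLp f 2 (leb.restrict (Set.Iic T))) →
      ∃ w : ℝ≥0 → V, Continuous w ∧ (∀ t, IsConvAt S f t (k (w t))) ∧
        ∀ T, 0 < T → xSq j w T ≤ C * ∫⁻ s in Set.Iic T, ‖f s‖ₑ ^ 2 ∂leb := by
  obtain ⟨C, -, hC⟩ := hS.conv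
  refine ⟨C ^ 2, fun f hf => ?_⟩
  have huniq : ∀ t a b, IsConvAt S f t (k a) → IsConvAt S f t (k b) → a = b := fun t a b ha hb =>
    hk (ha.2.trans hb.2.symm)
  obtain ⟨w, hw, hQ⟩ := exists_continuous_of_forall_Iic huniq fun T hT => by
    obtain ⟨w, h1, h2, -⟩ := hC T hT f (hf T)
    exact ⟨w, h1.1, h2⟩
  refine ⟨w, hw, hQ, fun T hT => ?_⟩
  obtain ⟨w', -, h2, h3⟩ := hC T hT f (hf T)
  have h4 : xNorm j w T = xNorm j w' T := xNorm_congr fun s hs => huniq s _ _ (hQ s) (h2 s hs)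
  rw [← xNorm_sq, h4, ← eLpNorm_two_sq, ENNReal.coe_pow, ← mul_pow]
  exact pow_le_pow_left' h3 2

lemma exists_orbit_path (hk : Function.Injective k) (hS : SemigroupAssumption j k S W 𝓕 P) :
    ∃ C : ℝ≥0 → ℝ≥0, ∀ v : V, ∃ w : ℝ≥0 → V, Continuous w ∧ (∀ t, k (w t) = S t (k v)) ∧
        ∀ T, 0 < T → xSq j w T ≤ C T * ‖v‖ₑ ^ 2 := by
  have h := fun T : ℝ≥0 => hS.orbit (T + 1) (by positivity)
  choose C _ hC using h
  refine ⟨fun T => C T ^ 2, fun v => ?_⟩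
  have hle : ∀ T : ℝ≥0, T ≤ T + 1 := fun T => le_add_of_nonneg_right zero_le_one
  have huniq : ∀ t a b, k a = S t (k v) → k b = S t (k v) → a = b := fun t a b ha hb =>
    hk (ha.trans hb.symm)
  obtain ⟨w, hw, hQ⟩ := exists_continuous_of_forall_Iic huniq fun T hT => by
    obtain ⟨w, h1, h2, -⟩ := hC T T hT (hle T) v
    exact ⟨w, h1.1, h2⟩
  refine ⟨w, hw, hQ, fun T hT => ?_⟩
  obtain ⟨w', -, h2, h3⟩ := hC T T hT (hle T) v
  have h4 : xNorm j w T = xNorm j w' T := xNorm_congr fun s hs => huniq s _ _ (hQ s) (h2 s hs)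
  rw [← xNorm_sq, h4, ENNReal.coe_pow, ← mul_pow]
  exact pow_le_pow_left' h3 2

/-- Strong continuity of `S` is not assumed; measurability of its orbits is read off from the
existence of the convolution with a constant function. -/
lemma SemigroupAssumption.aestronglyMeasurable_orbit (hS : SemigroupAssumption j k S W 𝓕 P)
    (t : ℝ≥0) (x : H) :
    AEStronglyMeasurable (fun r => S (t - r) x) (leb.restrict (Set.Iic t)) := by
  obtain ⟨C, -, hC⟩ := hS.conv
  have hle : t ≤ t + 1 := le_add_of_nonneg_right zero_le_one
  obtain ⟨w, -, h, -⟩ := hC (t + 1) (by positivity) (fun _ => x) (memLp_const x)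
  exact (h t hle).1.aestronglyMeasurable

/-- Measurability in `ω` of a convolution with a jointly measurable integrand. -/
lemma stronglyMeasurable_integral_conv {m : MeasurableSpace Ω} {f : ℝ≥0 → Ω → H} {t : ℝ≥0}
    (hSx : ∀ x : H, AEStronglyMeasurable (fun r => S (t - r) x) (leb.restrict (Set.Iic t)))
    (hf : StronglyMeasurable (fun p : Set.Iic t × Ω => f p.1 p.2)) :
    StronglyMeasurable (fun ω => ∫ r in Set.Iic t, S (t - r) (f r ω) ∂leb) := by
  classical
  set μ := leb.restrict (Set.Iic t)
  set g : ℝ≥0 × Ω → H := fun p => f (min p.1 t) p.2 with hg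
  have hgm : StronglyMeasurable g := by
    have h1 : Measurable (fun p : ℝ≥0 × Ω => ((⟨min p.1 t, Set.mem_Iic.2 (min_le_right _ _)⟩ : Set.Iic t), p.2)) :=
      (Measurable.subtype_mk (measurable_fst.min measurable_const)).prodMk measurable_snd
    exact hf.comp_measurable h1
  -- The orbits are measurable only up to null sets that depend on x. Simple approximations of the
  -- integrand take countably many values in all, so one null set `M` serves for all of them.
  have hae : ∀ᵐ r ∂μ, ∀ n : ℕ, ∀ x ∈ (hgm.approx n).range, (hSx x).mk _ r = S (t - r) x := by
    refine ae_all_iff.2 fun n => (ae_ball_iff (hgm.approx n).range.countable_toSet).2 fun x _ => ?_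
    exact (hSx x).ae_eq_mk.symm
  obtain ⟨M, hM, hMm, hM0⟩ := exists_measurable_superset_of_null hae
  have hML : ∀ r ∉ M, ∀ n : ℕ, ∀ x ∈ (hgm.approx n).range, (hSx x).mk _ r = S (t - r) x :=
    fun r hr => by
      by_contra h
      exact hr (hM h)
  set G : ℕ → ℝ≥0 × Ω → H := fun n p =>
    ∑ x ∈ (hgm.approx n).range, ((hgm.approx n) ⁻¹' {x}).indicator
      (fun p => (Mᶜ).indicator ((hSx x).mk _) p.1) p with hG
  have hGm : ∀ n, StronglyMeasurable (G n) := fun n =>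
    Finset.stronglyMeasurable_fun_sum _ fun x _ =>
      (((hSx x).stronglyMeasurable_mk.indicator hMm.compl).comp_measurable
        measurable_fst).indicator ((hgm.approx n).measurableSet_fiber x)
  have hGe : ∀ n p, G n p = (Mᶜ).indicator (fun r => S (t - r) (hgm.approx n p)) p.1 := by
    intro n p
    simp only [hG]
    rw [Finset.sum_eq_single_of_mem (hgm.approx n p) (SimpleFunc.mem_range_self _ _)]
    · rw [Set.indicator_of_mem (by simp)]
      by_cases hp : p.1 ∈ M
      · simp [hp]
      · simp [hp, hML p.1 hp n _ (SimpleFunc.mem_range_self _ _)]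
    · intro x _ hx
      refine Set.indicator_of_notMem ?_ _
      exact fun h => hx (Set.mem_singleton_iff.1 h).symm
  have hlim : StronglyMeasurable (fun p : ℝ≥0 × Ω => (Mᶜ).indicator (fun r => S (t - r) (g p)) p.1) := by
    refine stronglyMeasurable_of_tendsto atTop hGm ?_
    rw [tendsto_pi_nhds]
    intro p
    simp only [hGe]
    by_cases hp : p.1 ∈ M
    · simp [hp]
    · simp only [Set.indicator_of_mem (show p.1 ∈ Mᶜ from hp)]
      exact ((S (t - p.1)).continuous.tendsto _).comp (hgm.tendsto_approx p)
  have hfin := hlim.integral_prod_left' (μ := μ)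
  convert hfin using 2 with ω
  refine integral_congr_ae ?_
  filter_upwards [measure_eq_zero_iff_ae_notMem.1 hM0, ae_restrict_mem measurableSet_Iic]
    with r hr hrt
  rw [Set.indicator_of_mem (show r ∈ Mᶜ from hr)]
  simp only [hg, min_eq_left (show r ≤ t from hrt)]

/-- Lusin–Souslin: an injective continuous map out of a Polish space is a Borel embedding, so
measurability in `H` pulls back to `V`. -/
lemma stronglyMeasurable_of_comp_injective [CompleteSpace V] [SecondCountableTopology V]
    [SecondCountableTopology H] {m : MeasurableSpace Ω} (hk : Function.Injective k) {g : Ω → V}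
    (h : StronglyMeasurable (fun ω => k (g ω))) : StronglyMeasurable g := by
  borelize V
  borelize H
  exact ((k.continuous.measurableEmbedding hk).measurable_comp_iff.1 h.measurable).stronglyMeasurable

lemma stronglyMeasurable_path_min {X : Type*} [TopologicalSpace X] {m : MeasurableSpace Ω}
    {f : ℝ≥0 → Ω → X} {T : ℝ≥0} (hf : StronglyMeasurable (fun p : Set.Iic T × Ω => f p.1 p.2))
    (ω : Ω) : StronglyMeasurable (fun s : ℝ≥0 => f (min s T) ω) := by
  have h : Measurable (fun s : ℝ≥0 => ((⟨min s T, Set.mem_Iic.2 (min_le_right _ _)⟩ : Set.Iic T), ω)) :=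
    (Measurable.subtype_mk (measurable_id.min measurable_const)).prodMk measurable_const
  exact hf.comp_measurable h

lemma aestronglyMeasurable_path {X : Type*} [NormedAddCommGroup X]
    {f : ℝ≥0 → Ω → X} (hf : IsStronglyProgressive 𝓕 f) (ω : Ω) (T : ℝ≥0) :
    AEStronglyMeasurable (fun s => f s ω) (leb.restrict (Set.Iic T)) := by
  refine ⟨_, @stronglyMeasurable_path_min Ω X _ (𝓕 T) f T (hf T) ω, ?_⟩
  filter_upwards [ae_restrict_mem measurableSet_Iic] with s hs
  rw [min_eq_left (show s ≤ T from hs)]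

/-- A progressive process whose paths have `L²(0, T)`-norm bounded uniformly in `ω`. -/
structure IsBoundedData {X : Type*} [NormedAddCommGroup X] (𝓕 : Filtration ℝ≥0 mΩ)
    (f : ℝ≥0 → Ω → X) : Prop where
  progressive : IsStronglyProgressive 𝓕 f
  bound : ∀ T : ℝ≥0, ∃ C : ℝ≥0, ∀ ω, ∫⁻ s in Set.Iic T, ‖f s ω‖ₑ ^ 2 ∂leb ≤ C

namespace IsBoundedData

variable {X : Type*} [NormedAddCommGroup X] {f g : ℝ≥0 → Ω → X}

lemma sub (hf : IsBoundedData 𝓕 f) (hg : IsBoundedData 𝓕 g) :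
    IsBoundedData 𝓕 (fun s ω => f s ω - g s ω) where
  progressive t := (hf.progressive t).sub (hg.progressive t)
  bound T := by
    obtain ⟨C, hC⟩ := hf.bound T
    obtain ⟨D, hD⟩ := hg.bound T
    refine ⟨2 * C + 2 * D, fun ω => ?_⟩
    calc ∫⁻ s in Set.Iic T, ‖f s ω - g s ω‖ₑ ^ 2 ∂leb
        ≤ ∫⁻ s in Set.Iic T, (2 * ‖f s ω‖ₑ ^ 2 + 2 * ‖g s ω‖ₑ ^ 2) ∂leb :=
          lintegral_mono fun s => enorm_sub_sq_le _ _
      _ = 2 * ∫⁻ s in Set.Iic T, ‖f s ω‖ₑ ^ 2 ∂leb + 2 * ∫⁻ s in Set.Iic T, ‖g s ω‖ₑ ^ 2 ∂leb := by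
          rw [lintegral_add_left', lintegral_const_mul' _ _ (by norm_num),
            lintegral_const_mul' _ _ (by norm_num)]
          exact ((aestronglyMeasurable_path hf.progressive ω T).enorm.pow_const 2).const_mul _
      _ ≤ 2 * C + 2 * D := by gcongr; exacts [hC ω, hD ω]

lemma indicator (hf : IsBoundedData 𝓕 f) {B : Set (ℝ≥0 × Ω)}
    (hB : ∀ t : ℝ≥0, MeasurableSet[Subtype.instMeasurableSpace.prod (𝓕 t)]
      {p : Set.Iic t × Ω | ((p.1 : ℝ≥0), p.2) ∈ B}) :
    IsBoundedData 𝓕 (fun s ω => B.indicator (fun p => f p.1 p.2) (s, ω)) where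
  progressive t := by
    exact (hf.progressive t).indicator (hB t)
  bound T := by
    obtain ⟨C, hC⟩ := hf.bound T
    refine ⟨C, fun ω => (lintegral_mono fun s => ?_).trans (hC ω)⟩
    by_cases h : (s, ω) ∈ B
    · rw [Set.indicator_of_mem h]
    · rw [Set.indicator_of_notMem h]; simp

lemma memLp (hf : IsBoundedData 𝓕 f) (ω : Ω) (T : ℝ≥0) :
    MemLp (fun s => f s ω) 2 (leb.restrict (Set.Iic T)) := by
  refine ⟨aestronglyMeasurable_path hf.progressive ω T, ?_⟩
  obtain ⟨C, hC⟩ := hf.bound T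
  have := eLpNorm_two_sq (leb.restrict (Set.Iic T)) (fun s => f s ω)
  have h2 : eLpNorm (fun s => f s ω) 2 (leb.restrict (Set.Iic T)) ^ 2 < ⊤ := by
    rw [this]; exact (hC ω).trans_lt ENNReal.coe_lt_top
  simpa using h2

lemma memM2 [IsProbabilityMeasure P] (hf : IsBoundedData 𝓕 f) (T : ℝ≥0) : MemM2 𝓕 P f T := by
  refine ⟨hf.progressive, ENNReal.rpow_lt_top_of_nonneg (by norm_num) ?_⟩
  obtain ⟨C, hC⟩ := hf.bound T
  refine ((lintegral_mono hC).trans_lt ?_).ne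
  simp

end IsBoundedData

lemma UsualConditions.measurableSet_of_null (h𝓕 : UsualConditions 𝓕 P) {s : Set Ω} (hs : P s = 0)
    (t : ℝ≥0) : MeasurableSet[𝓕 t] s :=
  𝓕.mono zero_le s (h𝓕.null_mem s hs)

lemma UsualConditions.stronglyMeasurable_of_ae_eq {X : Type*} [TopologicalSpace X]
    [TopologicalSpace.PseudoMetrizableSpace X] [SecondCountableTopology X]
    (h𝓕 : UsualConditions 𝓕 P) {t : ℝ≥0} {f g : Ω → X} (hf : StronglyMeasurable[𝓕 t] f)
    (h : f =ᵐ[P] g) : StronglyMeasurable[𝓕 t] g := by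
  borelize X
  refine Measurable.stronglyMeasurable fun s hs => ?_
  have hnull : P {ω | ¬ f ω = g ω} = 0 := h
  have e : g ⁻¹' s = (f ⁻¹' s \ {ω | ¬ f ω = g ω}) ∪ (g ⁻¹' s ∩ {ω | ¬ f ω = g ω}) := by
    ext ω
    by_cases hω : f ω = g ω <;> simp [hω]
  rw [e]
  exact ((hf.measurable hs).diff (h𝓕.measurableSet_of_null hnull t)).union
    (h𝓕.measurableSet_of_null (measure_mono_null Set.inter_subset_right hnull) t)

/-! ### Locality and global versions of stochastic convolutions -/

section Stoch

variable [IsProbabilityMeasure P] [SecondCountableTopology H]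

lemma IsStochConvAt.ae_eq_of_forall_mem (hW : IsWienerProcess W 𝓕 P)
    {ξ ξ' : ℝ≥0 → Ω → V} {t : ℝ≥0} {h h' : Ω → H} (h1 : IsStochConvAt k S W 𝓕 P ξ t h)
    (h2 : IsStochConvAt k S W 𝓕 P ξ' t h') {A : Set Ω}
    (hA : ∀ᵐ ω ∂P, ω ∈ A → ∀ r < t, ξ r ω = ξ' r ω) : ∀ᵐ ω ∂P, ω ∈ A → h ω = h' ω := by
  have := (IsItoIntegral.sub h1 h2).ae_eq_zero_of_forall_mem hW (A := A) (by
    filter_upwards [hA] with ω hω hωA s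
    by_cases hs : s ∈ Set.Iio t
    · rw [Set.indicator_of_mem hs, Set.indicator_of_mem hs, hω hωA s hs, sub_self]
    · rw [Set.indicator_of_notMem hs, Set.indicator_of_notMem hs, sub_self])
  filter_upwards [this] with ω hω hωA
  exact sub_eq_zero.1 (hω hωA)

lemma IsStochConvAt.ae_eq (hk : Function.Injective k) (hW : IsWienerProcess W 𝓕 P)
    {ξ : ℝ≥0 → Ω → V} {t : ℝ≥0} {J J' : Ω → V}
    (h1 : IsStochConvAt k S W 𝓕 P ξ t (fun ω => k (J ω)))
    (h2 : IsStochConvAt k S W 𝓕 P ξ t (fun ω => k (J' ω))) : ∀ᵐ ω ∂P, J ω = J' ω := by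
  filter_upwards [h1.ae_eq_of_forall_mem hW h2 (A := Set.univ) (by simp)] with ω hω
  exact hk (hω trivial)

/-- The versions on [0, n + 1] agree a.s. on a countable dense set of times, hence everywhere by
continuity, and are glued. On the exceptional null set the process is put equal to 0, which
preserves adaptedness under the usual conditions. -/
lemma exists_stochConv_process [CompleteSpace E] [SecondCountableTopology E]
    (hk : Function.Injective k) (hW : IsWienerProcess W 𝓕 P)
    (h𝓕 : UsualConditions 𝓕 P) (hj : Function.Injective j)
    (hS : SemigroupAssumption j k S W 𝓕 P) :
    ∃ C : ℝ≥0, ∀ ξ : ℝ≥0 → Ω → V, IsBoundedData 𝓕 ξ →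
      ∃ J : ℝ≥0 → Ω → V, IsRegular j 𝓕 J ∧ (∀ ω, Continuous (fun t => J t ω)) ∧
        IsStochConv k S W 𝓕 P ξ J ∧
        ∀ T, 0 < T → ∫⁻ ω, xSq j (fun s => J s ω) T ∂P ≤
          C * ∫⁻ ω, ∫⁻ s in Set.Iic T, ‖ξ s ω‖ₑ ^ 2 ∂leb ∂P := by
  obtain ⟨C, -, hC⟩ := hS.stochConv
  refine ⟨C ^ 2, fun ξ hξ => ?_⟩
  obtain ⟨D, hD, hD'⟩ := TopologicalSpace.exists_countable_dense ℝ≥0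
  choose J hJM hJ _ using fun n : ℕ => hC (n + 1) (by positivity) ξ (hξ.memM2 (P := P) (n + 1))
  set Ω₀ : Set Ω := {ω | (∀ n, MemX j (fun s => J n s ω) (n + 1)) ∧
    ∀ n m : ℕ, ∀ q ∈ D, q ≤ n + 1 → q ≤ m + 1 → J n q ω = J m q ω} with hΩ₀
  have hae : ∀ᵐ ω ∂P, ω ∈ Ω₀ := by
    refine Eventually.and (ae_all_iff.2 fun n => (hJM n).2.1) ?_
    refine ae_all_iff.2 fun n => ae_all_iff.2 fun m => (ae_ball_iff hD).2 fun q _ => ?_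
    by_cases h1 : q ≤ n + 1
    · by_cases h2 : q ≤ m + 1
      · filter_upwards [(hJ n q h1).ae_eq hk hW (hJ m q h2)] with ω hω _ _ using hω
      · exact .of_forall fun ω _ h => absurd h h2
    · exact .of_forall fun ω h => absurd h h1
  have hcons : ∀ ω ∈ Ω₀, ∀ n m : ℕ, ∀ t : ℝ≥0, t < n + 1 → t < m + 1 → J n t ω = J m t ω := by
    intro ω hω n m t h1 h2
    have key : Set.EqOn (fun s => J n s ω) (fun s => J m s ω)
        (Set.Iio (min (n + 1) (m + 1) : ℝ≥0)) := by
      refine Set.EqOn.of_subset_closure (s := Set.Iio (min (n + 1) (m + 1) : ℝ≥0) ∩ D) ?_ ?_ ?_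
        Set.inter_subset_left (hD'.open_subset_closure_inter isOpen_Iio)
      · intro q hq
        have := lt_min_iff.1 (Set.mem_Iio.1 hq.1)
        exact hω.2 n m q hq.2 this.1.le this.2.le
      · exact (hω.1 n).1.mono fun x hx => (lt_min_iff.1 (Set.mem_Iio.1 hx)).1.le
      · exact (hω.1 m).1.mono fun x hx => (lt_min_iff.1 (Set.mem_Iio.1 hx)).2.le
    exact key (Set.mem_Iio.2 (lt_min h1 h2))
  have hceil : ∀ t : ℝ≥0, t < (⌈t⌉₊ : ℝ≥0) + 1 := fun t =>
    (Nat.le_ceil t).trans_lt (lt_add_of_pos_right _ one_pos)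
  set K : ℝ≥0 → Ω → V := fun t => Ω₀.indicator (J ⌈t⌉₊ t) with hK
  have hKeq : ∀ ω ∈ Ω₀, ∀ n : ℕ, ∀ t : ℝ≥0, t < n + 1 → K t ω = J n t ω := fun ω hω n t ht => by
    simp only [hK, Set.indicator_of_mem hω]
    exact hcons ω hω _ _ t (hceil t) ht
  have hK0 : ∀ ω ∉ Ω₀, ∀ t, K t ω = 0 := fun ω hω t => Set.indicator_of_notMem hω _
  have hcont : ∀ ω, Continuous (fun t => K t ω) := by
    intro ω
    by_cases hω : ω ∈ Ω₀
    · refine continuous_iff_continuousAt.2 fun t => ?_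
      have h1 : ContinuousAt (fun s => J ⌈t⌉₊ s ω) t :=
        (hω.1 ⌈t⌉₊).1.continuousAt (Iic_mem_nhds (hceil t))
      refine h1.congr ?_
      filter_upwards [Iio_mem_nhds (hceil t)] with s hs
      exact (hKeq ω hω _ s hs).symm
    · simp only [hK0 ω hω]
      exact continuous_const
  have hm : ∀ t, MeasurableSet[𝓕 t] Ω₀ := fun t => by
    have := (h𝓕.measurableSet_of_null (mem_ae_iff.1 hae) t).compl
    rwa [compl_compl] at this
  have hreg : IsRegular j 𝓕 K := by
    refine ⟨fun t => ?_, fun ω t => (hcont ω).continuousWithinAt, fun ω T => ?_⟩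
    · exact ((hJM _).1.stronglyAdapted t).indicator (hm t)
    · by_cases hω : ω ∈ Ω₀
      · rw [xSq_congr (w' := fun s => J ⌈T⌉₊ s ω)
          fun s hs => hKeq ω hω _ s (hs.trans_lt (hceil T))]
        exact (xSq_mono _ (hceil T).le).trans_lt (xNorm_lt_top_iff.1 (hω.1 ⌈T⌉₊).2)
      · simp only [hK0 ω hω]
        rw [xSq_zero hj]
        exact ENNReal.zero_lt_top
  have hKJ : ∀ t, (fun ω => k (J ⌈t⌉₊ t ω)) =ᵐ[P] fun ω => k (K t ω) := fun t => by
    filter_upwards [hae] with ω hω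
    rw [hKeq ω hω _ t (hceil t)]
  have hstoch : ∀ t, IsStochConvAt k S W 𝓕 P ξ t (fun ω => k (K t ω)) := fun t =>
    IsItoIntegral.congr (hJ ⌈t⌉₊ t (hceil t).le) (.of_forall fun _ _ => rfl) (hKJ t)
  refine ⟨K, hreg, hcont, ⟨.of_forall hcont, hstoch⟩, fun T hT => ?_⟩
  obtain ⟨L, hLM, hL, hLn⟩ := hC T hT ξ (hξ.memM2 T)
  -- The estimate is available for the version built on exactly [0, T], which must therefore be
  -- identified with `K`.
  have heq : ∀ᵐ ω ∂P, ∀ s ≤ T, K s ω = L s ω := by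
    have hq : ∀ᵐ ω ∂P, ∀ q ∈ D, q ≤ T → K q ω = L q ω := (ae_ball_iff hD).2 fun q _ => by
      by_cases h : q ≤ T
      · filter_upwards [(hstoch q).ae_eq hk hW (hL q h)] with ω hω _ using hω
      · exact .of_forall fun _ h' => absurd h' h
    filter_upwards [hq, hLM.2.1] with ω hω hωL
    have key : Set.EqOn (fun s => K s ω) (fun s => L s ω) (Set.Iic T) := by
      refine Set.EqOn.of_subset_closure (s := Set.Iio T ∩ D) ?_ (hcont ω).continuousOn hωL.1
        (fun x hx => (Set.mem_Iio.1 hx.1).le) ?_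
      · intro q hq
        exact hω q hq.2 (Set.mem_Iio.1 hq.1).le
      · rw [← closure_Iio' (a := T) ⟨0, hT⟩]
        exact closure_minimal (hD'.open_subset_closure_inter isOpen_Iio) isClosed_closure
    exact fun s hs => key hs
  calc ∫⁻ ω, xSq j (fun s => K s ω) T ∂P = ∫⁻ ω, xNorm j (fun s => L s ω) T ^ 2 ∂P := by
        refine lintegral_congr_ae ?_
        filter_upwards [heq] with ω hω
        rw [xNorm_sq]
        exact xSq_congr hω
    _ = m2xNorm j P L T ^ 2 := (rpow_half_sq _).symm
    _ ≤ (C * m2Norm P ξ T) ^ 2 := pow_le_pow_left' hLn 2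
    _ = _ := by rw [mul_pow, m2Norm, rpow_half_sq, ENNReal.coe_pow]

end Stoch

/-! ### Mild equations on a set of times and events -/

/-- On `B`, the process `u` is `S u₀ + S * f + S ⋄ ξ`. -/
def MildOn (k : V →L[ℝ] H) (S : ℝ≥0 → H →L[ℝ] H) (W : ℝ≥0 → Ω → ℝ) (𝓕 : Filtration ℝ≥0 mΩ)
    (P : Measure Ω) (u₀ : Ω → V) (B : Set (ℝ≥0 × Ω)) (f : ℝ≥0 → Ω → H) (ξ u : ℝ≥0 → Ω → V) : Prop :=
  ∃ J : ℝ≥0 → Ω → V, IsStochConv k S W 𝓕 P ξ J ∧ ∀ t, ∀ᵐ ω ∂P, (t, ω) ∈ B →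
    ∃ h : H, IsConvAt S (fun r => f r ω) t h ∧
      k (u t ω) = S t (k (u₀ ω)) + h + k (J t ω)

namespace MildOn

variable {u₀ u₀' : Ω → V} {B B' : Set (ℝ≥0 × Ω)} {f f' : ℝ≥0 → Ω → H} {ξ ξ' u u' : ℝ≥0 → Ω → V}

lemma mono (h : MildOn k S W 𝓕 P u₀ B f ξ u) (hB : B' ⊆ B) : MildOn k S W 𝓕 P u₀ B' f ξ u := by
  obtain ⟨J, hJ, h⟩ := h
  refine ⟨J, hJ, fun t => ?_⟩
  filter_upwards [h t] with ω hω hB' using hω (hB hB')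

lemma congr_left (h : MildOn k S W 𝓕 P u₀ B f ξ u)
    (hu : ∀ᵐ ω ∂P, ∀ t, (t, ω) ∈ B → u t ω = u' t ω) : MildOn k S W 𝓕 P u₀ B f ξ u' := by
  obtain ⟨J, hJ, h⟩ := h
  refine ⟨J, hJ, fun t => ?_⟩
  filter_upwards [h t, hu] with ω hω hω' hB
  rw [← hω' t hB]
  exact hω hB

lemma sub [SFinite P] (h : MildOn k S W 𝓕 P u₀ B f ξ u) (h' : MildOn k S W 𝓕 P u₀' B f' ξ' u') :
    MildOn k S W 𝓕 P (fun ω => u₀ ω - u₀' ω) B (fun r ω => f r ω - f' r ω)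
      (fun r ω => ξ r ω - ξ' r ω) (fun r ω => u r ω - u' r ω) := by
  obtain ⟨J, ⟨hJc, hJ⟩, h⟩ := h
  obtain ⟨J', ⟨hJc', hJ'⟩, h'⟩ := h'
  refine ⟨fun t ω => J t ω - J' t ω, ⟨?_, fun t => ?_⟩, fun t => ?_⟩
  · filter_upwards [hJc, hJc'] with ω h1 h2 using h1.sub h2
  · refine IsItoIntegral.congr (IsItoIntegral.sub (hJ t) (hJ' t)) (.of_forall fun ω s => ?_)
      (.of_forall fun ω => ?_)
    · by_cases hs : s ∈ Set.Iio t
      · simp only [Set.indicator_of_mem hs, map_sub]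
      · simp only [Set.indicator_of_notMem hs, sub_self]
    · simp
  · filter_upwards [h t, h' t] with ω hω hω' hB
    obtain ⟨a, ⟨ha1, ha2⟩, ha3⟩ := hω hB
    obtain ⟨b, ⟨hb1, hb2⟩, hb3⟩ := hω' hB
    refine ⟨a - b, ⟨?_, ?_⟩, ?_⟩
    · simp only [map_sub]
      exact ha1.sub hb1
    · simp only [map_sub]
      rw [integral_sub ha1 hb1, ← ha2, ← hb2]
    · simp only [map_sub, ha3, hb3]
      abel

variable [IsProbabilityMeasure P] [SecondCountableTopology H]

/-- At a fixed time t, locality is applied on the event (t, ω) ∈ B; a countable dense set of times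
and left-continuity do the rest. Agreement of the data before t suffices because a single time is
null, and this covers times up to and including a stopping time. -/
lemma ae_eq_of_forall_lt (hk : Function.Injective k) (hW : IsWienerProcess W 𝓕 P)
    (h : MildOn k S W 𝓕 P u₀ B f ξ u) (h' : MildOn k S W 𝓕 P u₀ B f' ξ' u')
    (hB : ∀ s t ω, s ≤ t → (t, ω) ∈ B → (s, ω) ∈ B)
    (hdata : ∀ᵐ ω ∂P, ∀ t, (t, ω) ∈ B → ∀ r < t, f r ω = f' r ω ∧ ξ r ω = ξ' r ω)
    (hc : ∀ᵐ ω ∂P, ∀ t, (t, ω) ∈ B → ContinuousWithinAt (fun s => u s ω) (Set.Iic t) t)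
    (hc' : ∀ᵐ ω ∂P, ∀ t, (t, ω) ∈ B → ContinuousWithinAt (fun s => u' s ω) (Set.Iic t) t) :
    ∀ᵐ ω ∂P, ∀ t, (t, ω) ∈ B → u t ω = u' t ω := by
  obtain ⟨J, ⟨-, hJ⟩, h⟩ := h
  obtain ⟨J', ⟨-, hJ'⟩, h'⟩ := h'
  have hpt : ∀ t, ∀ᵐ ω ∂P, (t, ω) ∈ B → u t ω = u' t ω := by
    intro t
    have hJJ := (hJ t).ae_eq_of_forall_mem hW (hJ' t) (A := {ω | (t, ω) ∈ B}) (by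
      filter_upwards [hdata] with ω hω hωB r hr
      exact (hω t hωB r hr).2)
    filter_upwards [h t, h' t, hJJ, hdata] with ω h1 h2 h3 h4 hωB
    obtain ⟨a, ⟨_, ha2⟩, ha3⟩ := h1 hωB
    obtain ⟨b, ⟨_, hb2⟩, hb3⟩ := h2 hωB
    have hab : a = b := by
      rw [ha2, hb2, ← setIntegral_congr_set Iio_ae_eq_Iic, ← setIntegral_congr_set Iio_ae_eq_Iic]
      exact setIntegral_congr_fun measurableSet_Iio fun r hr => by
        simp only [(h4 t hωB r hr).1]
    refine hk ?_
    rw [ha3, hb3, hab, h3 hωB]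
  obtain ⟨D₀, hD₀, hD₀'⟩ := TopologicalSpace.exists_countable_dense ℝ≥0
  have hq : ∀ᵐ ω ∂P, ∀ q ∈ insert 0 D₀, (q, ω) ∈ B → u q ω = u' q ω :=
    (ae_ball_iff (hD₀.insert 0)).2 fun q _ => hpt q
  filter_upwards [hq, hc, hc'] with ω hω hcω hcω' t ht
  rcases eq_or_ne t 0 with rfl | ht0
  · exact hω 0 (Set.mem_insert _ _) ht
  · have hcl : t ∈ closure (Set.Iio t ∩ D₀) := by
      have h2 := closure_mono (hD₀'.open_subset_closure_inter (isOpen_Iio (a := t)))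
      rw [closure_closure, closure_Iio' ⟨0, pos_iff_ne_zero.2 ht0⟩] at h2
      exact h2 Set.self_mem_Iic
    have hsub : Set.Iio t ∩ D₀ ⊆ Set.Iic t := fun x hx => (Set.mem_Iio.1 hx.1).le
    have hcd : ContinuousWithinAt (fun s => u s ω - u' s ω) (Set.Iio t ∩ D₀) t :=
      ((hcω t ht).sub (hcω' t ht)).mono hsub
    have h4 := hcd.mem_closure hcl (t := {0}) (fun q hq => by
      have hqt : q ≤ t := (Set.mem_Iio.1 hq.1).le
      simp [hω q (Set.mem_insert_of_mem _ hq.2) (hB q t ω hqt ht)])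
    rw [closure_singleton] at h4
    exact sub_eq_zero.1 h4

lemma ae_eq_of_forall_mem (hk : Function.Injective k) (hW : IsWienerProcess W 𝓕 P)
    (h : MildOn k S W 𝓕 P u₀ B f ξ u) (h' : MildOn k S W 𝓕 P u₀ B f' ξ' u')
    (hB : ∀ s t ω, s ≤ t → (t, ω) ∈ B → (s, ω) ∈ B)
    (hdata : ∀ᵐ ω ∂P, ∀ t, (t, ω) ∈ B → f t ω = f' t ω ∧ ξ t ω = ξ' t ω)
    (hc : ∀ᵐ ω ∂P, ∀ t, (t, ω) ∈ B → ContinuousWithinAt (fun s => u s ω) (Set.Iic t) t)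
    (hc' : ∀ᵐ ω ∂P, ∀ t, (t, ω) ∈ B → ContinuousWithinAt (fun s => u' s ω) (Set.Iic t) t) :
    ∀ᵐ ω ∂P, ∀ t, (t, ω) ∈ B → u t ω = u' t ω := by
  refine h.ae_eq_of_forall_lt hk hW h' hB ?_ hc hc'
  filter_upwards [hdata] with ω hω t ht r hr using hω r (hB r t ω hr.le ht)

end MildOn

/-- Solvability of the linear problem, with estimates. -/
lemma exists_mild [IsProbabilityMeasure P] [CompleteSpace E] [SecondCountableTopology E]
    [CompleteSpace V] [SecondCountableTopology V] [SecondCountableTopology H]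
    (hj : Function.Injective j) (hk : Function.Injective k) (hW : IsWienerProcess W 𝓕 P)
    (h𝓕 : UsualConditions 𝓕 P) (hS : SemigroupAssumption j k S W 𝓕 P) :
    ∃ (C : ℝ≥0) (D : ℝ≥0 → ℝ≥0), ∀ (u₀ : Ω → V) (f : ℝ≥0 → Ω → H) (ξ : ℝ≥0 → Ω → V),
      StronglyMeasurable[𝓕 0] u₀ → IsBoundedData 𝓕 f → IsBoundedData 𝓕 ξ →
      ∃ z : ℝ≥0 → Ω → V, IsRegular j 𝓕 z ∧ (∀ ω, Continuous (fun t => z t ω)) ∧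
        MildOn k S W 𝓕 P u₀ Set.univ f ξ z ∧
        ∀ T, 0 < T → ∫⁻ ω, xSq j (fun s => z s ω) T ∂P ≤ D T * ∫⁻ ω, ‖u₀ ω‖ₑ ^ 2 ∂P +
          C * (∫⁻ ω, ∫⁻ s in Set.Iic T, ‖f s ω‖ₑ ^ 2 ∂leb ∂P +
            ∫⁻ ω, ∫⁻ s in Set.Iic T, ‖ξ s ω‖ₑ ^ 2 ∂leb ∂P) := by
  borelize V
  obtain ⟨C₁, hC₁⟩ := exists_conv_path hk hS
  obtain ⟨C₀, hC₀⟩ := exists_orbit_path hk hS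
  obtain ⟨C₂, hC₂⟩ := exists_stochConv_process hk hW h𝓕 hj hS
  -- The solution is (a + b) + J, orbit plus two convolutions; two uses of (x + y)² ≤ 2x² + 2y² give
  -- the weights 4, 4 and 2.
  refine ⟨4 * C₁ + 2 * C₂, fun T => 4 * C₀ T, fun u₀ f ξ hu₀ hf hξ => ?_⟩
  choose a hac ha haT using fun ω => hC₀ (u₀ ω)
  choose b hbc hb hbT using fun ω => hC₁ (fun s => f s ω) (hf.memLp ω)
  obtain ⟨J, hJ, hJc, hJs, hJT⟩ := hC₂ ξ hξ
  have hfin : ∀ {w : ℝ≥0 → V}, (∀ T, 0 < T → xSq j w T < ⊤) → ∀ T, xSq j w T < ⊤ := fun h T =>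
    (xSq_mono _ (le_add_of_nonneg_right zero_le_one : T ≤ T + 1)).trans_lt (h _ (by positivity))
  have hareg : IsRegular j 𝓕 (fun t ω => a ω t) := by
    refine ⟨fun t => ?_, fun ω t => (hac ω).continuousWithinAt, fun ω => hfin fun T hT => ?_⟩
    · refine stronglyMeasurable_of_comp_injective hk ?_
      simp only [ha]
      exact (S t).continuous.comp_stronglyMeasurable
        (k.continuous.comp_stronglyMeasurable (hu₀.mono (𝓕.mono zero_le)))
    · exact (haT ω T hT).trans_lt (ENNReal.mul_lt_top (by simp) (by simp))
  have hbreg : IsRegular j 𝓕 (fun t ω => b ω t) := by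
    refine ⟨fun t => ?_, fun ω t => (hbc ω).continuousWithinAt, fun ω => hfin fun T hT => ?_⟩
    · refine stronglyMeasurable_of_comp_injective hk ?_
      have : (fun ω => k (b ω t)) = fun ω => ∫ r in Set.Iic t, S (t - r) (f r ω) ∂leb :=
        funext fun ω => (hb ω t).2
      rw [this]
      exact stronglyMeasurable_integral_conv (hS.aestronglyMeasurable_orbit t) (hf.progressive t)
    · refine (hbT ω T hT).trans_lt (ENNReal.mul_lt_top (by simp) ?_)
      obtain ⟨C, hC⟩ := hf.bound T
      exact (hC ω).trans_lt ENNReal.coe_lt_top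
  have hle : ∀ ω T, xSq j (fun s => a ω s + b ω s + J s ω) T ≤
      4 * xSq j (a ω) T + 4 * xSq j (b ω) T + 2 * xSq j (fun s => J s ω) T := fun ω T => by
    calc _ ≤ 2 * xSq j (fun s => a ω s + b ω s) T + 2 * xSq j (fun s => J s ω) T :=
          xSq_add_le hj ((hareg.measurable_path ω).add (hbreg.measurable_path ω))
      _ ≤ 2 * (2 * xSq j (a ω) T + 2 * xSq j (b ω) T) + 2 * xSq j (fun s => J s ω) T := by
          gcongr
          exact xSq_add_le hj (hareg.measurable_path ω)
      _ = _ := by ring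
  have hzc : ∀ ω, Continuous (fun t => a ω t + b ω t + J t ω) := fun ω =>
    ((hac ω).add (hbc ω)).add (hJc ω)
  refine ⟨fun t ω => a ω t + b ω t + J t ω, ⟨fun t => ?_, fun ω t => (hzc ω).continuousWithinAt,
    fun ω T => ?_⟩, hzc, ⟨J, hJs, fun t => .of_forall fun ω _ => ⟨k (b ω t), hb ω t, ?_⟩⟩,
    fun T hT => ?_⟩
  · exact ((hareg.adapted t).add (hbreg.adapted t)).add (hJ.adapted t)
  · refine (hle ω T).trans_lt (ENNReal.add_lt_top.2 ⟨ENNReal.add_lt_top.2 ⟨?_, ?_⟩, ?_⟩)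
    · exact ENNReal.mul_lt_top (by simp) (hareg.finite ω T)
    · exact ENNReal.mul_lt_top (by simp) (hbreg.finite ω T)
    · exact ENNReal.mul_lt_top (by simp) (hJ.finite ω T)
  · rw [map_add, map_add, ha]
  · have m1 := hareg.measurable_xSq hj T
    have m3 := hJ.measurable_xSq hj T
    calc ∫⁻ ω, xSq j (fun s => a ω s + b ω s + J s ω) T ∂P
        ≤ ∫⁻ ω, (4 * (C₀ T * ‖u₀ ω‖ₑ ^ 2) + 4 * (C₁ * ∫⁻ s in Set.Iic T, ‖f s ω‖ₑ ^ 2 ∂leb) +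
            2 * xSq j (fun s => J s ω) T) ∂P := by
          refine lintegral_mono fun ω => (hle ω T).trans ?_
          gcongr
          · exact haT ω T hT
          · exact hbT ω T hT
      _ = 4 * (C₀ T * ∫⁻ ω, ‖u₀ ω‖ₑ ^ 2 ∂P) +
            4 * (C₁ * ∫⁻ ω, ∫⁻ s in Set.Iic T, ‖f s ω‖ₑ ^ 2 ∂leb ∂P) +
            2 * ∫⁻ ω, xSq j (fun s => J s ω) T ∂P := by
          have m0 : Measurable (fun ω => ‖u₀ ω‖ₑ ^ 2) :=
            ((hu₀.mono (𝓕.le 0)).measurable.enorm).pow_const 2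
          rw [lintegral_add_right _ (m3.const_mul 2),
            lintegral_add_left ((m0.const_mul _).const_mul _)]
          simp only [lintegral_const_mul' _ _ (ENNReal.ofNat_ne_top),
            lintegral_const_mul' _ _ ENNReal.coe_ne_top]
      _ ≤ 4 * (C₀ T * ∫⁻ ω, ‖u₀ ω‖ₑ ^ 2 ∂P) +
            4 * (C₁ * ∫⁻ ω, ∫⁻ s in Set.Iic T, ‖f s ω‖ₑ ^ 2 ∂leb ∂P) +
            2 * (C₂ * ∫⁻ ω, ∫⁻ s in Set.Iic T, ‖ξ s ω‖ₑ ^ 2 ∂leb ∂P) := by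
          gcongr
          exact hJT T hT
      _ ≤ _ := by
          push_cast
          rw [← mul_assoc, ← mul_assoc, ← mul_assoc, mul_add, ← add_assoc]
          gcongr
          · exact le_self_add
          · exact le_add_self

end Convolution

/-! ### A Gronwall-type iteration -/

lemma setLIntegral_leb_coe (g : ℝ → ℝ≥0∞) (T : ℝ≥0) :
    ∫⁻ s in Set.Iic T, g s ∂leb = ∫⁻ x in Set.Icc 0 (T : ℝ), g x := by
  have h1 : leb.map ((↑) : ℝ≥0 → ℝ) = volume.restrict (Set.range ((↑) : ℝ≥0 → ℝ)) :=
    measurableEmbedding_coe.map_comap _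
  have h2 : ((↑) : ℝ≥0 → ℝ) ⁻¹' (Set.Icc 0 (T : ℝ)) = Set.Iic T := by
    ext s; simp
  rw [← h2, ← measurableEmbedding_coe.lintegral_map g, ← measurableEmbedding_coe.restrict_map, h1,
    Measure.restrict_restrict measurableSet_Icc]
  congr 2
  refine Set.inter_eq_left.2 fun x hx => ⟨⟨x, hx.1⟩, rfl⟩

lemma lintegral_exp_le {r : ℝ} (hr : 0 < r) (T : ℝ≥0) :
    ∫⁻ s in Set.Iic T, ENNReal.ofReal (Real.exp (r * s)) ∂leb ≤
      ENNReal.ofReal (r⁻¹ * Real.exp (r * T)) := by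
  rw [setLIntegral_leb_coe (fun x => ENNReal.ofReal (Real.exp (r * x)))]
  rw [← ofReal_integral_eq_lintegral_ofReal
    ((by fun_prop : Continuous fun x : ℝ => Real.exp (r * x)).continuousOn.integrableOn_Icc)
    (.of_forall fun x => (Real.exp_pos _).le)]
  refine ENNReal.ofReal_le_ofReal ?_
  rw [integral_Icc_eq_integral_Ioc, ← intervalIntegral.integral_of_le (NNReal.coe_nonneg T),
    intervalIntegral.integral_comp_mul_left (fun x => Real.exp x) hr.ne', integral_exp]
  simp only [smul_eq_mul, mul_zero, Real.exp_zero]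
  gcongr
  simp

/-- The weight e^{rT} with r = (C + 1) / κ satisfies C ∫_0^T e^{rs} ds ≤ κ e^{rT}, so the Volterra
term costs no more than the direct one and each step multiplies by 2κ, however long the horizon. -/
lemma le_geometric_of_gronwall {κ C : ℝ≥0} (hκ : 0 < κ) :
    ∃ G : ℝ≥0 → ℝ≥0, ∀ (a : ℕ → ℝ≥0 → ℝ≥0∞) (A : ℝ≥0∞) (N : ℝ≥0),
      (∀ T, 0 < T → T ≤ N → a 0 T ≤ A) →
      (∀ m T, 0 < T → T ≤ N → a (m + 1) T ≤ κ * a m T + C * ∫⁻ s in Set.Iic T, a m s ∂leb) →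
      ∀ m T, 0 < T → T ≤ N → a m T ≤ A * (2 * κ) ^ m * G T := by
  set r : ℝ := (C + 1) / κ with hr
  have hr0 : 0 < r := by positivity
  set g : ℝ≥0 → ℝ≥0∞ := fun T => ENNReal.ofReal (Real.exp (r * T)) with hg
  have hg1 : ∀ T, 1 ≤ g T := fun T => by
    rw [hg, ← ENNReal.ofReal_one]
    exact ENNReal.ofReal_le_ofReal (Real.one_le_exp (by positivity))
  have hint : ∀ T, C * ∫⁻ s in Set.Iic T, g s ∂leb ≤ κ * g T := fun T => by
    calc C * ∫⁻ s in Set.Iic T, g s ∂leb ≤ C * ENNReal.ofReal (r⁻¹ * Real.exp (r * T)) := by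
          gcongr
          exact lintegral_exp_le hr0 T
      _ = ENNReal.ofReal (C * r⁻¹ * Real.exp (r * T)) := by
          rw [mul_assoc, ENNReal.ofReal_mul (p := (C : ℝ)) C.2, ENNReal.ofReal_coe_nnreal]
      _ ≤ ENNReal.ofReal (κ * Real.exp (r * T)) := by
          refine ENNReal.ofReal_le_ofReal (mul_le_mul_of_nonneg_right ?_ (Real.exp_pos _).le)
          have hκ' : (0 : ℝ) < κ := hκ
          rw [hr, inv_div, mul_div_assoc', div_le_iff₀ (by positivity)]
          nlinarith
      _ = κ * g T := by rw [ENNReal.ofReal_mul (p := (κ : ℝ)) κ.2, ENNReal.ofReal_coe_nnreal]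
  refine ⟨fun T => (Real.exp (r * T)).toNNReal, fun a A N h0 hstep m => ?_⟩
  change ∀ T, 0 < T → T ≤ N → a m T ≤ A * (2 * κ) ^ m * g T
  induction m with
  | zero =>
    intro T hT hTN
    rw [pow_zero, mul_one]
    exact (h0 T hT hTN).trans (le_mul_of_one_le_right zero_le (hg1 T))
  | succ m ih =>
    intro T hT hTN
    have hgm : Measurable g := by fun_prop
    have hI : ∫⁻ s in Set.Iic T, a m s ∂leb ≤ A * (2 * κ) ^ m * ∫⁻ s in Set.Iic T, g s ∂leb := by
      rw [← lintegral_const_mul _ hgm]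
      refine lintegral_mono_ae ?_
      have h00 : ∀ᵐ s ∂leb.restrict (Set.Iic T), s ≠ 0 :=
        ae_restrict_of_ae (measure_eq_zero_iff_ae_notMem.1 (measure_singleton (μ := leb) 0))
      filter_upwards [h00, ae_restrict_mem measurableSet_Iic] with s hs hsT
      exact ih s (pos_iff_ne_zero.2 hs) (le_trans hsT hTN)
    calc a (m + 1) T ≤ κ * a m T + C * ∫⁻ s in Set.Iic T, a m s ∂leb := hstep m T hT hTN
      _ ≤ κ * (A * (2 * κ) ^ m * g T) + C * (A * (2 * κ) ^ m * ∫⁻ s in Set.Iic T, g s ∂leb) := by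
          gcongr
          exact ih T hT hTN
      _ = κ * (A * (2 * κ) ^ m * g T) + A * (2 * κ) ^ m * (C * ∫⁻ s in Set.Iic T, g s ∂leb) := by
          ring
      _ ≤ κ * (A * (2 * κ) ^ m * g T) + A * (2 * κ) ^ m * (κ * g T) := by
          exact add_le_add le_rfl (mul_le_mul' le_rfl (hint T))
      _ = A * (2 * κ) ^ (m + 1) * g T := by ring

/-- Iterating the constant sequence gives D ≤ const · 8^(-m) for all m. Finiteness of `D` is
essential; working at T + 1 covers T = 0. -/
lemma eq_zero_of_gronwall {C : ℝ≥0} {D : ℝ≥0 → ℝ≥0∞} (hmono : Monotone D)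
    (hfin : ∀ T, D T < ⊤)
    (h : ∀ T, 0 < T → D T ≤ (16⁻¹ : ℝ≥0) * D T + C * ∫⁻ s in Set.Iic T, D s ∂leb) (T : ℝ≥0) :
    D T = 0 := by
  obtain ⟨G, hG⟩ := le_geometric_of_gronwall (κ := 16⁻¹) (C := C) (by positivity)
  have hp : 0 < T + 1 := by positivity
  have hb := fun m => hG (fun _ => D) (D (T + 1)) (T + 1) (fun s _ hs => hmono hs)
    (fun _ s hs _ => h s hs) m (T + 1) hp le_rfl
  have hlim : Tendsto (fun m : ℕ => D (T + 1) * (2 * ((16⁻¹ : ℝ≥0) : ℝ≥0∞)) ^ m * G (T + 1))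
      atTop (𝓝 (D (T + 1) * 0 * G (T + 1))) := by
    refine ENNReal.Tendsto.mul_const (ENNReal.Tendsto.const_mul ?_ (Or.inr (hfin _).ne))
      (Or.inr ENNReal.coe_ne_top)
    refine ENNReal.tendsto_pow_atTop_nhds_zero_of_lt_one ?_
    norm_cast
    rw [mul_inv_lt_iff₀ (by norm_num)]
    norm_num
  rw [mul_zero, zero_mul] at hlim
  exact le_antisymm ((hmono (le_add_of_nonneg_right zero_le_one : T ≤ T + 1)).trans
    (ge_of_tendsto' hlim hb)) zero_le

/-! ### Limits of paths -/

/-- Each term is at most 2^(-l) times the square root of the weighted sum, and the geometric series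
has sum 2. -/
lemma tsum_sq_le (a : ℕ → ℝ≥0∞) : (∑' l, a l) ^ 2 ≤ 4 * ∑' l, 4 ^ l * a l ^ 2 := by
  set B := ∑' l, 4 ^ l * a l ^ 2
  have h1 : ∀ l, a l ≤ (2⁻¹) ^ l * B ^ (1 / 2 : ℝ) := fun l => by
    refine le_of_sq_le_sq ?_
    rw [mul_pow, rpow_half_sq, ← pow_mul, mul_comm l 2, pow_mul]
    have h2 : 4 ^ l * a l ^ 2 ≤ B := ENNReal.le_tsum l
    have h4 : ((2⁻¹ : ℝ≥0∞) ^ 2) ^ l * 4 ^ l = 1 := by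
      rw [← mul_pow, ← ENNReal.inv_pow]
      norm_num
      rw [ENNReal.inv_mul_cancel (by norm_num) (by norm_num), one_pow]
    calc a l ^ 2 = ((2⁻¹ : ℝ≥0∞) ^ 2) ^ l * (4 ^ l * a l ^ 2) := by rw [← mul_assoc, h4, one_mul]
      _ ≤ _ := by gcongr
  calc (∑' l, a l) ^ 2 ≤ (∑' l, (2⁻¹) ^ l * B ^ (1 / 2 : ℝ)) ^ 2 := by
        gcongr with l
        exact h1 l
    _ = (2 * B ^ (1 / 2 : ℝ)) ^ 2 := by
        rw [ENNReal.tsum_mul_right, ENNReal.tsum_geometric, ENNReal.one_sub_inv_two, inv_inv]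
    _ = 4 * B := by
        rw [mul_pow, rpow_half_sq]
        norm_num

lemma tsum_shift_sq_le (a : ℕ → ℝ≥0∞) (m : ℕ) :
    (∑' l, a (m + l)) ^ 2 ≤ 4 * (4⁻¹) ^ m * ∑' l, 4 ^ l * a l ^ 2 := by
  refine (tsum_sq_le fun l => a (m + l)).trans ?_
  rw [mul_assoc]
  gcongr
  have h4 : (4⁻¹ : ℝ≥0∞) ^ m * 4 ^ m = 1 := by
    rw [← mul_pow, ENNReal.inv_mul_cancel (by norm_num) (by norm_num), one_pow]
  calc ∑' l, 4 ^ l * a (m + l) ^ 2 = (4⁻¹) ^ m * ∑' l, 4 ^ (m + l) * a (m + l) ^ 2 := by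
        rw [← ENNReal.tsum_mul_left]
        refine tsum_congr fun l => ?_
        rw [pow_add, ← mul_assoc, ← mul_assoc, h4, one_mul]
    _ ≤ _ := by
        exact mul_le_mul' le_rfl (ENNReal.tsum_comp_le_tsum_of_injective (add_right_injective m)
          (fun l => 4 ^ l * a l ^ 2))

section PathLimit

variable {E V : Type*} [NormedAddCommGroup E] [NormedSpace ℝ E] [CompleteSpace E]
  [NormedAddCommGroup V] [NormedSpace ℝ V] {j : E →L[ℝ] V}

/-- If the increments are summable in `E`, completeness of `E` gives a limit there, and continuity
of `j` identifies it with the limit in `V`. -/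
lemma eNormE_sub_le_tsum (hj : Function.Injective j) {v : ℕ → V} {v' : V}
    (hv : Tendsto v atTop (𝓝 v')) (m : ℕ) :
    eNormE j (v' - v m) ≤ ∑' l, eNormE j (v (m + l + 1) - v (m + l)) := by
  by_cases htop : ∑' l, eNormE j (v (m + l + 1) - v (m + l)) = ⊤
  · rw [htop]; exact le_top
  have hfin := ENNReal.ne_top_of_tsum_ne_top htop
  choose e he using fun l => mem_range_of_eNormE_ne_top (hfin l)
  have hen : ∀ l, eNormE j (v (m + l + 1) - v (m + l)) = ‖e l‖ₑ := fun l => by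
    rw [← he l, eNormE_apply hj]
  simp only [hen] at htop ⊢
  have hs : Summable e :=
    Summable.of_norm (NNReal.summable_coe.2 (ENNReal.tsum_coe_ne_top_iff_summable.1 htop))
  have h1 : Tendsto (fun n => j (∑ l ∈ Finset.range n, e l)) atTop (𝓝 (j (∑' l, e l))) :=
    (j.continuous.tendsto _).comp hs.hasSum.tendsto_sum_nat
  have h2 : ∀ n, j (∑ l ∈ Finset.range n, e l) = v (m + n) - v m := fun n => by
    rw [map_sum]
    simp only [he]
    exact Finset.sum_range_sub (fun l => v (m + l)) n
  simp only [h2] at h1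
  have h3 : Tendsto (fun n => v (m + n) - v m) atTop (𝓝 (v' - v m)) :=
    (hv.comp (tendsto_add_atTop_nat m |>.congr fun n => add_comm _ _)).sub_const _
  rw [tendsto_nhds_unique h3 h1, eNormE_apply hj]
  exact enorm_tsum_le_tsum_enorm

end PathLimit

section PathLimit

variable {E V : Type*} [NormedAddCommGroup E] [NormedSpace ℝ E] [CompleteSpace E]
  [SecondCountableTopology E] [NormedAddCommGroup V] [NormedSpace ℝ V] [CompleteSpace V]
  [MeasurableSpace V] [BorelSpace V] [SecondCountableTopology V] {j : E →L[ℝ] V}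

/-- Completeness of the path space, for rapidly converging sequences. -/
lemma exists_path_limit (hj : Function.Injective j) {w : ℕ → ℝ≥0 → V} (hc : ∀ m, Continuous (w m))
    (hfin : ∀ N : ℕ, ∑' l, 4 ^ l * xSq j (fun s => w (l + 1) s - w l s) N ≠ ⊤) :
    ∃ v : ℝ≥0 → V, Continuous v ∧ (∀ s, Tendsto (fun m => w m s) atTop (𝓝 (v s))) ∧
      ∀ m T, xSq j (fun s => v s - w m s) T ≤
        4 * 4⁻¹ ^ m * ∑' l, 4 ^ l * xSq j (fun s => w (l + 1) s - w l s) T := by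
  have hed : ∀ l s, edist (w l s) (w (l + 1) s) ≤ ‖w (l + 1) s - w l s‖ₑ := fun l s => by
    rw [edist_comm, edist_eq_enorm_sub]
  have hsum : ∀ s T, s ≤ T → ∑' l, 4 ^ l * ‖w (l + 1) s - w l s‖ₑ ^ 2 ≤
      ∑' l, 4 ^ l * xSq j (fun s => w (l + 1) s - w l s) T := fun s T hs =>
    ENNReal.tsum_le_tsum fun l => mul_le_mul' le_rfl
      (enorm_sq_le_xSq (j := j) (fun s => w (l + 1) s - w l s) hs)
  have hcau : ∀ s, CauchySeq (fun m => w m s) := fun s => by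
    obtain ⟨N, hN⟩ := exists_nat_ge s
    refine cauchySeq_of_edist_le_of_tsum_ne_top _ (fun l => hed l s) fun htop => hfin N ?_
    have h1 := (tsum_sq_le fun l => ‖w (l + 1) s - w l s‖ₑ).trans (mul_le_mul' le_rfl (hsum s N hN))
    rw [htop, ENNReal.top_pow two_ne_zero, top_le_iff] at h1
    by_contra h2
    exact ENNReal.mul_ne_top (by norm_num) h2 h1
  choose v hv using fun s => cauchySeq_tendsto_of_complete (hcau s)
  have hbound : ∀ m T, xSq j (fun s => v s - w m s) T ≤
      4 * 4⁻¹ ^ m * ∑' l, 4 ^ l * xSq j (fun s => w (l + 1) s - w l s) T := by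
    intro m T
    have h1 : (⨆ s ∈ Set.Iic T, ‖v s - w m s‖ₑ ^ 2) ≤ 4 * 4⁻¹ ^ m *
        ∑' l, 4 ^ l * (⨆ s ∈ Set.Iic T, ‖w (l + 1) s - w l s‖ₑ ^ 2) := by
      refine iSup₂_le fun s hs => ?_
      have h2 : ‖v s - w m s‖ₑ ≤ ∑' l, ‖w (m + l + 1) s - w (m + l) s‖ₑ := by
        have := edist_le_tsum_of_edist_le_of_tendsto _ (fun l => hed l s) (hv s) m
        rwa [edist_comm, edist_eq_enorm_sub] at this
      calc ‖v s - w m s‖ₑ ^ 2 ≤ (∑' l, ‖w (m + l + 1) s - w (m + l) s‖ₑ) ^ 2 :=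
            pow_le_pow_left' h2 2
        _ ≤ 4 * 4⁻¹ ^ m * ∑' l, 4 ^ l * ‖w (l + 1) s - w l s‖ₑ ^ 2 :=
            tsum_shift_sq_le (fun l => ‖w (l + 1) s - w l s‖ₑ) m
        _ ≤ _ := mul_le_mul' le_rfl (ENNReal.tsum_le_tsum fun l => mul_le_mul' le_rfl
            (le_iSup₂ (f := fun s (_ : s ∈ Set.Iic T) => ‖w (l + 1) s - w l s‖ₑ ^ 2) s hs))
    have h3 : ∫⁻ s in Set.Iic T, eNormE j (v s - w m s) ^ 2 ∂leb ≤ 4 * 4⁻¹ ^ m *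
        ∑' l, 4 ^ l * ∫⁻ s in Set.Iic T, eNormE j (w (l + 1) s - w l s) ^ 2 ∂leb := by
      have hm : ∀ l, Measurable (fun s => 4 ^ l * eNormE j (w (l + 1) s - w l s) ^ 2) := fun l =>
        (((measurable_eNormE hj).comp ((hc (l + 1)).sub (hc l)).measurable).pow_const 2).const_mul _
      have h4 : ∀ l, 4 ^ l * ∫⁻ s in Set.Iic T, eNormE j (w (l + 1) s - w l s) ^ 2 ∂leb =
          ∫⁻ s in Set.Iic T, 4 ^ l * eNormE j (w (l + 1) s - w l s) ^ 2 ∂leb := fun l =>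
        (lintegral_const_mul' _ _ (ENNReal.pow_ne_top (by norm_num))).symm
      simp only [h4]
      rw [← lintegral_tsum fun l => (hm l).aemeasurable,
        ← lintegral_const_mul _ (Measurable.tsum hm)]
      refine lintegral_mono fun s => ?_
      exact (pow_le_pow_left' (eNormE_sub_le_tsum hj (hv s) m) 2).trans
        (tsum_shift_sq_le (fun l => eNormE j (w (l + 1) s - w l s)) m)
    refine (add_le_add h1 h3).trans_eq ?_
    rw [← mul_add, ← ENNReal.tsum_add]
    simp only [xSq, mul_add]
  refine ⟨v, ?_, hv, hbound⟩
  -- The tail bound at time N dominates the supremum over [0, N], so convergence is locally uniform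
  -- and the limit is continuous.
  have hunif : ∀ N : ℕ, TendstoUniformlyOn w v atTop (Set.Iic (N : ℝ≥0)) := by
    intro N
    rw [EMetric.tendstoUniformlyOn_iff]
    intro ε hε
    set B := ∑' l, 4 ^ l * xSq j (fun s => w (l + 1) s - w l s) N
    have hlim : Tendsto (fun m : ℕ => 4 * (4⁻¹ : ℝ≥0∞) ^ m * B) atTop (𝓝 (4 * 0 * B)) := by
      refine ENNReal.Tendsto.mul_const (ENNReal.Tendsto.const_mul ?_ (Or.inr (by norm_num)))
        (Or.inr (hfin N))
      refine ENNReal.tendsto_pow_atTop_nhds_zero_of_lt_one ?_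
      exact ENNReal.inv_lt_one.2 (by norm_num)
    rw [mul_zero, zero_mul] at hlim
    filter_upwards [hlim.eventually_lt_const (ENNReal.pow_pos hε 2 : 0 < ε ^ 2)] with m hm s hs
    rw [edist_eq_enorm_sub]
    refine lt_of_pow_lt_pow_left' 2 (lt_of_le_of_lt ?_ hm)
    exact (enorm_sq_le_xSq (fun s => v s - w m s) hs).trans (hbound m N)
  refine continuous_iff_continuousAt.2 fun s => ?_
  obtain ⟨N, hN⟩ := exists_nat_gt s
  exact ((hunif N).continuousOn (.of_forall fun m => (hc m).continuousOn)).continuousAt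
    (Iic_mem_nhds hN)

end PathLimit

/-! ### Contraction estimate and localized uniqueness -/

section FixedPoint

variable {E V H Ω : Type*}
  [NormedAddCommGroup E] [NormedSpace ℝ E] [CompleteSpace E] [SecondCountableTopology E]
  [NormedAddCommGroup V] [NormedSpace ℝ V] [CompleteSpace V] [SecondCountableTopology V]
  [NormedAddCommGroup H] [NormedSpace ℝ H] [SecondCountableTopology H]
  {mΩ : MeasurableSpace Ω} {j : E →L[ℝ] V} {k : V →L[ℝ] H} {S : ℝ≥0 → H →L[ℝ] H}
  {W : ℝ≥0 → Ω → ℝ} {𝓕 : Filtration ℝ≥0 mΩ} {P : Measure Ω} [IsProbabilityMeasure P]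
  {F : E → H} {G : E → V} {θ : ℝ → ℝ} {R : ℝ} {u₀ : Ω → V}

lemma IsRegular.isBoundedData_trunc {X : Type*} [NormedAddCommGroup X] [NormedSpace ℝ X]
    (hj : Function.Injective j) {Φ : E → X} (hΦ : PolyLocallyLipschitz j Φ) (hθ : IsCutoff θ)
    (hR : 0 < R) {u : ℝ≥0 → Ω → V} (hu : IsRegular j 𝓕 u) :
    IsBoundedData 𝓕 (fun r ω => trunc j θ R Φ (fun s => u s ω) r) := by
  borelize V
  refine ⟨hu.stronglyProgressive_trunc hj hΦ hθ hR, fun T => ?_⟩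
  obtain ⟨C, hC⟩ := exists_lintegral_trunc_le hj hΦ hθ hR T
  exact ⟨C, fun ω => hC _ (hu.finite ω T)⟩

lemma isRegular_leftContinuous {u : ℝ≥0 → Ω → V} (hu : IsRegular j 𝓕 u) {B : Set (ℝ≥0 × Ω)} :
    ∀ᵐ ω ∂P, ∀ t, (t, ω) ∈ B → ContinuousWithinAt (fun s => u s ω) (Set.Iic t) t :=
  .of_forall fun ω t _ => hu.leftCont ω t

/-- The solution of the linear problem is unique up to indistinguishability, so the bound for the
constructed solution passes to every regular one. -/
lemma exists_mild_estimate (hj : Function.Injective j) (hk : Function.Injective k)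
    (hW : IsWienerProcess W 𝓕 P) (h𝓕 : UsualConditions 𝓕 P)
    (hS : SemigroupAssumption j k S W 𝓕 P) :
    ∃ (C : ℝ≥0) (D : ℝ≥0 → ℝ≥0), ∀ (u₀ : Ω → V) (f : ℝ≥0 → Ω → H) (ξ z : ℝ≥0 → Ω → V),
      StronglyMeasurable[𝓕 0] u₀ → IsBoundedData 𝓕 f → IsBoundedData 𝓕 ξ → IsRegular j 𝓕 z →
      MildOn k S W 𝓕 P u₀ Set.univ f ξ z →
        ∀ T, 0 < T → ∫⁻ ω, xSq j (fun s => z s ω) T ∂P ≤ D T * ∫⁻ ω, ‖u₀ ω‖ₑ ^ 2 ∂P +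
          C * (∫⁻ ω, ∫⁻ s in Set.Iic T, ‖f s ω‖ₑ ^ 2 ∂leb ∂P +
            ∫⁻ ω, ∫⁻ s in Set.Iic T, ‖ξ s ω‖ₑ ^ 2 ∂leb ∂P) := by
  obtain ⟨C, D, h⟩ := exists_mild hj hk hW h𝓕 hS
  refine ⟨C, D, fun u₀ f ξ z hu₀ hf hξ hz hm T hT => ?_⟩
  obtain ⟨z', hz', -, hm', hT'⟩ := h u₀ f ξ hu₀ hf hξ
  have heq := hm.ae_eq_of_forall_mem hk hW hm' (fun _ _ _ _ _ => trivial) (by simp)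
    (isRegular_leftContinuous hz) (isRegular_leftContinuous hz')
  refine le_trans (lintegral_mono_ae ?_) (hT' T hT)
  filter_upwards [heq] with ω hω
  exact (xSq_congr fun s _ => hω s trivial).le

lemma lintegral_data_le {C : ℝ≥0} {X : Type*} [NormedAddCommGroup X] {f : ℝ≥0 → Ω → X} {T : ℝ≥0}
    (hC : ∀ ω, ∫⁻ s in Set.Iic T, ‖f s ω‖ₑ ^ 2 ∂leb ≤ C) :
    ∫⁻ ω, ∫⁻ s in Set.Iic T, ‖f s ω‖ₑ ^ 2 ∂leb ∂P ≤ C := by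
  refine (lintegral_mono hC).trans ?_
  simp

lemma lintegral_xSq_lt_top (hj : Function.Injective j) (hk : Function.Injective k)
    (hW : IsWienerProcess W 𝓕 P) (h𝓕 : UsualConditions 𝓕 P)
    (hS : SemigroupAssumption j k S W 𝓕 P) (hu₀ : StronglyMeasurable[𝓕 0] u₀)
    (hu₀' : ∫⁻ ω, ‖u₀ ω‖ₑ ^ 2 ∂P < ⊤) {f : ℝ≥0 → Ω → H} {ξ z : ℝ≥0 → Ω → V}
    (hf : IsBoundedData 𝓕 f) (hξ : IsBoundedData 𝓕 ξ) (hz : IsRegular j 𝓕 z)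
    (hm : MildOn k S W 𝓕 P u₀ Set.univ f ξ z) (T : ℝ≥0) :
    ∫⁻ ω, xSq j (fun s => z s ω) T ∂P < ⊤ := by
  obtain ⟨C, D, h⟩ := exists_mild_estimate hj hk hW h𝓕 hS
  have hp : 0 < T + 1 := by positivity
  obtain ⟨C₁, hC₁⟩ := hf.bound (T + 1)
  obtain ⟨C₂, hC₂⟩ := hξ.bound (T + 1)
  have h1 := h u₀ f ξ z hu₀ hf hξ hz hm (T + 1) hp
  refine lt_of_le_of_lt ((lintegral_mono fun ω =>
    xSq_mono _ (le_add_of_nonneg_right zero_le_one : T ≤ T + 1)).trans h1) ?_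
  refine ENNReal.add_lt_top.2 ⟨ENNReal.mul_lt_top (by simp) hu₀',
    ENNReal.mul_lt_top (by simp) (ENNReal.add_lt_top.2 ⟨?_, ?_⟩)⟩
  · exact (lintegral_data_le hC₁).trans_lt ENNReal.coe_lt_top
  · exact (lintegral_data_le hC₂).trans_lt ENNReal.coe_lt_top

/-- Mean-square Lipschitz estimate for the truncated nonlinearity, on a set `B` of times and
events. -/
lemma exists_lintegral_indicator_trunc_sub_le {X : Type*} [NormedAddCommGroup X] [NormedSpace ℝ X]
    (hj : Function.Injective j) {Φ : E → X} (hΦ : PolyLocallyLipschitz j Φ) (hθ : IsCutoff θ)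
    (hR : 0 < R) {η : ℝ≥0} (hη : 0 < η) :
    ∃ C : ℝ≥0, ∀ (B : Set (ℝ≥0 × Ω)) (u v z : ℝ≥0 → Ω → V),
      (∀ s t ω, s ≤ t → (t, ω) ∈ B → (s, ω) ∈ B) →
      IsRegular j 𝓕 u → IsRegular j 𝓕 v → IsRegular j 𝓕 z →
      (∀ᵐ ω ∂P, ∀ t, (t, ω) ∈ B → u t ω - v t ω = z t ω) → ∀ T,
      ∫⁻ ω, ∫⁻ r in Set.Iic T, ‖B.indicator (fun p => trunc j θ R Φ (fun s => u s p.2) p.1 -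
          trunc j θ R Φ (fun s => v s p.2) p.1) (r, ω)‖ₑ ^ 2 ∂leb ∂P ≤
        η * ∫⁻ ω, xSq j (fun s => z s ω) T ∂P +
          C * ∫⁻ r in Set.Iic T, ∫⁻ ω, xSq j (fun s => z s ω) r ∂P ∂leb := by
  borelize V
  obtain ⟨C, hC⟩ := exists_lintegral_trunc_sub_le hj hΦ hθ hR hη
  refine ⟨C, fun B u v z hB hu hv hz huv T => ?_⟩
  have hpt : ∀ᵐ ω ∂P, ∫⁻ r in Set.Iic T, ‖B.indicator (fun p =>
      trunc j θ R Φ (fun s => u s p.2) p.1 - trunc j θ R Φ (fun s => v s p.2) p.1) (r, ω)‖ₑ ^ 2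
        ∂leb ≤ η * xSq j (fun s => z s ω) T +
          C * ∫⁻ r in Set.Iic T, xSq j (fun s => z s ω) r ∂leb := by
    filter_upwards [huv] with ω hω
    -- The section of `B` at ω is an initial segment of time, so the pathwise estimate on each [0,
    -- t] inside it suffices.
    set L : Set ℝ≥0 := {r | r ≤ T ∧ (r, ω) ∈ B} with hLdef
    have hL : IsLowerSet L := fun a b hba ha => ⟨hba.trans ha.1, hB b a ω hba ha.2⟩
    have hLm : MeasurableSet L := hL.ordConnected.measurableSet
    have h1 : ∫⁻ r in Set.Iic T, ‖B.indicator (fun p => trunc j θ R Φ (fun s => u s p.2) p.1 -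
          trunc j θ R Φ (fun s => v s p.2) p.1) (r, ω)‖ₑ ^ 2 ∂leb =
        ∫⁻ r in L, ‖trunc j θ R Φ (fun s => u s ω) r - trunc j θ R Φ (fun s => v s ω) r‖ₑ ^ 2
          ∂leb := by
      rw [← lintegral_indicator measurableSet_Iic, ← lintegral_indicator hLm]
      refine lintegral_congr fun r => ?_
      by_cases hr : r ≤ T <;> by_cases hr' : (r, ω) ∈ B <;>
        simp [Set.indicator_apply, hLdef, hr, hr']
    rw [h1]
    refine setLIntegral_le_of_isLowerSet hL _ fun t ht => ?_
    refine (hC _ _ (fun s => z s ω) t (hu.measurable_path ω) (hv.measurable_path ω)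
      (fun s hs => hω s (hB s t ω hs ht.2)) (hu.finite ω t) (hv.finite ω t)).trans ?_
    exact add_le_add (mul_le_mul' le_rfl (xSq_mono _ ht.1))
      (mul_le_mul' le_rfl (lintegral_mono_set (Set.Iic_subset_Iic.2 ht.1)))
  refine (lintegral_mono_ae hpt).trans_eq ?_
  rw [lintegral_add_left ((hz.measurable_xSq hj T).const_mul _),
    lintegral_const_mul' _ _ ENNReal.coe_ne_top, lintegral_const_mul' _ _ ENNReal.coe_ne_top]
  congr 2
  rw [lintegral_lintegral_swap]
  exact ((hz.measurable_uncurry_xSq hj).comp measurable_swap).aemeasurable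

/-- The contraction estimate behind existence and uniqueness. -/
lemma exists_contraction (hj : Function.Injective j) (hk : Function.Injective k)
    (hW : IsWienerProcess W 𝓕 P) (h𝓕 : UsualConditions 𝓕 P)
    (hS : SemigroupAssumption j k S W 𝓕 P) (hF : PolyLocallyLipschitz j F)
    (hG : PolyLocallyLipschitz j G) (hθ : IsCutoff θ) (hR : 0 < R) :
    ∃ C : ℝ≥0, ∀ (B : Set (ℝ≥0 × Ω)) (u v z z' : ℝ≥0 → Ω → V),
      (∀ s t ω, s ≤ t → (t, ω) ∈ B → (s, ω) ∈ B) →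
      (∀ t : ℝ≥0, MeasurableSet[Subtype.instMeasurableSpace.prod (𝓕 t)]
        {p : Set.Iic t × Ω | ((p.1 : ℝ≥0), p.2) ∈ B}) →
      IsRegular j 𝓕 u → IsRegular j 𝓕 v → IsRegular j 𝓕 z → IsRegular j 𝓕 z' →
      (∀ᵐ ω ∂P, ∀ t, (t, ω) ∈ B → u t ω - v t ω = z' t ω) →
      MildOn k S W 𝓕 P (fun _ => 0) Set.univ
        (fun r ω => B.indicator (fun p => trunc j θ R F (fun s => u s p.2) p.1 -
          trunc j θ R F (fun s => v s p.2) p.1) (r, ω))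
        (fun r ω => B.indicator (fun p => trunc j θ R G (fun s => u s p.2) p.1 -
          trunc j θ R G (fun s => v s p.2) p.1) (r, ω)) z →
      ∀ T, 0 < T → ∫⁻ ω, xSq j (fun s => z s ω) T ∂P ≤
        (16⁻¹ : ℝ≥0) * ∫⁻ ω, xSq j (fun s => z' s ω) T ∂P +
          C * ∫⁻ r in Set.Iic T, ∫⁻ ω, xSq j (fun s => z' s ω) r ∂P ∂leb := by
  obtain ⟨C, D, h⟩ := exists_mild_estimate hj hk hW h𝓕 hS
  -- Drift and noise each contribute Cη, and 2Cη ≤ 1/16.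
  set η : ℝ≥0 := (32 * (C + 1))⁻¹ with hη
  have hη0 : 0 < η := by positivity
  obtain ⟨C₁, hC₁⟩ := exists_lintegral_indicator_trunc_sub_le (P := P) (𝓕 := 𝓕) hj hF hθ hR hη0
  obtain ⟨C₂, hC₂⟩ := exists_lintegral_indicator_trunc_sub_le (P := P) (𝓕 := 𝓕) hj hG hθ hR hη0
  refine ⟨C * (C₁ + C₂), fun B u v z z' hB hBm hu hv hz hz' huv hm T hT => ?_⟩
  have h1 := h (fun _ => 0) _ _ z stronglyMeasurable_const
    (((hu.isBoundedData_trunc hj hF hθ hR).sub (hv.isBoundedData_trunc hj hF hθ hR)).indicator hBm)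
    (((hu.isBoundedData_trunc hj hG hθ hR).sub (hv.isBoundedData_trunc hj hG hθ hR)).indicator hBm)
    hz hm T hT
  have h0 : ∫⁻ _ : Ω, ‖(0 : V)‖ₑ ^ 2 ∂P = 0 := by simp
  rw [h0, mul_zero, zero_add] at h1
  refine h1.trans ((mul_le_mul' le_rfl (add_le_add (hC₁ B u v z' hB hu hv hz' huv T)
    (hC₂ B u v z' hB hu hv hz' huv T))).trans ?_)
  set a := ∫⁻ ω, xSq j (fun s => z' s ω) T ∂P
  set b := ∫⁻ r in Set.Iic T, ∫⁻ ω, xSq j (fun s => z' s ω) r ∂P ∂leb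
  have hCη : C * (2 * η) ≤ 16⁻¹ := by
    rw [hη, ← NNReal.coe_le_coe]
    push_cast
    rw [mul_inv, ← mul_assoc, ← mul_assoc, ← div_eq_mul_inv, div_le_iff₀ (by positivity)]
    have := C.2
    nlinarith
  calc (C : ℝ≥0∞) * (η * a + C₁ * b + (η * a + C₂ * b))
      = ((C * (2 * η) : ℝ≥0) : ℝ≥0∞) * a + ((C * (C₁ + C₂) : ℝ≥0) : ℝ≥0∞) * b := by
        push_cast
        ring
    _ ≤ _ := by gcongr

/-- Two processes that solve the truncated equation on a set `B` coincide on `B`. -/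
lemma ae_eq_on_of_mildOn (hj : Function.Injective j) (hk : Function.Injective k)
    (hW : IsWienerProcess W 𝓕 P) (h𝓕 : UsualConditions 𝓕 P)
    (hS : SemigroupAssumption j k S W 𝓕 P) (hF : PolyLocallyLipschitz j F)
    (hG : PolyLocallyLipschitz j G) (hθ : IsCutoff θ) (hR : 0 < R) {B : Set (ℝ≥0 × Ω)}
    (hB : ∀ s t ω, s ≤ t → (t, ω) ∈ B → (s, ω) ∈ B)
    (hBm : ∀ t : ℝ≥0, MeasurableSet[Subtype.instMeasurableSpace.prod (𝓕 t)]
        {p : Set.Iic t × Ω | ((p.1 : ℝ≥0), p.2) ∈ B})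
    {u v : ℝ≥0 → Ω → V} (hu : IsRegular j 𝓕 u) (hv : IsRegular j 𝓕 v)
    {f f' : ℝ≥0 → Ω → H} {ξ ξ' : ℝ≥0 → Ω → V}
    (hmu : MildOn k S W 𝓕 P u₀ B f ξ u) (hmv : MildOn k S W 𝓕 P u₀ B f' ξ' v)
    (hdu : ∀ᵐ ω ∂P, ∀ t, (t, ω) ∈ B → f t ω = trunc j θ R F (fun s => u s ω) t ∧
      ξ t ω = trunc j θ R G (fun s => u s ω) t)
    (hdv : ∀ᵐ ω ∂P, ∀ t, (t, ω) ∈ B → f' t ω = trunc j θ R F (fun s => v s ω) t ∧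
      ξ' t ω = trunc j θ R G (fun s => v s ω) t) :
    ∀ᵐ ω ∂P, ∀ t, (t, ω) ∈ B → u t ω = v t ω := by
  borelize V
  have hf := ((hu.isBoundedData_trunc hj hF hθ hR).sub
    (hv.isBoundedData_trunc hj hF hθ hR)).indicator hBm
  have hξ := ((hu.isBoundedData_trunc hj hG hθ hR).sub
    (hv.isBoundedData_trunc hj hG hθ hR)).indicator hBm
  obtain ⟨_, _, hex⟩ := exists_mild hj hk hW h𝓕 hS
  -- `z` solves the linear problem on the whole time axis with data cut off outside `B`; it agrees
  -- with u - v on `B` and has finite second moments, which u - v may lack.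
  obtain ⟨z, hz, -, hmz, -⟩ := hex (fun _ => 0) _ _ stronglyMeasurable_const hf hξ
  obtain ⟨C, hC⟩ := exists_contraction (R := R) hj hk hW h𝓕 hS hF hG hθ hR
  have huv : ∀ᵐ ω ∂P, ∀ t, (t, ω) ∈ B → u t ω - v t ω = z t ω := by
    have hsub := hmu.sub hmv
    simp only [sub_self] at hsub
    refine hsub.ae_eq_of_forall_mem hk hW (hmz.mono (Set.subset_univ B)) hB ?_
      (isRegular_leftContinuous (hu.sub hj hv)) (isRegular_leftContinuous hz)
    filter_upwards [hdu, hdv] with ω h1 h2 t ht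
    rw [Set.indicator_of_mem ht, Set.indicator_of_mem ht, (h1 t ht).1, (h1 t ht).2, (h2 t ht).1,
      (h2 t ht).2]
    exact ⟨rfl, rfl⟩
  -- The data of `z` depend only on u - v on `B`, that is, on `z` itself, so the contraction
  -- estimate closes with z' = z.
  have hD := eq_zero_of_gronwall (D := fun T => ∫⁻ ω, xSq j (fun s => z s ω) T ∂P)
    (fun a b hab => lintegral_mono fun ω => xSq_mono _ hab)
    (fun T => lintegral_xSq_lt_top hj hk hW h𝓕 hS stronglyMeasurable_const (by simp) hf hξ hz
      hmz T)
    (hC B u v z z hB hBm hu hv hz hz huv hmz)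
  have hz0 : ∀ᵐ ω ∂P, ∀ N : ℕ, xSq j (fun s => z s ω) N = 0 := ae_all_iff.2 fun N =>
    (lintegral_eq_zero_iff (hz.measurable_xSq hj N)).1 (hD N)
  filter_upwards [huv, hz0] with ω h1 h2 t ht
  obtain ⟨N, hN⟩ := exists_nat_ge t
  have h3 := h1 t ht
  rw [eq_zero_of_xSq_eq_zero (h2 N) hN] at h3
  exact sub_eq_zero.1 h3

end FixedPoint

/-! ### Picard iteration for the truncated equation -/

section Existence

variable {E V H Ω : Type*}
  [NormedAddCommGroup E] [NormedSpace ℝ E] [CompleteSpace E] [SecondCountableTopology E]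
  [NormedAddCommGroup V] [NormedSpace ℝ V] [CompleteSpace V] [SecondCountableTopology V]
  [NormedAddCommGroup H] [NormedSpace ℝ H] [SecondCountableTopology H]
  {mΩ : MeasurableSpace Ω} {j : E →L[ℝ] V} {k : V →L[ℝ] H} {S : ℝ≥0 → H →L[ℝ] H}
  {W : ℝ≥0 → Ω → ℝ} {𝓕 : Filtration ℝ≥0 mΩ} {P : Measure Ω} [IsProbabilityMeasure P]
  {F : E → H} {G : E → V} {θ : ℝ → ℝ} {R : ℝ} {u₀ : Ω → V}

/-- A rapidly Cauchy sequence of regular processes has a regular limit. -/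
lemma exists_regular_limit (hj : Function.Injective j) (h𝓕 : UsualConditions 𝓕 P)
    {U : ℕ → ℝ≥0 → Ω → V} (hU : ∀ m, IsRegular j 𝓕 (U m)) (hUc : ∀ m ω, Continuous (fun t => U m t ω))
    (hfin : ∀ N : ℕ, ∑' l, 4 ^ l * ∫⁻ ω, xSq j (fun s => U (l + 1) s ω - U l s ω) N ∂P ≠ ⊤) :
    ∃ u : ℝ≥0 → Ω → V, IsRegular j 𝓕 u ∧ (∀ ω, Continuous (fun t => u t ω)) ∧
      ∀ m (N : ℕ), ∫⁻ ω, xSq j (fun s => u s ω - U m s ω) N ∂P ≤ 4 * 4⁻¹ ^ m *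
        ∑' l, 4 ^ l * ∫⁻ ω, xSq j (fun s => U (l + 1) s ω - U l s ω) N ∂P := by
  borelize V
  have hmeas : ∀ l (N : ℝ≥0), Measurable (fun ω => 4 ^ l * xSq j (fun s => U (l + 1) s ω - U l s ω) N) :=
    fun l N => (((hU (l + 1)).sub hj (hU l)).measurable_xSq hj N).const_mul _
  have hswap : ∀ N : ℝ≥0, ∫⁻ ω, ∑' l, 4 ^ l * xSq j (fun s => U (l + 1) s ω - U l s ω) N ∂P =
      ∑' l, 4 ^ l * ∫⁻ ω, xSq j (fun s => U (l + 1) s ω - U l s ω) N ∂P := fun N => by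
    rw [lintegral_tsum fun l => (hmeas l N).aemeasurable]
    exact tsum_congr fun l => lintegral_const_mul' _ _ (ENNReal.pow_ne_top (by norm_num))
  set Ω₀ : Set Ω := {ω | ∀ N : ℕ, ∑' l, 4 ^ l * xSq j (fun s => U (l + 1) s ω - U l s ω) N ≠ ⊤}
    with hΩ₀
  have hae : ∀ᵐ ω ∂P, ω ∈ Ω₀ := ae_all_iff.2 fun N => by
    have h1 := ae_lt_top (μ := P) (Measurable.tsum fun l => hmeas l N)
      (by rw [hswap]; exact hfin N)
    filter_upwards [h1] with ω hω using hω.ne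
  have hex : ∀ ω, ∃ v : ℝ≥0 → V, Continuous v ∧ (ω ∉ Ω₀ → v = 0) ∧
      (ω ∈ Ω₀ → (∀ s, Tendsto (fun m => U m s ω) atTop (𝓝 (v s))) ∧
      ∀ m T, xSq j (fun s => v s - U m s ω) T ≤
        4 * 4⁻¹ ^ m * ∑' l, 4 ^ l * xSq j (fun s => U (l + 1) s ω - U l s ω) T) := fun ω => by
    by_cases hω : ω ∈ Ω₀
    · obtain ⟨v, h1, h2, h3⟩ := exists_path_limit hj (fun m => hUc m ω) hω
      exact ⟨v, h1, fun h => absurd hω h, fun _ => ⟨h2, h3⟩⟩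
    · exact ⟨0, continuous_const, fun _ => rfl, fun h => absurd h hω⟩
  choose v hvc hv0 hv using hex
  have hm : ∀ t, MeasurableSet[𝓕 t] Ω₀ := fun t => by
    have := (h𝓕.measurableSet_of_null (mem_ae_iff.1 hae) t).compl
    rwa [compl_compl] at this
  refine ⟨fun t ω => v ω t, ⟨fun t => ?_, fun ω t => (hvc ω).continuousWithinAt, fun ω T => ?_⟩, hvc,
    fun m N => ?_⟩
  · refine stronglyMeasurable_of_tendsto (f := fun m => Ω₀.indicator (U m t)) atTop
      (fun m => ((hU m).adapted t).indicator (hm t)) ?_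
    rw [tendsto_pi_nhds]
    intro ω
    by_cases hω : ω ∈ Ω₀
    · simp only [Set.indicator_of_mem hω]
      exact (hv ω hω).1 t
    · simp only [Set.indicator_of_notMem hω, hv0 ω hω]
      exact tendsto_const_nhds
  · by_cases hω : ω ∈ Ω₀
    · obtain ⟨N, hN⟩ := exists_nat_ge T
      have h1 : xSq j (fun s => v ω s - U 0 s ω) T < ⊤ := by
        refine ((xSq_mono _ hN).trans ((hv ω hω).2 0 N)).trans_lt ?_
        exact ENNReal.mul_lt_top (by norm_num) (hω N).lt_top
      have h2 := xSq_add_le (w := fun s => v ω s - U 0 s ω) (z := fun s => U 0 s ω) (T := T) hj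
        ((hvc ω).sub (hUc 0 ω)).measurable
      simp only [sub_add_cancel] at h2
      exact h2.trans_lt (ENNReal.add_lt_top.2 ⟨ENNReal.mul_lt_top (by simp) h1,
        ENNReal.mul_lt_top (by simp) ((hU 0).finite ω T)⟩)
    · simp only [hv0 ω hω, Pi.zero_apply]
      rw [xSq_zero hj]
      exact ENNReal.zero_lt_top
  · rw [← hswap, ← lintegral_const_mul' _ _ (by finiteness)]
    refine lintegral_mono_ae ?_
    filter_upwards [hae] with ω hω
    exact (hv ω hω).2 m N

/-- The truncated equation has a global solution. -/
lemma exists_mildOn_trunc (hj : Function.Injective j) (hk : Function.Injective k)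
    (hW : IsWienerProcess W 𝓕 P) (h𝓕 : UsualConditions 𝓕 P)
    (hS : SemigroupAssumption j k S W 𝓕 P) (hF : PolyLocallyLipschitz j F)
    (hG : PolyLocallyLipschitz j G) (hθ : IsCutoff θ) (hR : 0 < R)
    (hu₀ : StronglyMeasurable[𝓕 0] u₀) (hu₀' : ∫⁻ ω, ‖u₀ ω‖ₑ ^ 2 ∂P < ⊤) :
    ∃ u : ℝ≥0 → Ω → V, IsRegular j 𝓕 u ∧ (∀ ω, Continuous (fun t => u t ω)) ∧
      MildOn k S W 𝓕 P u₀ Set.univ (fun r ω => trunc j θ R F (fun s => u s ω) r)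
        (fun r ω => trunc j θ R G (fun s => u s ω) r) u := by
  borelize V
  -- One Picard step. The input need not have finite moments, because truncated data are bounded in
  -- L² uniformly in ω.
  have hstep : ∀ u : {u : ℝ≥0 → Ω → V // IsRegular j 𝓕 u}, ∃ z : {u : ℝ≥0 → Ω → V // IsRegular j 𝓕 u},
      (∀ ω, Continuous (fun t => z.1 t ω)) ∧
      MildOn k S W 𝓕 P u₀ Set.univ (fun r ω => trunc j θ R F (fun s => u.1 s ω) r)
        (fun r ω => trunc j θ R G (fun s => u.1 s ω) r) z.1 := fun u => by
    obtain ⟨_, _, hex⟩ := exists_mild hj hk hW h𝓕 hS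
    obtain ⟨z, hz, hzc, hzm, -⟩ := hex u₀ _ _ hu₀ (u.2.isBoundedData_trunc hj hF hθ hR)
      (u.2.isBoundedData_trunc hj hG hθ hR)
    exact ⟨⟨z, hz⟩, hzc, hzm⟩
  choose Ψ hΨc hΨm using hstep
  have hΨfin : ∀ u (N : ℝ≥0), ∫⁻ ω, xSq j (fun s => (Ψ u).1 s ω) N ∂P < ⊤ := fun u N =>
    lintegral_xSq_lt_top hj hk hW h𝓕 hS hu₀ hu₀' (u.2.isBoundedData_trunc hj hF hθ hR)
      (u.2.isBoundedData_trunc hj hG hθ hR) (Ψ u).2 (hΨm u) N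
  obtain ⟨C, hC⟩ := exists_contraction (R := R) hj hk hW h𝓕 hS hF hG hθ hR
  have hcontr : ∀ u v : {u : ℝ≥0 → Ω → V // IsRegular j 𝓕 u}, ∀ T, 0 < T →
      ∫⁻ ω, xSq j (fun s => (Ψ u).1 s ω - (Ψ v).1 s ω) T ∂P ≤
        (16⁻¹ : ℝ≥0) * ∫⁻ ω, xSq j (fun s => u.1 s ω - v.1 s ω) T ∂P +
          C * ∫⁻ r in Set.Iic T, ∫⁻ ω, xSq j (fun s => u.1 s ω - v.1 s ω) r ∂P ∂leb := by
    intro u v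
    refine hC Set.univ u.1 v.1 (fun s ω => (Ψ u).1 s ω - (Ψ v).1 s ω)
      (fun s ω => u.1 s ω - v.1 s ω) (fun _ _ _ _ _ => trivial) (fun t => by simp) u.2 v.2
      ((Ψ u).2.sub hj (Ψ v).2) (u.2.sub hj v.2) (.of_forall fun _ _ _ => rfl) ?_
    have h := (hΨm u).sub (hΨm v)
    simp only [sub_self] at h
    simpa only [Set.indicator_univ] using h
  set U : ℕ → {u : ℝ≥0 → Ω → V // IsRegular j 𝓕 u} := fun m =>
    Ψ^[m] ⟨fun _ _ => 0, IsRegular.zero hj⟩ with hUdef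
  have hU0 : (U 0).1 = fun _ _ => 0 := rfl
  have hUs : ∀ m, U (m + 1) = Ψ (U m) := fun m => Function.iterate_succ_apply' Ψ m _
  have hUc : ∀ m ω, Continuous (fun t => (U m).1 t ω) := fun m ω => by
    cases m with
    | zero => rw [hU0]; exact continuous_const
    | succ m => rw [hUs]; exact hΨc _ ω
  obtain ⟨g, hg⟩ := le_geometric_of_gronwall (κ := 16⁻¹) (C := C) (by positivity)
  set a : ℕ → ℝ≥0 → ℝ≥0∞ := fun m T => ∫⁻ ω, xSq j (fun s => (U (m + 1)).1 s ω - (U m).1 s ω) T ∂P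
    with ha
  have hamono : ∀ m, Monotone (a m) := fun m _ _ hst => lintegral_mono fun ω => xSq_mono _ hst
  have ha0 : ∀ N, a 0 N < ⊤ := fun N => by
    simp only [ha, hU0, sub_zero, hUs]
    exact hΨfin _ N
  have hsum : ∀ N : ℝ≥0, 0 < N → ∑' l, 4 ^ l * a l N ≠ ⊤ := fun N hN => by
    have h1 : ∀ l, 4 ^ l * a l N ≤ a 0 N * g N * (2⁻¹ : ℝ≥0∞) ^ l := fun l => by
      have h2 := hg a (a 0 N) N (fun T _ hT => hamono 0 hT) (fun m T hT _ => by
        simp only [ha, hUs (m + 1)]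
        have h3 := hcontr (U (m + 1)) (U m) T hT
        rw [← hUs m] at h3
        exact h3) l N hN le_rfl
      refine (mul_le_mul' le_rfl h2).trans_eq ?_
      -- The constant 1/16 was chosen for this: the iteration decays like 8^(-l), which beats the
      -- weight 4^l of the completeness lemma.
      have h4 : (4 : ℝ≥0∞) ^ l * (2 * ((16⁻¹ : ℝ≥0) : ℝ≥0∞)) ^ l = 2⁻¹ ^ l := by
        rw [← mul_pow]
        congr 1
        have h5 : (4 * (2 * 16⁻¹) : ℝ≥0) = 2⁻¹ := by
          rw [← NNReal.coe_inj]; push_cast; norm_num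
        have h6 := congrArg ((↑) : ℝ≥0 → ℝ≥0∞) h5
        push_cast at h6
        exact h6
      rw [← h4]
      ring
    refine ne_top_of_le_ne_top ?_ (ENNReal.tsum_le_tsum h1)
    rw [ENNReal.tsum_mul_left, ENNReal.tsum_geometric]
    refine ENNReal.mul_ne_top (ENNReal.mul_ne_top (ha0 N).ne ENNReal.coe_ne_top) ?_
    rw [ENNReal.one_sub_inv_two, inv_inv]
    exact ENNReal.ofNat_ne_top
  have hsum' : ∀ N : ℕ, ∑' l, 4 ^ l * a l N ≠ ⊤ := fun N =>
    ne_top_of_le_ne_top (hsum (N + 1) (by positivity)) (ENNReal.tsum_le_tsum fun l =>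
      mul_le_mul' le_rfl (hamono l (le_add_of_nonneg_right zero_le_one)))
  obtain ⟨u, hu, huc, hub⟩ := exists_regular_limit hj h𝓕 (fun m => (U m).2) hUc hsum'
  refine ⟨u, hu, huc, ?_⟩
  set z := Ψ ⟨u, hu⟩ with hz
  -- The iterates U (m + 1) = Ψ (U m) converge to `u`, and by the contraction estimate also to Ψ u =
  -- z.
  have hzero : ∀ N : ℕ, 0 < N → ∫⁻ ω, xSq j (fun s => z.1 s ω - u s ω) N ∂P = 0 := by
    intro N hN
    have hN' : (0 : ℝ≥0) < N := by exact_mod_cast hN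
    set B := ∑' l, 4 ^ l * a l N with hB
    set K : ℝ≥0∞ := (2 * ((16⁻¹ : ℝ≥0) + C * N) + 2) * (4 * B) with hK
    have hKtop : K ≠ ⊤ := by
      refine ENNReal.mul_ne_top ?_ (ENNReal.mul_ne_top (by norm_num) (hsum' N))
      finiteness
    have hle : ∀ m : ℕ, ∫⁻ ω, xSq j (fun s => z.1 s ω - u s ω) N ∂P ≤ (4⁻¹ : ℝ≥0∞) ^ m * K := by
      intro m
      have hd := ((z.2.sub hj (U (m + 1)).2))
      have h1 : ∀ ω, xSq j (fun s => z.1 s ω - u s ω) N ≤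
          2 * xSq j (fun s => z.1 s ω - (U (m + 1)).1 s ω) N +
            2 * xSq j (fun s => u s ω - (U (m + 1)).1 s ω) N := fun ω => by
        have := xSq_sub_le (w := fun s => z.1 s ω - (U (m + 1)).1 s ω)
          (z := fun s => u s ω - (U (m + 1)).1 s ω) (T := N) hj (hd.measurable_path ω)
        simpa only [sub_sub_sub_cancel_right] using this
      have h2 : ∫⁻ ω, xSq j (fun s => z.1 s ω - (U (m + 1)).1 s ω) N ∂P ≤
          ((16⁻¹ : ℝ≥0) + C * N) * (4 * 4⁻¹ ^ m * B) := by
        have h3 := hcontr ⟨u, hu⟩ (U m) N hN'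
        rw [← hUs m] at h3
        refine h3.trans ?_
        rw [add_mul]
        refine add_le_add (mul_le_mul' le_rfl (hub m N)) ?_
        rw [mul_assoc]
        refine mul_le_mul' le_rfl ?_
        calc ∫⁻ r in Set.Iic (N : ℝ≥0), ∫⁻ ω, xSq j (fun s => u s ω - (U m).1 s ω) r ∂P ∂leb
            ≤ ∫⁻ r in Set.Iic (N : ℝ≥0), 4 * 4⁻¹ ^ m * B ∂leb :=
              setLIntegral_mono' measurableSet_Iic fun r hr =>
                (lintegral_mono fun ω => xSq_mono _ hr).trans (hub m N)
          _ = N * (4 * 4⁻¹ ^ m * B) := by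
              rw [setLIntegral_const, leb_Iic, mul_comm]
              simp
      calc ∫⁻ ω, xSq j (fun s => z.1 s ω - u s ω) N ∂P
          ≤ ∫⁻ ω, (2 * xSq j (fun s => z.1 s ω - (U (m + 1)).1 s ω) N +
            2 * xSq j (fun s => u s ω - (U (m + 1)).1 s ω) N) ∂P := lintegral_mono h1
        _ = 2 * ∫⁻ ω, xSq j (fun s => z.1 s ω - (U (m + 1)).1 s ω) N ∂P +
            2 * ∫⁻ ω, xSq j (fun s => u s ω - (U (m + 1)).1 s ω) N ∂P := by
            rw [lintegral_add_left ((hd.measurable_xSq hj N).const_mul _),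
              lintegral_const_mul' _ _ (by norm_num), lintegral_const_mul' _ _ (by norm_num)]
        _ ≤ 2 * (((16⁻¹ : ℝ≥0) + C * N) * (4 * 4⁻¹ ^ m * B)) + 2 * (4 * 4⁻¹ ^ m * B) := by
            gcongr
            refine (hub (m + 1) N).trans ?_
            gcongr ?_ * _
            gcongr 4 * ?_
            exact pow_le_pow_right_of_le_one' (by norm_num) (Nat.le_succ m)
        _ = _ := by rw [hK]; ring
    have hlim : Tendsto (fun m : ℕ => (4⁻¹ : ℝ≥0∞) ^ m * K) atTop (𝓝 (0 * K)) :=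
      ENNReal.Tendsto.mul_const (ENNReal.tendsto_pow_atTop_nhds_zero_of_lt_one
        (ENNReal.inv_lt_one.2 (by norm_num))) (Or.inr hKtop)
    rw [zero_mul] at hlim
    exact le_antisymm (ge_of_tendsto' hlim hle) zero_le
  refine (hΨm ⟨u, hu⟩).congr_left ?_
  have hall : ∀ᵐ ω ∂P, ∀ N : ℕ, xSq j (fun s => z.1 s ω - u s ω) (N + 1 : ℕ) = 0 :=
    ae_all_iff.2 fun N => (lintegral_eq_zero_iff ((z.2.sub hj hu).measurable_xSq hj _)).1
      (hzero (N + 1) N.succ_pos)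
  filter_upwards [hall] with ω hω t _
  obtain ⟨N, hN⟩ := exists_nat_ge t
  exact sub_eq_zero.1 (eq_zero_of_xSq_eq_zero (hω N)
    (hN.trans (by push_cast; exact le_add_of_nonneg_right zero_le_one)))

end Existence

/-! ### Continuity of the path norm in time -/

section PathNorm

variable {E V Ω : Type*} [NormedAddCommGroup E] [NormedSpace ℝ E] [NormedAddCommGroup V]
  [NormedSpace ℝ V] {j : E →L[ℝ] V}

lemma tendsto_setLIntegral_Ioc {g : ℝ≥0 → ℝ≥0∞} {T : ℝ≥0} (hg : ∫⁻ s in Set.Iic T, g s ∂leb ≠ ⊤)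
    {l : Filter ℝ≥0} {a b : ℝ≥0 → ℝ≥0} {t : ℝ≥0} (ha : Tendsto a l (𝓝 t)) (hb : Tendsto b l (𝓝 t))
    (hT : ∀ᶠ s in l, b s ≤ T) :
    Tendsto (fun s => ∫⁻ r in Set.Ioc (a s) (b s), g r ∂leb) l (𝓝 0) := by
  have h1 : Tendsto (fun s => leb.restrict (Set.Iic T) (Set.Ioc (a s) (b s))) l (𝓝 0) := by
    refine tendsto_of_tendsto_of_tendsto_of_le_of_le tendsto_const_nhds
      (h := fun s => leb (Set.Ioc (a s) (b s))) ?_ (fun _ => zero_le)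
      fun s => Measure.restrict_apply_le _ _
    simp only [leb_Ioc]
    have h2 : Tendsto (fun s => ((b s : ℝ) - a s)) l (𝓝 (t - t)) :=
      (NNReal.tendsto_coe.2 hb).sub (NNReal.tendsto_coe.2 ha)
    have h3 := ENNReal.tendsto_ofReal h2
    rwa [sub_self, ENNReal.ofReal_zero] at h3
  refine (tendsto_setLIntegral_zero hg h1).congr' ?_
  filter_upwards [hT] with s hs
  have h2 : Set.Ioc (a s) (b s) ⊆ Set.Iic T := fun r hr => le_trans hr.2 hs
  rw [Measure.restrict_restrict measurableSet_Ioc, Set.inter_eq_left.2 h2]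

/-- Right-continuity of the path norm: shortly after t the supremum and the integral each grow by at
most ε, by continuity of the path and of the integral. -/
lemma exists_xSq_lt_of_lt {w : ℝ≥0 → V} (hc : Continuous w) (hfin : ∀ T, xSq j w T < ⊤) {t : ℝ≥0}
    {c : ℝ≥0∞} (h : xSq j w t < c) : ∃ s, t < s ∧ xSq j w s < c := by
  set a := ⨆ s ∈ Set.Iic t, ‖w s‖ₑ ^ 2 with ha
  set b := ∫⁻ s in Set.Iic t, eNormE j (w s) ^ 2 ∂leb with hb
  have hat : a ≠ ⊤ := ne_top_of_le_ne_top (hfin t).ne le_self_add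
  have hx : Tendsto (fun x : ℝ≥0∞ => (a + x) + (b + x)) (𝓝[>] 0) (𝓝 ((a + 0) + (b + 0))) := by
    refine Tendsto.mono_left ?_ nhdsWithin_le_nhds
    exact (tendsto_const_nhds.add tendsto_id).add (tendsto_const_nhds.add tendsto_id)
  rw [add_zero, add_zero] at hx
  obtain ⟨ε, hε, hε0⟩ := ((hx.eventually_lt_const h).and self_mem_nhdsWithin).exists
  have hlt : t < t + 1 := lt_add_of_pos_right _ one_pos
  have hI : ∀ᶠ s in 𝓝[>] t, ∫⁻ r in Set.Ioc t s, eNormE j (w r) ^ 2 ∂leb < ε := by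
    refine Tendsto.eventually_lt_const hε0 (tendsto_setLIntegral_Ioc (T := t + 1) (t := t)
      (ne_top_of_le_ne_top (hfin (t + 1)).ne le_add_self) tendsto_const_nhds
      (Tendsto.mono_left tendsto_id nhdsWithin_le_nhds) ?_)
    exact mem_nhdsWithin_of_mem_nhds (Iic_mem_nhds hlt)
  have hs : ∀ᶠ s in 𝓝[>] t, ∀ r ∈ Set.Icc t s, ‖w r‖ₑ ^ 2 < a + ε := by
    have h1 : ∀ᶠ r in 𝓝[≥] t, ‖w r‖ₑ ^ 2 < a + ε := by
      refine Tendsto.eventually_lt_const (v := ‖w t‖ₑ ^ 2) ?_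
        (Tendsto.mono_left ?_ nhdsWithin_le_nhds)
      · exact lt_of_le_of_lt (le_iSup₂ (f := fun s (_ : s ∈ Set.Iic t) => ‖w s‖ₑ ^ 2) t Set.self_mem_Iic)
          (ENNReal.lt_add_right hat hε0.ne')
      · exact (ENNReal.continuous_pow 2).continuousAt.tendsto.comp hc.enorm.continuousAt
    obtain ⟨u, hu, hu'⟩ := (mem_nhdsGE_iff_exists_Ico_subset' hlt).1 h1
    filter_upwards [Ioo_mem_nhdsGT hu] with s hs r hr
    exact hu' ⟨hr.1, hr.2.trans_lt hs.2⟩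
  obtain ⟨s, ⟨h1, h2⟩, h3⟩ := ((hI.and hs).and self_mem_nhdsWithin).exists
  refine ⟨s, h3, lt_of_le_of_lt (add_le_add ?_ ?_) hε⟩
  · refine iSup₂_le fun r hr => ?_
    rcases le_total r t with hrt | hrt
    · exact (le_iSup₂ (f := fun s (_ : s ∈ Set.Iic t) => ‖w s‖ₑ ^ 2) r hrt).trans le_self_add
    · exact (h2 r ⟨hrt, hr⟩).le
  · rw [← Set.Iic_union_Ioc_eq_Iic (le_of_lt h3)]
    exact (lintegral_union_le _ _ _).trans (add_le_add le_rfl h1.le)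

/-- Left-continuity of the path norm. The time t = 0 must be excluded, the hypothesis being empty
there. -/
lemma xSq_le_of_forall_lt {w : ℝ≥0 → V} (hc : Continuous w) {t : ℝ≥0} (hfin : xSq j w t < ⊤)
    (ht : t ≠ 0) {c : ℝ≥0∞} (h : ∀ s < t, xSq j w s ≤ c) : xSq j w t ≤ c := by
  have ht' : 0 < t := pos_iff_ne_zero.2 ht
  have hne : (𝓝[<] t).NeBot := nhdsLT_neBot_of_exists_lt ⟨0, ht'⟩
  have h1 : ∀ r ≤ t, ∀ s < t, ‖w r‖ₑ ^ 2 + ∫⁻ x in Set.Iic s, eNormE j (w x) ^ 2 ∂leb ≤ c := by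
    intro r hr s hs
    rcases hr.lt_or_eq with hr | rfl
    · refine le_trans ?_ (h (max r s) (max_lt hr hs))
      exact add_le_add (le_iSup₂ (f := fun x (_ : x ∈ Set.Iic (max r s)) => ‖w x‖ₑ ^ 2) r
        (Set.mem_Iic.2 (le_max_left _ _)))
        (lintegral_mono_set (Set.Iic_subset_Iic.2 (le_max_right _ _)))
    · refine le_of_tendsto (x := 𝓝[<] r)
        (f := fun y => ‖w y‖ₑ ^ 2 + ∫⁻ x in Set.Iic s, eNormE j (w x) ^ 2 ∂leb) ?_ ?_
      · refine Tendsto.add (Tendsto.mono_left ?_ nhdsWithin_le_nhds) tendsto_const_nhds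
        exact (ENNReal.continuous_pow 2).continuousAt.tendsto.comp hc.enorm.continuousAt
      · filter_upwards [self_mem_nhdsWithin] with y hy
        refine le_trans ?_ (h (max y s) (max_lt hy hs))
        exact add_le_add
          (le_iSup₂ (f := fun x (_ : x ∈ Set.Iic (max y s)) => ‖w x‖ₑ ^ 2) y
            (Set.mem_Iic.2 (le_max_left _ _)))
          (lintegral_mono_set (Set.Iic_subset_Iic.2 (le_max_right _ _)))
  have h2 : ∀ s < t, xSq j w t ≤ c + ∫⁻ x in Set.Ioc s t, eNormE j (w x) ^ 2 ∂leb := by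
    intro s hs
    have h3 : (⨆ r ∈ Set.Iic t, ‖w r‖ₑ ^ 2) + ∫⁻ x in Set.Iic s, eNormE j (w x) ^ 2 ∂leb ≤ c := by
      rw [ENNReal.biSup_add (s := Set.Iic t) ⟨0, Set.mem_Iic.2 zero_le⟩]
      exact iSup₂_le fun r hr => h1 r hr s hs
    have h4 : ∫⁻ x in Set.Iic t, eNormE j (w x) ^ 2 ∂leb ≤
        ∫⁻ x in Set.Iic s, eNormE j (w x) ^ 2 ∂leb +
          ∫⁻ x in Set.Ioc s t, eNormE j (w x) ^ 2 ∂leb := by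
      rw [← Set.Iic_union_Ioc_eq_Iic hs.le]
      exact lintegral_union_le _ _ _
    calc xSq j w t ≤ _ := add_le_add le_rfl h4
      _ = _ := (add_assoc _ _ _).symm
      _ ≤ _ := add_le_add h3 le_rfl
  have h5 : Tendsto (fun s => c + ∫⁻ x in Set.Ioc s t, eNormE j (w x) ^ 2 ∂leb) (𝓝[<] t)
      (𝓝 (c + 0)) := by
    refine tendsto_const_nhds.add (tendsto_setLIntegral_Ioc (T := t) (t := t)
      (ne_top_of_le_ne_top hfin.ne le_add_self)
      (Tendsto.mono_left tendsto_id nhdsWithin_le_nhds) tendsto_const_nhds ?_)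
    exact .of_forall fun _ => le_rfl
  rw [add_zero] at h5
  refine ge_of_tendsto h5 ?_
  filter_upwards [self_mem_nhdsWithin] with s hs using h2 s hs

/-- By right-continuity a norm below `R` at t stays below `R` a little longer. Exit times are thus
governed by the norm at one fixed time. -/
lemma coe_lt_exitTime_iff {R : ℝ≥0∞} {u : ℝ≥0 → Ω → V} {ω : Ω} (hc : Continuous (fun s => u s ω))
    (hfin : ∀ T, xSq j (fun s => u s ω) T < ⊤) (t : ℝ≥0) :
    (t : WithTop ℝ≥0) < exitTime j R u ω ↔ xNorm j (fun s => u s ω) t < R := by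
  constructor
  · intro h
    exact not_le.1 (notMem_of_lt_hittingAfter h zero_le)
  · intro h
    have h2 : xSq j (fun s => u s ω) t < R ^ 2 := by
      rw [← xNorm_sq]
      exact ENNReal.pow_lt_pow_left two_ne_zero h
    obtain ⟨s, hs, hs'⟩ := exists_xSq_lt_of_lt hc hfin h2
    have h3 : ∀ r, R ≤ xNorm j (fun s => u s ω) r → s ≤ r := fun r hr => by
      by_contra hlt
      have h4 := (xSq_mono (j := j) (fun s => u s ω) (not_le.1 hlt).le).trans_lt hs'
      rw [← xNorm_sq] at h4
      exact absurd (pow_le_pow_left' hr 2) (not_le.2 h4)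
    refine lt_of_lt_of_le (WithTop.coe_lt_coe.2 hs) ?_
    rw [exitTime, hittingAfter]
    split_ifs with hex
    · obtain ⟨r, -, hr⟩ := hex
      exact WithTop.coe_le_coe.2 (le_csInf ⟨r, zero_le, hr⟩ fun x hx => h3 x hx.2)
    · exact le_top

lemma exitTime_congr {R : ℝ≥0∞} {u v : ℝ≥0 → Ω → V} {ω : Ω} (h : ∀ t, u t ω = v t ω) :
    exitTime j R u ω = exitTime j R v ω := by
  have h' : ∀ t, xNorm j (fun s => u s ω) t = xNorm j (fun s => v s ω) t := fun t =>
    xNorm_congr fun s _ => h s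
  classical
  unfold exitTime hittingAfter
  exact if_congr (by simp only [h']) (by simp only [h']) rfl

end PathNorm

/-! ### Compatible sequences of paths -/

section Paths

variable {E V : Type*} [NormedAddCommGroup E] [NormedSpace ℝ E] [NormedAddCommGroup V]
  [NormedSpace ℝ V] {j : E →L[ℝ] V}

/-- Paths `U n`, and exit times `τ n` of `U n` from balls of radius `n + 1`, such that `U m` extends
`U n` for `n ≤ m`. -/
structure IsCompatible (j : E →L[ℝ] V) (U : ℕ → ℝ≥0 → V) (τ : ℕ → WithTop ℝ≥0) : Prop where
  cont : ∀ n, Continuous (U n)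
  finite : ∀ n T, xSq j (U n) T < ⊤
  -- Not implied by `eqOn`: the norm at time 0 may already exceed n + 1, and then τ n = 0.
  initial : ∀ n m, U n 0 = U m 0
  eqOn : ∀ n m, n ≤ m → ∀ t, xNorm j (U n) t ≤ n + 1 → U n t = U m t
  lt_iff : ∀ n (t : ℝ≥0), (t : WithTop ℝ≥0) < τ n ↔ xNorm j (U n) t < n + 1

namespace IsCompatible

variable {U : ℕ → ℝ≥0 → V} {τ : ℕ → WithTop ℝ≥0} (h : IsCompatible j U τ)
include h

lemma eq_of_lt {n m : ℕ} (hnm : n ≤ m) {t : ℝ≥0} (ht : (t : WithTop ℝ≥0) < τ n) : U n t = U m t :=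
  h.eqOn n m hnm t ((h.lt_iff n t).1 ht).le

lemma eq_of_lt_of_lt {n m : ℕ} {t : ℝ≥0} (hn : (t : WithTop ℝ≥0) < τ n)
    (hm : (t : WithTop ℝ≥0) < τ m) : U n t = U m t := by
  rcases le_total n m with hnm | hnm
  · exact h.eq_of_lt hnm hn
  · exact (h.eq_of_lt hnm hm).symm

lemma xNorm_eq {n m : ℕ} (hnm : n ≤ m) {t : ℝ≥0} (ht : xNorm j (U n) t ≤ n + 1) :
    xNorm j (U n) t = xNorm j (U m) t :=
  xNorm_congr fun s hs => h.eqOn n m hnm s ((xNorm_mono _ hs).trans ht)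

lemma monotone : Monotone τ := by
  intro n m hnm
  refine le_of_forall_lt fun c hc => ?_
  lift c to ℝ≥0 using (lt_top_of_lt hc).ne
  have h1 := (h.lt_iff n c).1 hc
  rw [h.lt_iff, ← h.xNorm_eq hnm h1.le]
  refine h1.trans_le (add_le_add ?_ le_rfl)
  exact_mod_cast hnm

lemma le_xNorm {n : ℕ} {t : ℝ≥0} (ht : τ n = t) : n + 1 ≤ xNorm j (U n) t :=
  not_lt.1 fun hlt => (lt_irrefl _ (ht ▸ (h.lt_iff n t).2 hlt))

lemma xNorm_le {n : ℕ} {t : ℝ≥0} (ht : τ n = t) (ht0 : t ≠ 0) : xNorm j (U n) t ≤ n + 1 := by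
  refine le_of_sq_le_sq ?_
  rw [xNorm_sq]
  refine xSq_le_of_forall_lt (h.cont n) (h.finite n t) ht0 fun s hs => ?_
  rw [← xNorm_sq]
  exact pow_le_pow_left' ((h.lt_iff n s).1 (by rw [ht]; exact WithTop.coe_lt_coe.2 hs)).le 2

lemma xNorm_zero_lt_top (n : ℕ) : xNorm j (U n) 0 < ⊤ := xNorm_lt_top_iff.2 (h.finite n 0)

lemma exists_pos : ∃ n, ∀ m, n ≤ m → 0 < τ m := by
  obtain ⟨n, hn⟩ := ENNReal.exists_nat_gt (h.xNorm_zero_lt_top 0).ne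
  refine ⟨n, fun m hm => (h.lt_iff m 0).2 ?_⟩
  rw [xNorm_congr (w' := U 0) fun s hs => by
    rw [show s = 0 from le_antisymm hs zero_le]; exact h.initial m 0]
  refine hn.trans_le ?_
  calc (n : ℝ≥0∞) ≤ m := by exact_mod_cast hm
    _ ≤ _ := le_self_add

lemma iSup_pos : 0 < ⨆ n, τ n := by
  obtain ⟨n, hn⟩ := h.exists_pos
  exact (hn n le_rfl).trans_le (le_iSup τ n)

/-- A finite exit time lies strictly before the limit. -/
lemma lt_iSup_of_eq {n : ℕ} {t : ℝ≥0} (ht : τ n = t) : (t : WithTop ℝ≥0) < ⨆ n, τ n := by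
  rcases eq_or_ne t 0 with rfl | ht0
  · exact h.iSup_pos
  -- At a positive exit time the norm is at most n + 1, by left-continuity, hence below the next
  -- level n + 2.
  · refine lt_of_lt_of_le ((h.lt_iff (n + 1) t).2 ?_) (le_iSup τ (n + 1))
    have h1 := h.xNorm_le ht ht0
    rw [← h.xNorm_eq n.le_succ h1]
    refine h1.trans_lt ?_
    push_cast
    exact ENNReal.lt_add_right (by finiteness) one_ne_zero

variable {u : ℝ≥0 → V} (hu : ∀ n (t : ℝ≥0), (t : WithTop ℝ≥0) < τ n → u t = U n t)
include hu

omit hu in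
lemma xNorm_le_or {n : ℕ} {t : ℝ≥0} (ht : (t : WithTop ℝ≥0) ≤ τ n) :
    xNorm j (U n) t ≤ n + 1 ∨ t = 0 := by
  rcases ht.lt_or_eq with ht | ht
  · exact Or.inl ((h.lt_iff n t).1 ht).le
  · rcases eq_or_ne t 0 with h0 | h0
    · exact Or.inr h0
    · exact Or.inl (h.xNorm_le ht.symm h0)

/-- The limit path coincides with `U n` up to and including the time `τ n`. -/
lemma eq_of_le {n : ℕ} {t : ℝ≥0} (ht : (t : WithTop ℝ≥0) ≤ τ n) : u t = U n t := by
  have hlt : ∃ m, n ≤ m ∧ (t : WithTop ℝ≥0) < τ m := by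
    rcases ht.lt_or_eq with ht' | ht'
    · exact ⟨n, le_rfl, ht'⟩
    · obtain ⟨m, hm⟩ := lt_iSup_iff.1 (h.lt_iSup_of_eq ht'.symm)
      exact ⟨max n m, le_max_left _ _, hm.trans_le (h.monotone (le_max_right _ _))⟩
  obtain ⟨m, hnm, hm⟩ := hlt
  rw [hu m t hm]
  rcases h.xNorm_le_or ht with h1 | rfl
  · exact (h.eqOn n m hnm t h1).symm
  · exact h.initial m n

lemma continuousAt {t : ℝ≥0} (ht : (t : WithTop ℝ≥0) < ⨆ n, τ n) : ContinuousAt u t := by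
  obtain ⟨n, hn⟩ := lt_iSup_iff.1 ht
  obtain ⟨s, hts, hs⟩ : ∃ s : ℝ≥0, t < s ∧ (s : WithTop ℝ≥0) < τ n := by
    have h1 := (h.lt_iff n t).1 hn
    have h2 : xSq j (U n) t < (n + 1) ^ 2 := by
      rw [← xNorm_sq]
      exact ENNReal.pow_lt_pow_left two_ne_zero h1
    obtain ⟨s, hs, hs'⟩ := exists_xSq_lt_of_lt (h.cont n) (h.finite n) h2
    refine ⟨s, hs, (h.lt_iff n s).2 ?_⟩
    rw [← xNorm_sq] at hs'
    exact lt_of_pow_lt_pow_left' 2 hs'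
  refine ((h.cont n).continuousAt (x := t)).congr ?_
  filter_upwards [Iio_mem_nhds hts] with r hr
  exact (hu n r ((WithTop.coe_lt_coe.2 hr).trans hs)).symm

/-- If the limit path explodes, in the sense of its supremum, then its limit superior is
infinite. -/
lemma limsup_eq_top {T : ℝ≥0} (hT : ⨆ n, τ n = T)
    (hsup : ⨆ (t : ℝ≥0) (_ : (t : WithTop ℝ≥0) < ⨆ n, τ n), ‖u t‖ₑ = ⊤) :
    limsup (fun t => ‖u t‖ₑ) (𝓝[<] T) = ⊤ := by
  by_contra hne
  obtain ⟨c, hc, hc'⟩ := exists_between (lt_top_iff_ne_top.2 hne)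
  have hev := eventually_lt_of_limsup_lt hc
  have hT0 : 0 < T := by
    have := h.iSup_pos
    rw [hT] at this
    exact_mod_cast this
  obtain ⟨s, hs, hs'⟩ := (mem_nhdsLT_iff_exists_Ioo_subset' hT0).1 hev
  -- A finite limsup bounds the path near T, and compactness bounds it on [0, s]; together they
  -- contradict `hsup`.
  have hcont : ContinuousOn (fun t => ‖u t‖ₑ) (Set.Icc 0 s) := fun t ht =>
    ((h.continuousAt hu (by
      rw [hT]; exact WithTop.coe_lt_coe.2 (ht.2.trans_lt hs))).enorm).continuousWithinAt
  obtain ⟨x, -, hx⟩ := isCompact_Icc.exists_isMaxOn ⟨0, Set.left_mem_Icc.2 zero_le⟩ hcont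
  have hle : ⨆ (t : ℝ≥0) (_ : (t : WithTop ℝ≥0) < ⨆ n, τ n), ‖u t‖ₑ ≤ max ‖u x‖ₑ c := by
    refine iSup₂_le fun t ht => ?_
    rw [hT] at ht
    rcases le_or_gt t s with hts | hts
    · exact (hx ⟨zero_le, hts⟩).trans (le_max_left _ _)
    · exact (hs' ⟨hts, WithTop.coe_lt_coe.1 ht⟩).le.trans (le_max_right _ _)
  rw [hsup, top_le_iff] at hle
  exact (max_lt enorm_lt_top hc').ne hle

end IsCompatible

end Paths

/-! ### Global solutions of the truncated equation -/

section Truncated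

variable {E V H Ω : Type*}
  [NormedAddCommGroup E] [NormedSpace ℝ E]
  [NormedAddCommGroup V] [NormedSpace ℝ V]
  [NormedAddCommGroup H] [NormedSpace ℝ H]
  {mΩ : MeasurableSpace Ω} {j : E →L[ℝ] V} {k : V →L[ℝ] H} {S : ℝ≥0 → H →L[ℝ] H}
  {W : ℝ≥0 → Ω → ℝ} {𝓕 : Filtration ℝ≥0 mΩ} {P : Measure Ω}
  {F : E → H} {G : E → V} {θ : ℝ → ℝ} {R R' : ℝ} {u₀ : Ω → V} {u v : ℝ≥0 → Ω → V}

/-- A solution of the truncated equation all of whose paths are continuous and of finite norm. -/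
structure IsRegularSolution (θ : ℝ → ℝ) (R : ℝ) (j : E →L[ℝ] V) (k : V →L[ℝ] H)
    (S : ℝ≥0 → H →L[ℝ] H) (F : E → H) (G : E → V) (W : ℝ≥0 → Ω → ℝ)
    (𝓕 : Filtration ℝ≥0 mΩ) (P : Measure Ω) (u₀ : Ω → V) (u : ℝ≥0 → Ω → V) : Prop where
  regular : IsRegular j 𝓕 u
  cont : ∀ ω, Continuous (fun t => u t ω)
  mild : MildOn k S W 𝓕 P u₀ Set.univ (fun r ω => trunc j θ R F (fun s => u s ω) r)
    (fun r ω => trunc j θ R G (fun s => u s ω) r) u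

/-- Every solution of the truncated equation is indistinguishable from a regular one. -/
lemma IsTruncatedSolution.exists_regular [SecondCountableTopology V] [SFinite P]
    (hj : Function.Injective j) (h𝓕 : UsualConditions 𝓕 P)
    (hu : IsTruncatedSolution θ R j k S F G W 𝓕 P u₀ u) :
    ∃ v, IsRegularSolution θ R j k S F G W 𝓕 P u₀ v ∧ ∀ᵐ ω ∂P, ∀ t, u t ω = v t ω := by
  obtain ⟨hM, J, ⟨hJc, hJ⟩, hmild⟩ := hu
  set Ω₀ : Set Ω := {ω | ∀ N : ℕ, MemX j (fun s => u s ω) N} with hΩ₀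
  have hae : ∀ᵐ ω ∂P, ω ∈ Ω₀ := ae_all_iff.2 fun N => (hM N).2.1
  have hm : ∀ t, MeasurableSet[𝓕 t] Ω₀ := fun t => by
    have := (h𝓕.measurableSet_of_null (mem_ae_iff.1 hae) t).compl
    rwa [compl_compl] at this
  set v : ℝ≥0 → Ω → V := fun t => Ω₀.indicator (u t) with hv
  have hvu : ∀ ω ∈ Ω₀, ∀ t, v t ω = u t ω := fun ω hω t => Set.indicator_of_mem hω _
  have hv0 : ∀ ω ∉ Ω₀, ∀ t, v t ω = 0 := fun ω hω t => Set.indicator_of_notMem hω _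
  have hvc : ∀ ω, Continuous (fun t => v t ω) := fun ω => by
    by_cases hω : ω ∈ Ω₀
    · simp only [hvu ω hω]
      refine continuous_iff_continuousAt.2 fun t => ?_
      obtain ⟨N, hN⟩ := exists_nat_gt t
      exact (hω N).1.continuousAt (Iic_mem_nhds hN)
    · simp only [hv0 ω hω]
      exact continuous_const
  have huv : ∀ᵐ ω ∂P, ∀ t, u t ω = v t ω := by
    filter_upwards [hae] with ω hω t using (hvu ω hω t).symm
  refine ⟨v, ⟨⟨fun t => ?_, fun ω t => (hvc ω).continuousWithinAt, fun ω T => ?_⟩, hvc, J,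
    ⟨hJc, fun t => ?_⟩, fun t => ?_⟩, huv⟩
  · exact ((hM 0).1.stronglyAdapted t).indicator (hm t)
  · by_cases hω : ω ∈ Ω₀
    · simp only [hvu ω hω]
      obtain ⟨N, hN⟩ := exists_nat_ge T
      exact (xSq_mono _ hN).trans_lt (xNorm_lt_top_iff.1 (hω N).2)
    · simp only [hv0 ω hω]
      rw [xSq_zero hj]
      exact ENNReal.zero_lt_top
  · refine IsItoIntegral.congr (hJ t) ?_ (.of_forall fun _ => rfl)
    filter_upwards [huv] with ω hω s
    simp only [hω, trunc]
  · filter_upwards [hmild t, huv] with ω h1 h2 _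
    simp only [h2] at h1
    exact h1

variable [CompleteSpace E] [SecondCountableTopology E] [CompleteSpace V] [SecondCountableTopology V]
  [SecondCountableTopology H] [IsProbabilityMeasure P]

lemma IsRegularSolution.isTruncatedSolution (hj : Function.Injective j) (hk : Function.Injective k)
    (hW : IsWienerProcess W 𝓕 P) (h𝓕 : UsualConditions 𝓕 P)
    (hS : SemigroupAssumption j k S W 𝓕 P) (hF : PolyLocallyLipschitz j F)
    (hG : PolyLocallyLipschitz j G) (hθ : IsCutoff θ) (hR : 0 < R)
    (hu₀ : StronglyMeasurable[𝓕 0] u₀) (hu₀' : ∫⁻ ω, ‖u₀ ω‖ₑ ^ 2 ∂P < ⊤)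
    (hu : IsRegularSolution θ R j k S F G W 𝓕 P u₀ u) :
    IsTruncatedSolution θ R j k S F G W 𝓕 P u₀ u := by
  refine ⟨fun T => ⟨hu.regular.adapted.isStronglyProgressive_of_continuous hu.cont,
    .of_forall fun ω => ⟨(hu.cont ω).continuousOn, xNorm_lt_top_iff.2 (hu.regular.finite ω T)⟩,
    ENNReal.rpow_lt_top_of_nonneg (by norm_num) ?_⟩, ?_⟩
  · simp only [xNorm_sq]
    exact (lintegral_xSq_lt_top hj hk hW h𝓕 hS hu₀ hu₀' (hu.regular.isBoundedData_trunc hj hF hθ hR)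
      (hu.regular.isBoundedData_trunc hj hG hθ hR) hu.regular hu.mild T).ne
  · obtain ⟨J, hJ, h⟩ := hu.mild
    refine ⟨J, hJ, fun t => ?_⟩
    filter_upwards [h t] with ω hω using hω trivial

/-- Sets of the form `{N ≤ c}`, with `N` the norm of a regular path up to the present. -/
lemma IsRegular.measurableSet_xNorm_le (hj : Function.Injective j) (hu : IsRegular j 𝓕 u)
    (c : ℝ≥0∞) (t : ℝ≥0) : MeasurableSet[Subtype.instMeasurableSpace.prod (𝓕 t)]
      {p : Set.Iic t × Ω | ((p.1 : ℝ≥0), p.2) ∈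
        {q : ℝ≥0 × Ω | xNorm j (fun s => u s q.2) q.1 ≤ c}} := by
  borelize V
  have h1 : Measurable[Subtype.instMeasurableSpace.prod (𝓕 t)] (fun p : Set.Iic t × Ω =>
      xSq j (fun s => u s p.2) p.1) :=
    @Measurable.comp _ _ _ (Subtype.instMeasurableSpace.prod (𝓕 t)) _ _ _ _ measurable_snd
      (hu.measurable_pair hj t)
  have h2 := @Measurable.comp _ _ _ (Subtype.instMeasurableSpace.prod (𝓕 t)) _ _ _ _
    (measurable_id.pow_const (1 / 2 : ℝ)) h1
  exact h2 measurableSet_Iic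

lemma IsRegular.measurableSet_le_xNorm (hj : Function.Injective j) (hu : IsRegular j 𝓕 u)
    (c : ℝ≥0∞) (t : ℝ≥0) : MeasurableSet[𝓕 t] {ω | c ≤ xNorm j (fun s => u s ω) t} := by
  borelize V
  have h1 : Measurable[Subtype.instMeasurableSpace.prod (𝓕 t)] (fun p : Set.Iic t × Ω =>
      xSq j (fun s => u s p.2) p.1) :=
    @Measurable.comp _ _ _ (Subtype.instMeasurableSpace.prod (𝓕 t)) _ _ _ _ measurable_snd
      (hu.measurable_pair hj t)
  have h2 := @Measurable.comp _ _ _ (Subtype.instMeasurableSpace.prod (𝓕 t)) _ _ _ _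
    (measurable_id.pow_const (1 / 2 : ℝ)) h1
  have h3 : @Measurable Ω (Set.Iic t × Ω) (𝓕 t) (Subtype.instMeasurableSpace.prod (𝓕 t))
      (fun ω : Ω => ((⟨t, Set.mem_Iic.2 le_rfl⟩ : Set.Iic t), ω)) :=
    @measurable_prodMk_left _ _ (Subtype.instMeasurableSpace) (𝓕 t) _
  exact (@Measurable.comp _ _ _ (𝓕 t) (Subtype.instMeasurableSpace.prod (𝓕 t)) _ _ _ h2 h3)
    measurableSet_Ici

/-- Solutions of the equations truncated at the levels `R ≤ R'` coincide as long as the first has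
norm at most `R`. -/
lemma IsRegularSolution.ae_eq_of_xNorm_le (hj : Function.Injective j) (hk : Function.Injective k)
    (hW : IsWienerProcess W 𝓕 P) (h𝓕 : UsualConditions 𝓕 P)
    (hS : SemigroupAssumption j k S W 𝓕 P) (hF : PolyLocallyLipschitz j F)
    (hG : PolyLocallyLipschitz j G) (hθ : IsCutoff θ) (hR : 0 < R) (hRR' : R ≤ R')
    (hu : IsRegularSolution θ R j k S F G W 𝓕 P u₀ u)
    (hv : IsRegularSolution θ R' j k S F G W 𝓕 P u₀ v) :
    ∀ᵐ ω ∂P, ∀ t, xNorm j (fun s => u s ω) t ≤ ENNReal.ofReal R → u t ω = v t ω := by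
  -- While the norm of `u` is at most R, the cutoffs at both levels equal 1 along `u`, so `u` solves
  -- the equation of level R' there.
  have h := ae_eq_on_of_mildOn (R := R') (θ := θ)
    (B := {q : ℝ≥0 × Ω | xNorm j (fun s => u s q.2) q.1 ≤ ENNReal.ofReal R}) hj hk hW h𝓕 hS hF hG hθ
    (hR.trans_le hRR') (fun s t ω hst ht => (xNorm_mono _ hst).trans ht)
    (hu.regular.measurableSet_xNorm_le hj _) hu.regular hv.regular
    (hu.mild.mono (Set.subset_univ _)) (hv.mild.mono (Set.subset_univ _))
    (.of_forall fun ω t ht => ?_) (.of_forall fun ω t _ => ⟨rfl, rfl⟩)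
  · exact h
  · have ht' : xNorm j (fun s => u s ω) t ≤ ENNReal.ofReal R := ht
    have ht'' := ht'.trans (ENNReal.ofReal_le_ofReal hRR')
    constructor
    · rw [trunc_eq_onV hθ hR ht', trunc_eq_onV hθ (hR.trans_le hRR') ht'']
    · rw [trunc_eq_onV hθ hR ht', trunc_eq_onV hθ (hR.trans_le hRR') ht'']

lemma IsRegularSolution.ae_eq (hj : Function.Injective j) (hk : Function.Injective k)
    (hW : IsWienerProcess W 𝓕 P) (h𝓕 : UsualConditions 𝓕 P)
    (hS : SemigroupAssumption j k S W 𝓕 P) (hF : PolyLocallyLipschitz j F)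
    (hG : PolyLocallyLipschitz j G) (hθ : IsCutoff θ) (hR : 0 < R)
    (hu : IsRegularSolution θ R j k S F G W 𝓕 P u₀ u)
    (hv : IsRegularSolution θ R j k S F G W 𝓕 P u₀ v) :
    ∀ᵐ ω ∂P, ∀ t, u t ω = v t ω := by
  have h := ae_eq_on_of_mildOn (R := R) (θ := θ) (B := Set.univ) hj hk hW h𝓕 hS hF hG hθ hR
    (fun _ _ _ _ _ => trivial) (fun t => by simp) hu.regular hv.regular hu.mild hv.mild
    (.of_forall fun ω t _ => ⟨rfl, rfl⟩) (.of_forall fun ω t _ => ⟨rfl, rfl⟩)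
  filter_upwards [h] with ω hω t using hω t trivial

lemma IsRegularSolution.ae_zero_eq (hk : Function.Injective k)
    (hS : SemigroupAssumption j k S W 𝓕 P) (hW : IsWienerProcess W 𝓕 P)
    (hu : IsRegularSolution θ R j k S F G W 𝓕 P u₀ u) : ∀ᵐ ω ∂P, u 0 ω = u₀ ω := by
  obtain ⟨J, ⟨-, hJ⟩, h⟩ := hu.mild
  have hJ0 : ∀ᵐ ω ∂P, ω ∈ Set.univ → k (J 0 ω) = 0 := by
    refine (hJ 0).ae_eq_zero_of_forall_mem hW (A := Set.univ) (.of_forall fun ω _ s => ?_)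
    exact Set.indicator_of_notMem (by simp) _
  filter_upwards [h 0, hJ0] with ω h1 h2
  obtain ⟨a, ⟨-, ha⟩, ha'⟩ := h1 trivial
  refine hk ?_
  have h0 : leb (Set.Iic 0) = 0 := by rw [leb_Iic]; rfl
  rw [Measure.restrict_eq_zero.2 h0, integral_zero_measure] at ha
  rw [ha', ha, h2 trivial, hS.map_zero]
  simp

/-- A sequence of solutions of the truncated equations is compatible, almost surely. -/
lemma ae_isCompatible (hj : Function.Injective j) (hk : Function.Injective k)
    (hW : IsWienerProcess W 𝓕 P) (h𝓕 : UsualConditions 𝓕 P)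
    (hS : SemigroupAssumption j k S W 𝓕 P) (hF : PolyLocallyLipschitz j F)
    (hG : PolyLocallyLipschitz j G) (hθ : IsCutoff θ) {U : ℕ → ℝ≥0 → Ω → V}
    (hU : ∀ n : ℕ, IsRegularSolution θ (n + 1) j k S F G W 𝓕 P u₀ (U n)) :
    ∀ᵐ ω ∂P, IsCompatible j (fun n s => U n s ω) (fun n => exitTime j (n + 1) (U n) ω) := by
  have h1 : ∀ᵐ ω ∂P, ∀ n m : ℕ, n ≤ m → ∀ t, xNorm j (fun s => U n s ω) t ≤ n + 1 →
      U n t ω = U m t ω := ae_all_iff.2 fun n => ae_all_iff.2 fun m => by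
    by_cases hnm : n ≤ m
    · have h2 := (hU n).ae_eq_of_xNorm_le hj hk hW h𝓕 hS hF hG hθ (by positivity)
        (by have : (n : ℝ) ≤ m := by exact_mod_cast hnm
            linarith) (hU m)
      have h3 : ENNReal.ofReal (n + 1) = n + 1 := by
        rw [ENNReal.ofReal_add (by positivity) zero_le_one, ENNReal.ofReal_natCast,
          ENNReal.ofReal_one]
      rw [h3] at h2
      filter_upwards [h2] with ω hω _ using hω
    · exact .of_forall fun ω h => absurd h hnm
  have h0 : ∀ᵐ ω ∂P, ∀ n, U n 0 ω = u₀ ω := ae_all_iff.2 fun n => (hU n).ae_zero_eq hk hS hW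
  filter_upwards [h1, h0] with ω h2 h3
  exact ⟨fun n => (hU n).cont ω, fun n => (hU n).regular.finite ω, fun n m => by
    rw [h3 n, h3 m], h2, fun n t => coe_lt_exitTime_iff ((hU n).cont ω) ((hU n).regular.finite ω) t⟩

end Truncated

/-! ### Stopping times -/

section StoppingTimes

variable {E V Ω : Type*} [NormedAddCommGroup E] [NormedSpace ℝ E] [NormedAddCommGroup V]
  [NormedSpace ℝ V] {j : E →L[ℝ] V} {mΩ : MeasurableSpace Ω} {𝓕 : Filtration ℝ≥0 mΩ} {P : Measure Ω}

lemma UsualConditions.isStoppingTime_of_ae_eq (h𝓕 : UsualConditions 𝓕 P)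
    {τ τ' : Ω → WithTop ℝ≥0} (hτ : IsStoppingTime 𝓕 τ) (h : ∀ᵐ ω ∂P, τ ω = τ' ω) :
    IsStoppingTime 𝓕 τ' := by
  intro t
  have hnull : P {ω | ¬ τ ω = τ' ω} = 0 := h
  have e : {ω | τ' ω ≤ t} = ({ω | τ ω ≤ t} \ {ω | ¬ τ ω = τ' ω}) ∪
      ({ω | τ' ω ≤ t} ∩ {ω | ¬ τ ω = τ' ω}) := by
    ext ω
    by_cases hω : τ ω = τ' ω <;> simp [hω]
  rw [e]
  exact ((hτ t).diff (h𝓕.measurableSet_of_null hnull t)).union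
    (h𝓕.measurableSet_of_null (measure_mono_null Set.inter_subset_right hnull) t)

lemma isStoppingTime_iSup {τ : ℕ → Ω → WithTop ℝ≥0} (hτ : ∀ n, IsStoppingTime 𝓕 (τ n)) :
    IsStoppingTime 𝓕 (fun ω => ⨆ n, τ n ω) := by
  intro t
  simp only [iSup_le_iff, Set.ofPred_forall]
  exact MeasurableSet.iInter fun n => hτ n t

/-- For s < t the condition is s < min σ t, and min σ t is `𝓕 t`-measurable. This minimum does not
see whether σ exceeds t, so the slice s = t is treated separately. -/
lemma measurableSet_lt_of_isStoppingTime {σ : Ω → ℝ≥0}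
    (hσ : IsStoppingTime 𝓕 (fun ω => (σ ω : WithTop ℝ≥0))) (t : ℝ≥0) :
    MeasurableSet[Subtype.instMeasurableSpace.prod (𝓕 t)]
      {p : Set.Iic t × Ω | ((p.1 : ℝ≥0), p.2) ∈ {q : ℝ≥0 × Ω | q.1 < σ q.2}} := by
  have hle : ∀ s ≤ t, MeasurableSet[𝓕 t] {ω | σ ω ≤ s} := fun s hs => by
    have := 𝓕.mono hs _ (hσ s)
    simpa only [WithTop.coe_le_coe] using this
  let _ : MeasurableSpace Ω := 𝓕 t
  have h1 : Measurable (fun ω => min (σ ω) t) := by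
    refine measurable_of_Iic fun s => ?_
    by_cases hts : t ≤ s
    · have : (fun ω => min (σ ω) t) ⁻¹' Set.Iic s = Set.univ :=
        Set.eq_univ_of_forall fun ω => (min_le_right _ _).trans hts
      rw [this]
      exact MeasurableSet.univ
    · have : (fun ω => min (σ ω) t) ⁻¹' Set.Iic s = {ω | σ ω ≤ s} := by
        ext ω
        simp [hts]
      rw [this]
      exact hle s (not_le.1 hts).le
  have e : {p : Set.Iic t × Ω | ((p.1 : ℝ≥0), p.2) ∈ {q : ℝ≥0 × Ω | q.1 < σ q.2}} =
      {p | (p.1 : ℝ≥0) < min (σ p.2) t} ∪ ({p | t ≤ (p.1 : ℝ≥0)} ∩ {p | σ p.2 ≤ t}ᶜ) := by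
    ext ⟨⟨s, hs⟩, ω⟩
    have hs' : s ≤ t := hs
    simp only [Set.mem_ofPred_eq, Set.mem_union, Set.mem_inter_iff, Set.mem_compl_iff, lt_min_iff,
      not_le]
    constructor
    · intro h
      rcases hs'.lt_or_eq with hlt | rfl
      · exact Or.inl ⟨h, hlt⟩
      · exact Or.inr ⟨le_rfl, h⟩
    · rintro (h | h)
      · exact h.1
      · exact hs'.trans_lt h.2
  rw [e]
  have hc : Measurable (fun p : Set.Iic t × Ω => (p.1 : ℝ≥0)) :=
    measurable_subtype_coe.comp measurable_fst
  refine (measurableSet_lt hc (h1.comp measurable_snd)).union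
    ((measurableSet_le measurable_const hc).inter ?_)
  exact (measurable_snd (hle t le_rfl)).compl

/-- The event of exit by time t is that the norm at time t is at least `R`, which depends on the
path up to t only. -/
lemma isStoppingTime_exitTime [CompleteSpace E] [SecondCountableTopology E] [CompleteSpace V]
    [SecondCountableTopology V]
    (hj : Function.Injective j) {u : ℝ≥0 → Ω → V} (hu : IsRegular j 𝓕 u)
    (hc : ∀ ω, Continuous (fun t => u t ω)) (R : ℝ≥0∞) : IsStoppingTime 𝓕 (exitTime j R u) := by
  intro t
  have : {ω | exitTime j R u ω ≤ t} = {ω | R ≤ xNorm j (fun s => u s ω) t} := by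
    ext ω
    have h := coe_lt_exitTime_iff (R := R) (hc ω) (hu.finite ω) t
    exact not_iff_not.1 (by simpa only [Set.mem_ofPred_eq, not_le] using h)
  rw [this]
  exact hu.measurableSet_le_xNorm hj R t

end StoppingTimes

/-! ### Stopped paths and localizing times -/

section Stopped

variable {E V : Type*} [NormedAddCommGroup E] [NormedSpace ℝ E] [NormedAddCommGroup V]
  [NormedSpace ℝ V] {j : E →L[ℝ] V}

lemma xSq_stopped (hj : Function.Injective j) (w : ℝ≥0 → V) (c T : ℝ≥0) :
    xSq j (fun s => if s ≤ c then w s else 0) T = xSq j w (min T c) := by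
  unfold xSq
  congr 1
  · refine le_antisymm (iSup₂_le fun s hs => ?_) (iSup₂_le fun s hs => ?_)
    · by_cases hc : s ≤ c
      · simp only [hc, if_true]
        exact le_iSup₂ (f := fun s (_ : s ∈ Set.Iic (min T c)) => ‖w s‖ₑ ^ 2) s
          (Set.mem_Iic.2 (le_min hs hc))
      · simp [hc]
    · have hs' : s ≤ T ∧ s ≤ c := le_min_iff.1 hs
      refine le_trans ?_ (le_iSup₂ (f := fun s (_ : s ∈ Set.Iic T) =>
        ‖(if s ≤ c then w s else 0)‖ₑ ^ 2) s hs'.1)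
      simp only [hs'.2, if_true]
      exact le_rfl
  · rw [← Set.Iic_inter_Iic, Set.inter_comm, ← Measure.restrict_restrict measurableSet_Iic,
      ← lintegral_indicator (μ := leb.restrict (Set.Iic T)) measurableSet_Iic]
    refine lintegral_congr fun s => ?_
    by_cases hc : s ≤ c
    · rw [Set.indicator_of_mem (show s ∈ Set.Iic c from hc)]
      simp only [hc, if_true]
    · rw [Set.indicator_of_notMem (show s ∉ Set.Iic c from hc)]
      simp [hc, eNormE_zero hj]

namespace IsCompatible

variable {U : ℕ → ℝ≥0 → V} {τ : ℕ → WithTop ℝ≥0} (h : IsCompatible j U τ)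
include h

/-- The times min (τ m) m will localize the limit solution: they are finite and, even when they
equal τ m, strictly below the limit. -/
lemma min_lt_iSup (m : ℕ) {s : ℝ≥0} (hs : (s : WithTop ℝ≥0) = min (τ m) (m : ℝ≥0)) :
    (s : WithTop ℝ≥0) < ⨆ n, τ n := by
  have h1 : (s : WithTop ℝ≥0) ≤ τ m := hs.le.trans (min_le_left _ _)
  rcases h1.lt_or_eq with h2 | h2
  · exact h2.trans_le (le_iSup τ m)
  · exact h.lt_iSup_of_eq h2.symm

lemma iSup_min : ⨆ m, min (τ m) ((m : ℝ≥0) : WithTop ℝ≥0) = ⨆ n, τ n := by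
  refine le_antisymm (iSup_mono fun m => min_le_left _ _) (iSup_le fun n => ?_)
  refine le_of_forall_lt fun c hc => ?_
  lift c to ℝ≥0 using (lt_top_of_lt hc).ne
  obtain ⟨m, hm⟩ := exists_nat_gt c
  refine lt_of_lt_of_le ?_ (le_iSup (fun m => min (τ m) ((m : ℝ≥0) : WithTop ℝ≥0)) (max n m))
  refine lt_min (hc.trans_le (h.monotone (le_max_left _ _))) (WithTop.coe_lt_coe.2 (hm.trans_le ?_))
  exact_mod_cast le_max_right n m

end IsCompatible

end Stopped

/-! ### The truncated equation up to a stopping time -/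

section Local

variable {E V H Ω : Type*}
  [NormedAddCommGroup E] [NormedSpace ℝ E]
  [NormedAddCommGroup V] [NormedSpace ℝ V]
  [NormedAddCommGroup H] [NormedSpace ℝ H]
  {mΩ : MeasurableSpace Ω} {j : E →L[ℝ] V} {k : V →L[ℝ] H} {S : ℝ≥0 → H →L[ℝ] H}
  {W : ℝ≥0 → Ω → ℝ} {𝓕 : Filtration ℝ≥0 mΩ} {P : Measure Ω}
  {F : E → H} {G : E → V} {θ : ℝ → ℝ} {R : ℝ} {u₀ : Ω → V}

lemma IsConvAt.congr {f g : ℝ≥0 → H} {t : ℝ≥0} {h : H} (hf : IsConvAt S f t h)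
    (hfg : ∀ r < t, f r = g r) : IsConvAt S g t h := by
  have hae : (fun r => S (t - r) (f r)) =ᵐ[leb.restrict (Set.Iic t)] fun r => S (t - r) (g r) := by
    rw [← Measure.restrict_congr_set Iio_ae_eq_Iic]
    filter_upwards [ae_restrict_mem measurableSet_Iio] with r hr
    rw [hfg r hr]
  exact ⟨(integrable_congr hae).1 hf.1, hf.2.trans (integral_congr_ae hae)⟩

/-- A mild equation holds for all times simultaneously. -/
lemma MildOn.ae_forall (hk : Function.Injective k) (hS : SemigroupAssumption j k S W 𝓕 P)
    {f : ℝ≥0 → Ω → H} {ξ z : ℝ≥0 → Ω → V} (hf : IsBoundedData 𝓕 f)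
    (hz : ∀ ω, Continuous (fun t => z t ω)) (h : MildOn k S W 𝓕 P u₀ Set.univ f ξ z) :
    ∃ J, IsStochConv k S W 𝓕 P ξ J ∧ ∀ᵐ ω ∂P, ∀ t, ∃ h, IsConvAt S (fun r => f r ω) t h ∧
      k (z t ω) = S t (k (u₀ ω)) + h + k (J t ω) := by
  obtain ⟨J, hJ, h⟩ := h
  obtain ⟨_, hconv⟩ := exists_conv_path hk hS
  obtain ⟨_, horb⟩ := exists_orbit_path hk hS
  choose a hac ha _ using fun ω => horb (u₀ ω)
  choose b hbc hb _ using fun ω => hconv (fun s => f s ω) (hf.memLp ω)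
  obtain ⟨D, hD, hD'⟩ := TopologicalSpace.exists_countable_dense ℝ≥0
  refine ⟨J, hJ, ?_⟩
  filter_upwards [(ae_ball_iff hD).2 fun t _ => h t, hJ.1] with ω h1 h2 t
  -- Both sides are continuous in t, so equality at a countable dense set of times gives one null
  -- set for all times, random ones included.
  have h3 : (fun t => z t ω) = fun t => a ω t + b ω t + J t ω := by
    refine (hz ω).ext_on hD' (((hac ω).add (hbc ω)).add h2) fun q hq => hk ?_
    obtain ⟨x, ⟨_, hx⟩, hx'⟩ := h1 q hq trivial
    simp only [map_add, ha]
    rw [hx', hx, (hb ω q).2]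
  refine ⟨k (b ω t), hb ω t, ?_⟩
  rw [congrFun h3 t, map_add, map_add, ha]

variable [CompleteSpace E] [SecondCountableTopology E] [CompleteSpace V] [SecondCountableTopology V]
  [SecondCountableTopology H] [IsProbabilityMeasure P]

/-- The truncated equation, stopped at `σ`. -/
lemma IsRegularSolution.exists_stopped (hj : Function.Injective j) (hk : Function.Injective k)
    (hW : IsWienerProcess W 𝓕 P) (h𝓕 : UsualConditions 𝓕 P)
    (hS : SemigroupAssumption j k S W 𝓕 P) (hF : PolyLocallyLipschitz j F)
    (hG : PolyLocallyLipschitz j G) (hθ : IsCutoff θ) (hR : 0 < R)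
    (hu₀ : StronglyMeasurable[𝓕 0] u₀) {u : ℝ≥0 → Ω → V}
    (hu : IsRegularSolution θ R j k S F G W 𝓕 P u₀ u) {σ : Ω → ℝ≥0}
    (hσ : IsStoppingTime 𝓕 (fun ω => (σ ω : WithTop ℝ≥0))) :
    ∃ J, IsStochConv k S W 𝓕 P (fun r ω => (Set.Iio (σ ω)).indicator
        (fun r => trunc j θ R G (fun s => u s ω) r) r) J ∧
      ∀ᵐ ω ∂P, ∀ t ≤ σ ω, ∃ h, IsConvAt S (fun r => trunc j θ R F (fun s => u s ω) r) t h ∧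
        k (u t ω) = S t (k (u₀ ω)) + h + k (J t ω) := by
  have hf := hu.regular.isBoundedData_trunc hj hF hθ hR
  have hξ := (hu.regular.isBoundedData_trunc hj hG hθ hR).indicator
    (measurableSet_lt_of_isStoppingTime hσ)
  obtain ⟨_, _, hex⟩ := exists_mild hj hk hW h𝓕 hS
  obtain ⟨z, hz, hzc, hzm, -⟩ := hex u₀ _ _ hu₀ hf hξ
  -- `z` has the same drift data but noise switched off from σ on. The data agree strictly before t
  -- for every t ≤ σ, so `u` and `z` agree at σ as well.
  have heq := (hu.mild.mono (Set.subset_univ {q : ℝ≥0 × Ω | q.1 ≤ σ q.2})).ae_eq_of_forall_lt hk hW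
    (hzm.mono (Set.subset_univ _)) (fun s t ω hst ht => le_trans hst ht)
    (.of_forall fun ω t ht r hr => ⟨rfl, ?_⟩) (isRegular_leftContinuous hu.regular)
    (isRegular_leftContinuous hz)
  · obtain ⟨J, hJ, hJ'⟩ := hzm.ae_forall hk hS hf hzc
    refine ⟨J, hJ, ?_⟩
    filter_upwards [heq, hJ'] with ω h1 h2 t ht
    rw [h1 t ht]
    exact h2 t
  · exact (Set.indicator_of_mem (s := {q : ℝ≥0 × Ω | q.1 < σ q.2}) (a := (r, ω))
      (lt_of_lt_of_le hr ht) (fun p => trunc j θ R G (fun s => u s p.2) p.1)).symm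

end Local

/-! ### The limit process as the largest local mild solution -/

section LocalSolution

variable {E V H Ω : Type*}
  [NormedAddCommGroup E] [NormedSpace ℝ E]
  [NormedAddCommGroup V] [NormedSpace ℝ V]
  [NormedAddCommGroup H] [NormedSpace ℝ H]
  {mΩ : MeasurableSpace Ω} {j : E →L[ℝ] V} {k : V →L[ℝ] H} {S : ℝ≥0 → H →L[ℝ] H}
  {W : ℝ≥0 → Ω → ℝ} {𝓕 : Filtration ℝ≥0 mΩ} {P : Measure Ω}
  {F : E → H} {G : E → V} {θ : ℝ → ℝ} {R : ℝ} {u₀ : Ω → V}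
  [CompleteSpace E] [SecondCountableTopology E] [CompleteSpace V] [SecondCountableTopology V]
  [SecondCountableTopology H] [IsProbabilityMeasure P]
  {U : ℕ → ℝ≥0 → Ω → V} {τ : Ω → WithTop ℝ≥0} {u : ℝ≥0 → Ω → V}

lemma ofReal_natCast_add_one (n : ℕ) : ENNReal.ofReal ((n : ℝ) + 1) = n + 1 := by
  rw [ENNReal.ofReal_add (by positivity) zero_le_one, ENNReal.ofReal_natCast, ENNReal.ofReal_one]

/-- On t < τ the value is the limit of the U n, each cut off at its own exit time. The null set
where this fails is harmless because the usual conditions place it in `𝓕 t`. -/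
lemma isAdmissible_limit (hj : Function.Injective j) (h𝓕 : UsualConditions 𝓕 P)
    (hU : ∀ n : ℕ, IsRegularSolution θ (n + 1) j k S F G W 𝓕 P u₀ (U n))
    (hcomp : ∀ᵐ ω ∂P, IsCompatible j (fun n s => U n s ω) (fun n => exitTime j (n + 1) (U n) ω))
    (hτ : ∀ᵐ ω ∂P, limitTime j U ω = τ ω)
    (hu : ∀ᵐ ω ∂P, ∀ n : ℕ, ∀ t : ℝ≥0, (t : WithTop ℝ≥0) < exitTime j (n + 1) (U n) ω →
      u t ω = U n t ω) : IsAdmissible 𝓕 P u τ := by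
  have hτs : ∀ n : ℕ, IsStoppingTime 𝓕 (exitTime j (n + 1) (U n)) := fun n =>
    isStoppingTime_exitTime hj (hU n).regular (hU n).cont _
  refine ⟨fun t => ?_, ?_⟩
  · set Ω₀ : Set Ω := {ω | (IsCompatible j (fun n s => U n s ω)
      (fun n => exitTime j (n + 1) (U n) ω)) ∧ (limitTime j U ω = τ ω) ∧ ∀ n : ℕ, ∀ t : ℝ≥0,
        (t : WithTop ℝ≥0) < exitTime j (n + 1) (U n) ω → u t ω = U n t ω} with hΩ₀
    have hae : ∀ᵐ ω ∂P, ω ∈ Ω₀ := by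
      filter_upwards [hcomp, hτ, hu] with ω h1 h2 h3 using ⟨h1, h2, h3⟩
    have hm : MeasurableSet[𝓕 t] Ω₀ := by
      have := (h𝓕.measurableSet_of_null (mem_ae_iff.1 hae) t).compl
      rwa [compl_compl] at this
    set g : ℕ → Ω → V := fun n =>
      Ω₀.indicator ({ω | (t : WithTop ℝ≥0) < exitTime j (n + 1) (U n) ω}.indicator (U n t))
    have hg : ∀ n, StronglyMeasurable[𝓕 t] (g n) := fun n => by
      refine (((hU n).regular.adapted t).indicator ?_).indicator hm
      have := (hτs n t).compl
      simpa only [Set.compl_ofPred, not_le] using this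
    have hlim : StronglyMeasurable[𝓕 t]
        (Ω₀.indicator ({ω | (t : WithTop ℝ≥0) < τ ω}.indicator (u t))) := by
      refine stronglyMeasurable_of_tendsto atTop hg ?_
      rw [tendsto_pi_nhds]
      intro ω
      by_cases hω : ω ∈ Ω₀
      · simp only [g, Set.indicator_of_mem hω]
        obtain ⟨h1, h2, h3⟩ := hω
        by_cases ht : (t : WithTop ℝ≥0) < τ ω
        · have ht' := ht
          rw [← h2, limitTime] at ht'
          obtain ⟨n₀, hn₀⟩ := lt_iSup_iff.1 ht'
          refine tendsto_const_nhds.congr' ?_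
          filter_upwards [eventually_ge_atTop n₀] with n hn
          have hn' : (t : WithTop ℝ≥0) < exitTime j (n + 1) (U n) ω :=
            hn₀.trans_le (h1.monotone hn)
          rw [Set.indicator_of_mem (show ω ∈ {ω | (t : WithTop ℝ≥0) < τ ω} from ht),
            Set.indicator_of_mem (show ω ∈ {ω | (t : WithTop ℝ≥0) < exitTime j (n + 1) (U n) ω}
              from hn'), h3 n t hn']
        · refine tendsto_const_nhds.congr fun n => ?_
          have hn' : ¬ (t : WithTop ℝ≥0) < exitTime j (n + 1) (U n) ω := fun hn => ht (by
            rw [← h2]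
            exact hn.trans_le (le_iSup (fun n : ℕ => exitTime j (n + 1) (U n) ω) n))
          rw [Set.indicator_of_notMem (show ω ∉ {ω | (t : WithTop ℝ≥0) < τ ω} from ht),
            Set.indicator_of_notMem
              (show ω ∉ {ω | (t : WithTop ℝ≥0) < exitTime j (n + 1) (U n) ω} from hn')]
      · simp only [g, Set.indicator_of_notMem hω]
        exact tendsto_const_nhds
    refine h𝓕.stronglyMeasurable_of_ae_eq hlim ?_
    filter_upwards [hae] with ω hω
    rw [Set.indicator_of_mem hω]
  · filter_upwards [hcomp, hτ, hu] with ω h1 h2 h3 t ht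
    refine (h1.continuousAt (u := fun t => u t ω) h3 ?_).continuousWithinAt
    have ht' : (t : WithTop ℝ≥0) < τ ω := ht
    rwa [← h2] at ht'

/-- The limit of the solutions of the truncated equations is a local mild solution. -/
lemma isLocalMildSolution_limit (hj : Function.Injective j) (hk : Function.Injective k)
    (hW : IsWienerProcess W 𝓕 P) (h𝓕 : UsualConditions 𝓕 P)
    (hS : SemigroupAssumption j k S W 𝓕 P) (hF : PolyLocallyLipschitz j F)
    (hG : PolyLocallyLipschitz j G) (hθ : IsCutoff θ)
    (hu₀ : StronglyMeasurable[𝓕 0] u₀) (hu₀' : ∫⁻ ω, ‖u₀ ω‖ₑ ^ 2 ∂P < ⊤)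
    (hU : ∀ n : ℕ, IsRegularSolution θ (n + 1) j k S F G W 𝓕 P u₀ (U n))
    (hτ : ∀ᵐ ω ∂P, limitTime j U ω = τ ω)
    (hu : ∀ᵐ ω ∂P, ∀ n : ℕ, ∀ t : ℝ≥0, (t : WithTop ℝ≥0) < exitTime j (n + 1) (U n) ω →
      u t ω = U n t ω) : IsLocalMildSolution j k S F G W 𝓕 P u₀ u τ := by
  have hcomp := ae_isCompatible hj hk hW h𝓕 hS hF hG hθ hU
  have hτs : ∀ n : ℕ, IsStoppingTime 𝓕 (exitTime j (n + 1) (U n)) := fun n =>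
    isStoppingTime_exitTime hj (hU n).regular (hU n).cont _
  -- The minimum with `m` makes the time finite, so the default value 0 of `untopD` never occurs.
  set σ : ℕ → Ω → ℝ≥0 := fun m ω =>
    (min (exitTime j (m + 1) (U m) ω) ((m : ℝ≥0) : WithTop ℝ≥0)).untopD 0 with hσdef
  have hσ : ∀ m ω, ((σ m ω : ℝ≥0) : WithTop ℝ≥0) =
      min (exitTime j (m + 1) (U m) ω) ((m : ℝ≥0) : WithTop ℝ≥0) := fun m ω => by
    have hne : min (exitTime j (m + 1) (U m) ω) ((m : ℝ≥0) : WithTop ℝ≥0) ≠ ⊤ :=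
      ne_top_of_le_ne_top WithTop.coe_ne_top (min_le_right _ _)
    obtain ⟨x, hx⟩ := WithTop.ne_top_iff_exists.1 hne
    simp only [hσdef]
    rw [← hx, WithTop.untopD_coe]
  have hσs : ∀ m, IsStoppingTime 𝓕 (fun ω => (σ m ω : WithTop ℝ≥0)) := fun m => by
    simp only [hσ]
    exact (hτs m).min_const _
  have hσae : ∀ᵐ ω ∂P, Monotone (fun m => σ m ω) ∧ (∀ m, (σ m ω : WithTop ℝ≥0) < τ ω) ∧
      (⨆ m, (σ m ω : WithTop ℝ≥0)) = τ ω := by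
    filter_upwards [hcomp, hτ] with ω h1 h2
    refine ⟨fun m n hmn => ?_, fun m => ?_, ?_⟩
    · refine WithTop.coe_le_coe.1 ?_
      rw [hσ, hσ]
      exact min_le_min (h1.monotone hmn) (WithTop.coe_le_coe.2 (by exact_mod_cast hmn))
    · rw [← h2]
      exact h1.min_lt_iSup m (hσ m ω)
    · simp only [hσ]
      rw [← h2]
      exact h1.iSup_min
  have hle : ∀ m ω, (σ m ω : WithTop ℝ≥0) ≤ exitTime j (m + 1) (U m) ω := fun m ω => by
    rw [hσ]
    exact min_le_left _ _
  have heq : ∀ m, ∀ᵐ ω ∂P, ∀ t ≤ σ m ω, u t ω = U m t ω := fun m => by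
    filter_upwards [hcomp, hu] with ω h1 h2 t ht
    exact h1.eq_of_le (u := fun t => u t ω) h2 ((WithTop.coe_le_coe.2 ht).trans (hle m ω))
  -- Only strictly before σ: if the exit time is 0, the norm at 0 may exceed the level.
  have hbd : ∀ m : ℕ, ∀ᵐ ω ∂P, ∀ t < σ m ω,
      xNorm j (fun s => U m s ω) t ≤ ENNReal.ofReal ((m : ℝ) + 1) := by
    intro m
    filter_upwards [hcomp] with ω h1 t ht
    rw [ofReal_natCast_add_one]
    exact ((h1.lt_iff m t).1 ((WithTop.coe_lt_coe.2 ht).trans_le (hle m ω))).le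
  refine ⟨⟨h𝓕.isStoppingTime_of_ae_eq (isStoppingTime_iSup hτs) hτ,
    fun m ω => (σ m ω : WithTop ℝ≥0), hσs, ?_⟩, isAdmissible_limit hj h𝓕 hU hcomp hτ hu, σ, hσs,
    hσae, fun m => ⟨fun t => ?_, ?_⟩⟩
  · filter_upwards [hσae] with ω h1
    exact ⟨fun m n hmn => WithTop.coe_le_coe.2 (h1.1 hmn), h1.2⟩
  · have hm1 : (0 : ℝ) < m + 1 := by positivity
    refine lt_of_le_of_lt (lintegral_mono_ae ?_) (lintegral_xSq_lt_top hj hk hW h𝓕 hS hu₀ hu₀'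
      ((hU m).regular.isBoundedData_trunc hj hF hθ hm1)
      ((hU m).regular.isBoundedData_trunc hj hG hθ hm1) (hU m).regular (hU m).mild t)
    filter_upwards [heq m] with ω h1
    rw [xNorm_sq, xSq_congr (w' := fun s => U m s ω) fun s hs => h1 s (hs.trans (min_le_right _ _))]
    exact xSq_mono _ (min_le_left _ _)
  · obtain ⟨J, ⟨hJc, hJ⟩, h⟩ := (hU m).exists_stopped hj hk hW h𝓕 hS hF hG hθ (by positivity) hu₀
      (hσs m)
    refine ⟨J, ⟨hJc, fun t => ?_⟩, fun t => ?_⟩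
    · refine IsItoIntegral.congr (hJ t) ?_ (.of_forall fun _ => rfl)
      filter_upwards [hbd m, heq m] with ω h1 h2 s
      by_cases hs : s ∈ Set.Iio t
      · rw [Set.indicator_of_mem hs, Set.indicator_of_mem hs]
        by_cases hs' : s ∈ Set.Iio (σ m ω)
        · rw [Set.indicator_of_mem hs', Set.indicator_of_mem hs',
            trunc_eq_onV hθ (by positivity) (h1 s hs'), h2 s (le_of_lt hs')]
        · rw [Set.indicator_of_notMem hs', Set.indicator_of_notMem hs']
      · rw [Set.indicator_of_notMem hs, Set.indicator_of_notMem hs]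
    · filter_upwards [h, hbd m, heq m] with ω h1 h2 h3
      obtain ⟨x, hx, hx'⟩ := h1 _ (min_le_right t (σ m ω))
      refine ⟨x, hx.congr fun r hr => ?_, ?_⟩
      · have hr' := hr.trans_le (min_le_right _ _)
        rw [trunc_eq_onV hθ (by positivity) (h2 r hr'), h3 r hr'.le]
      · rw [h3 _ (min_le_right _ _), hx']

/-- Every local mild solution is a restriction of the limit of the solutions of the truncated
equations. -/
lemma IsLocalMildSolution.ae_lt_limitTime (hj : Function.Injective j) (hk : Function.Injective k)
    (hW : IsWienerProcess W 𝓕 P) (h𝓕 : UsualConditions 𝓕 P)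
    (hS : SemigroupAssumption j k S W 𝓕 P) (hF : PolyLocallyLipschitz j F)
    (hG : PolyLocallyLipschitz j G) (hθ : IsCutoff θ)
    (hU : ∀ n : ℕ, IsRegularSolution θ (n + 1) j k S F G W 𝓕 P u₀ (U n))
    {v : ℝ≥0 → Ω → V} {ρ : Ω → WithTop ℝ≥0}
    (hv : IsLocalMildSolution j k S F G W 𝓕 P u₀ v ρ) :
    ∀ᵐ ω ∂P, ∀ t : ℝ≥0, (t : WithTop ℝ≥0) < ρ ω →
      ∃ n : ℕ, (t : WithTop ℝ≥0) < exitTime j (n + 1) (U n) ω ∧ v t ω = U n t ω := by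
  borelize V
  obtain ⟨-, ⟨hvad, hvc⟩, σ, hσs, hσae, hsol⟩ := hv
  -- Before σ m the path norm of v is finite, hence below some level n + 1, and up to that level v
  -- must follow U n.
  have key : ∀ m n : ℕ, ∀ᵐ ω ∂P, ∀ t < σ m ω, xNorm j (fun s => v s ω) t < ⊤ ∧
      (xNorm j (fun s => v s ω) t < n + 1 →
        (t : WithTop ℝ≥0) < exitTime j (n + 1) (U n) ω ∧ v t ω = U n t ω) := by
    intro m n
    obtain ⟨hint, J, hJ, hmild⟩ := hsol m
    set Ω₁ : Set Ω := {ω | ContinuousOn (fun t => v t ω) {t : ℝ≥0 | (t : WithTop ℝ≥0) < ρ ω} ∧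
      (σ m ω : WithTop ℝ≥0) < ρ ω} with hΩ₁
    have hae₁ : ∀ᵐ ω ∂P, ω ∈ Ω₁ := by
      filter_upwards [hvc, hσae] with ω h1 h2 using ⟨h1, h2.2.1 m⟩
    have hm : ∀ {A : Set Ω}, (∀ᵐ ω ∂P, ω ∈ A) → ∀ t, MeasurableSet[𝓕 t] A := fun h t => by
      have := (h𝓕.measurableSet_of_null (mem_ae_iff.1 h) t).compl
      rwa [compl_compl] at this
    have hσle : ∀ t : ℝ≥0, MeasurableSet[𝓕 t] {ω | t ≤ σ m ω} := fun t => by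
      have := ((hσs m).measurableSet_lt t).compl
      simpa only [Set.compl_ofPred, not_lt, WithTop.coe_le_coe] using this
    have hlt : ∀ ω ∈ Ω₁, ∀ s ≤ σ m ω, (s : WithTop ℝ≥0) < ρ ω := fun ω hω s hs =>
      (WithTop.coe_le_coe.2 hs).trans_lt hω.2
    -- Setting v to 0 after σ keeps it adapted and left-continuous; freezing the value instead could
    -- destroy the finiteness of the E-integral.
    set y : ℝ≥0 → Ω → V := fun t => Ω₁.indicator fun ω => if t ≤ σ m ω then v t ω else 0 with hy
    have hyad : StronglyAdapted 𝓕 y := fun t => by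
      have h1 := (((hvad t).indicator (hσle t)).indicator (hm hae₁ t))
      convert h1 using 1
      ext ω
      by_cases hω : ω ∈ Ω₁
      · simp only [hy, Set.indicator_of_mem hω]
        by_cases ht : t ≤ σ m ω
        · rw [if_pos ht, Set.indicator_of_mem (show ω ∈ {ω | t ≤ σ m ω} from ht),
            Set.indicator_of_mem (show ω ∈ {ω | (t : WithTop ℝ≥0) < ρ ω} from hlt ω hω t ht)]
        · rw [if_neg ht, Set.indicator_of_notMem (show ω ∉ {ω | t ≤ σ m ω} from ht)]
      · simp only [hy, Set.indicator_of_notMem hω]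
    have hyc : ∀ ω t, ContinuousWithinAt (fun s => y s ω) (Set.Iic t) t := fun ω t => by
      by_cases hω : ω ∈ Ω₁
      · simp only [hy, Set.indicator_of_mem hω]
        by_cases ht : t ≤ σ m ω
        · have h1 : ContinuousWithinAt (fun s => v s ω) (Set.Iic t) t :=
            (hω.1 t (hlt ω hω t ht)).mono fun s hs => hlt ω hω s (le_trans hs ht)
          refine h1.congr (fun s hs => if_pos (le_trans hs ht)) (if_pos ht)
        · refine ContinuousAt.continuousWithinAt ?_
          refine (continuousAt_const (y := (0 : V))).congr ?_
          filter_upwards [Ioi_mem_nhds (not_le.1 ht)] with s hs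
          exact (if_neg (not_le.2 hs)).symm
      · simp only [hy, Set.indicator_of_notMem hω]
        exact continuousWithinAt_const
    have hyS : ∀ ω ∈ Ω₁, ∀ T, xSq j (fun s => y s ω) T = xSq j (fun s => v s ω) (min T (σ m ω)) :=
      fun ω hω T => by
        simp only [hy, Set.indicator_of_mem hω]
        exact xSq_stopped hj (fun s => v s ω) _ _
    have hyfin : ∀ᵐ ω ∂P, ∀ N : ℕ, xSq j (fun s => y s ω) N < ⊤ := ae_all_iff.2 fun N => by
      have hmeas : Measurable (fun ω => xSq j (fun s => y s ω) N) :=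
        Measurable.comp (f := fun ω : Ω => ((N : ℝ≥0), ω))
          (measurable_uncurry_xSq hj (fun t => ((hyad t).mono (𝓕.le t)).measurable) hyc)
          measurable_prodMk_left
      refine ae_lt_top hmeas (lt_of_le_of_lt (lintegral_mono_ae ?_) (hint N)).ne
      filter_upwards [hae₁] with ω hω
      rw [hyS ω hω, xNorm_sq]
    set Ω₂ : Set Ω := {ω | ∀ N : ℕ, xSq j (fun s => y s ω) N < ⊤} with hΩ₂
    set z : ℝ≥0 → Ω → V := fun t => Ω₂.indicator (y t) with hz
    have hzreg : IsRegular j 𝓕 z := by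
      refine ⟨fun t => (hyad t).indicator (hm hyfin t), fun ω t => ?_, fun ω T => ?_⟩
      · by_cases hω : ω ∈ Ω₂
        · simp only [hz, Set.indicator_of_mem hω]
          exact hyc ω t
        · simp only [hz, Set.indicator_of_notMem hω]
          exact continuousWithinAt_const
      · by_cases hω : ω ∈ Ω₂
        · simp only [hz, Set.indicator_of_mem hω]
          obtain ⟨N, hN⟩ := exists_nat_ge T
          exact (xSq_mono _ hN).trans_lt (hω N)
        · simp only [hz, Set.indicator_of_notMem hω]
          rw [xSq_zero hj]
          exact ENNReal.zero_lt_top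
    have hzv : ∀ᵐ ω ∂P, ∀ t ≤ σ m ω, z t ω = v t ω := by
      filter_upwards [hae₁, hyfin] with ω h1 h2 t ht
      simp only [hz, hy, Set.indicator_of_mem (show ω ∈ Ω₂ from h2), Set.indicator_of_mem h1,
        if_pos ht]
    -- On `B` the cutoff of level n + 1 equals 1 along `z`, so the equation of v is there the
    -- truncated equation.
    set B : Set (ℝ≥0 × Ω) := {q | q.1 < σ m q.2} ∩ {q | xNorm j (fun s => z s q.2) q.1 ≤ n + 1}
      with hB
    have hmz : MildOn k S W 𝓕 P u₀ B (fun r ω => onV j F (v r ω))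
        (fun r ω => (Set.Iio (σ m ω)).indicator (fun s => onV j G (v s ω)) r) z := by
      refine ⟨J, hJ, fun t => ?_⟩
      filter_upwards [hmild t, hzv] with ω h1 h2 ht
      rw [min_eq_left (le_of_lt ht.1)] at h1
      rw [h2 t (le_of_lt ht.1)]
      exact h1
    have hBl : ∀ s t ω, s ≤ t → (t, ω) ∈ B → (s, ω) ∈ B := fun s t ω hst ht =>
      ⟨lt_of_le_of_lt hst ht.1, (xNorm_mono _ hst).trans ht.2⟩
    have hBm : ∀ t : ℝ≥0, MeasurableSet[Subtype.instMeasurableSpace.prod (𝓕 t)]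
        {p : Set.Iic t × Ω | ((p.1 : ℝ≥0), p.2) ∈ B} := fun t =>
      @MeasurableSet.inter _ (Subtype.instMeasurableSpace.prod (𝓕 t)) _ _
        (measurableSet_lt_of_isStoppingTime (hσs m) t) (hzreg.measurableSet_xNorm_le hj _ t)
    have heq := ae_eq_on_of_mildOn (R := n + 1) (θ := θ) hj hk hW h𝓕 hS hF hG hθ (by positivity)
      hBl hBm hzreg (hU n).regular hmz ((hU n).mild.mono (Set.subset_univ _)) (by
        filter_upwards [hzv] with ω h1 t ht
        have h2 : xNorm j (fun s => z s ω) t ≤ ENNReal.ofReal ((n : ℝ) + 1) := by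
          rw [ofReal_natCast_add_one]
          exact ht.2
        rw [trunc_eq_onV hθ (by positivity) h2, trunc_eq_onV hθ (by positivity) h2,
          Set.indicator_of_mem (show t ∈ Set.Iio (σ m ω) from ht.1), h1 t (le_of_lt ht.1)]
        exact ⟨rfl, rfl⟩) (.of_forall fun ω t _ => ⟨rfl, rfl⟩)
    filter_upwards [heq, hzv] with ω h1 h2 t ht
    have h3 : xNorm j (fun s => z s ω) t = xNorm j (fun s => v s ω) t :=
      xNorm_congr fun s hs => h2 s (hs.trans ht.le)
    refine ⟨h3 ▸ xNorm_lt_top_iff.2 (hzreg.finite ω t), fun hN => ?_⟩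
    have htB : (t, ω) ∈ B := ⟨ht, by rw [Set.mem_ofPred_eq, h3]; exact hN.le⟩
    have h4 : xNorm j (fun s => z s ω) t = xNorm j (fun s => U n s ω) t :=
      xNorm_congr fun s hs => h1 s (hBl s t ω hs htB)
    refine ⟨(coe_lt_exitTime_iff ((hU n).cont ω) ((hU n).regular.finite ω) t).2 ?_, ?_⟩
    · rw [← h4, h3]
      exact hN
    · rw [← h2 t ht.le, h1 t htB]
  filter_upwards [ae_all_iff.2 fun m => ae_all_iff.2 fun n => key m n, hσae]
    with ω h1 h3 t ht
  rw [← h3.2.2] at ht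
  obtain ⟨m, hm⟩ := lt_iSup_iff.1 ht
  have hm' := WithTop.coe_lt_coe.1 hm
  obtain ⟨n, hn⟩ := ENNReal.exists_nat_gt (h1 m 0 t hm').1.ne
  exact ⟨n, (h1 m n t hm').2 (hn.trans_le le_self_add)⟩

end LocalSolution

/-! ### Explosion -/

section Explosion

variable {E V H Ω : Type*}
  [NormedAddCommGroup E] [NormedSpace ℝ E]
  [NormedAddCommGroup V] [NormedSpace ℝ V]
  [NormedAddCommGroup H] [NormedSpace ℝ H]
  {mΩ : MeasurableSpace Ω} {j : E →L[ℝ] V} {k : V →L[ℝ] H} {S : ℝ≥0 → H →L[ℝ] H}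
  {W : ℝ≥0 → Ω → ℝ} {𝓕 : Filtration ℝ≥0 mΩ} {P : Measure Ω}
  {F : E → H} {G : E → V} {θ : ℝ → ℝ} {R : ℝ} {u₀ : Ω → V}

/-- With `j` the identity of `V`, the path norm controls only V-norms. The measurability results for
path norms thus apply to events on which the V-norm stays bounded. -/
lemma xNorm_id_le {w : ℝ≥0 → V} {t : ℝ≥0} {M : ℝ≥0∞} (h : ∀ s ≤ t, ‖w s‖ₑ ≤ M) :
    xNorm (ContinuousLinearMap.id ℝ V) w t ≤ M * (1 + t) := by
  refine le_of_sq_le_sq ?_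
  rw [xNorm_sq]
  have h1 : ∀ s ≤ t, ‖w s‖ₑ ^ 2 ≤ M ^ 2 := fun s hs => pow_le_pow_left' (h s hs) 2
  have h2 : ∀ v : V, eNormE (ContinuousLinearMap.id ℝ V) v = ‖v‖ₑ := fun v =>
    eNormE_apply (j := ContinuousLinearMap.id ℝ V) Function.injective_id v
  calc xSq (ContinuousLinearMap.id ℝ V) w t ≤ M ^ 2 + M ^ 2 * t := by
        refine add_le_add (iSup₂_le h1) ?_
        simp only [h2]
        refine (setLIntegral_mono' measurableSet_Iic h1).trans_eq ?_
        rw [setLIntegral_const, leb_Iic]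
    _ ≤ M ^ 2 + M ^ 2 * t + (M ^ 2 * t + M ^ 2 * t ^ 2) := le_self_add
    _ = (M * (1 + t)) ^ 2 := by ring

lemma IsRegular.id {u : ℝ≥0 → Ω → V} (hu : IsRegular j 𝓕 u) :
    IsRegular (ContinuousLinearMap.id ℝ V) 𝓕 u := by
  refine ⟨hu.adapted, hu.leftCont, fun ω T => xNorm_lt_top_iff.1 ?_⟩
  refine (xNorm_id_le fun s hs => enorm_le_xNorm (j := j) _ hs).trans_lt ?_
  exact ENNReal.mul_lt_top (xNorm_lt_top_iff.2 (hu.finite ω T)) (by finiteness)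

lemma enorm_indicator_sq {α X : Type*} [NormedAddCommGroup X] (B : Set α) (g : α → X) (q : α) :
    ‖B.indicator g q‖ₑ ^ 2 = B.indicator (fun p => ‖g p‖ₑ ^ 2) q := by
  by_cases hq : q ∈ B
  · rw [Set.indicator_of_mem hq, Set.indicator_of_mem hq]
  · rw [Set.indicator_of_notMem hq, Set.indicator_of_notMem hq]
    simp

lemma le_two_mul_of_le_add_half {a b : ℝ≥0∞} (ha : a ≠ ⊤) (h : a ≤ b + 2⁻¹ * a) : a ≤ 2 * b := by
  have h1 : 2⁻¹ * a + 2⁻¹ * a = a := by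
    rw [← add_mul, ENNReal.inv_two_add_inv_two, one_mul]
  have h2 : 2⁻¹ * a ≤ b := by
    refine ENNReal.le_of_add_le_add_right (a := 2⁻¹ * a) (ENNReal.mul_ne_top (by simp) ha) ?_
    rwa [h1]
  calc a = 2 * (2⁻¹ * a) := by rw [two_mul, h1]
    _ ≤ 2 * b := mul_le_mul' le_rfl h2

variable [CompleteSpace E] [SecondCountableTopology E] [CompleteSpace V] [SecondCountableTopology V]
  [SecondCountableTopology H] [IsProbabilityMeasure P]

/-- As long as the norm of `V` remains bounded, the norm of `X_t` is bounded in mean square,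
uniformly in the level of truncation. -/
lemma exists_measure_mul_sq_le (hj : Function.Injective j) (hk : Function.Injective k)
    (hW : IsWienerProcess W 𝓕 P) (h𝓕 : UsualConditions 𝓕 P)
    (hS : SemigroupAssumption j k S W 𝓕 P) (hF : PolyLocallyLipschitz j F)
    (hG : PolyLocallyLipschitz j G) (hθ : IsCutoff θ)
    (hu₀ : StronglyMeasurable[𝓕 0] u₀) (hu₀' : ∫⁻ ω, ‖u₀ ω‖ₑ ^ 2 ∂P < ⊤) {T : ℝ≥0} (hT : 0 < T)
    (M : ℝ≥0) :
    ∃ A : ℝ≥0∞, A ≠ ⊤ ∧ ∀ (R : ℝ) (u : ℝ≥0 → Ω → V), 0 < R →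
      IsRegularSolution θ R j k S F G W 𝓕 P u₀ u → ∀ c : ℝ≥0∞,
      c ^ 2 * P {ω | ∃ t ≤ T, c ≤ xNorm j (fun s => u s ω) t ∧ ∀ s ≤ t, ‖u s ω‖ₑ ≤ M} ≤ A := by
  borelize V
  obtain ⟨C, D, hest⟩ := exists_mild_estimate hj hk hW h𝓕 hS
  -- Gives 2Cη ≤ 1/2, so that the E-terms of both nonlinearities can be absorbed.
  set η : ℝ≥0 := (4 * (C + 1))⁻¹ with hη
  have hη0 : 0 < η := by positivity
  set L : ℝ≥0 := M * (1 + T) with hL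
  obtain ⟨C₁, hC₁⟩ := exists_enorm_trunc_sq_le hj hF hθ L hη0
  obtain ⟨C₂, hC₂⟩ := exists_enorm_trunc_sq_le hj hG hθ L hη0
  refine ⟨2 * (D T * ∫⁻ ω, ‖u₀ ω‖ₑ ^ 2 ∂P + C * (C₁ * T + C₂ * T)), ?_, fun R u hR hu c => ?_⟩
  · have := hu₀'.ne
    finiteness
  set B : Set (ℝ≥0 × Ω) := {q | q.1 ≤ T} ∩
    {q | xNorm (ContinuousLinearMap.id ℝ V) (fun s => u s q.2) q.1 ≤ L} with hB
  have hBl : ∀ s t ω, s ≤ t → (t, ω) ∈ B → (s, ω) ∈ B := fun s t ω hst ht =>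
    ⟨le_trans hst ht.1, (xNorm_mono _ hst).trans ht.2⟩
  have hBm : ∀ t : ℝ≥0, MeasurableSet[Subtype.instMeasurableSpace.prod (𝓕 t)]
      {p : Set.Iic t × Ω | ((p.1 : ℝ≥0), p.2) ∈ B} := fun t => by
    refine @MeasurableSet.inter _ (Subtype.instMeasurableSpace.prod (𝓕 t)) _ _ ?_
      (hu.regular.id.measurableSet_xNorm_le Function.injective_id _ t)
    let _ : MeasurableSpace Ω := 𝓕 t
    exact measurableSet_le (measurable_subtype_coe.comp measurable_fst) measurable_const
  have hf := (hu.regular.isBoundedData_trunc hj hF hθ hR).indicator hBm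
  have hξ := (hu.regular.isBoundedData_trunc hj hG hθ hR).indicator hBm
  obtain ⟨_, _, hex⟩ := exists_mild hj hk hW h𝓕 hS
  obtain ⟨z, hz, -, hzm, -⟩ := hex u₀ _ _ hu₀ hf hξ
  have heq : ∀ᵐ ω ∂P, ∀ t, (t, ω) ∈ B → u t ω = z t ω := by
    refine (hu.mild.mono (Set.subset_univ B)).ae_eq_of_forall_mem hk hW
      (hzm.mono (Set.subset_univ B)) hBl (.of_forall fun ω t ht => ?_)
      (isRegular_leftContinuous hu.regular) (isRegular_leftContinuous hz)
    rw [Set.indicator_of_mem ht, Set.indicator_of_mem ht]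
    exact ⟨rfl, rfl⟩
  set a := ∫⁻ ω, xSq j (fun s => z s ω) T ∂P with ha
  -- Absorption needs finiteness beforehand. The truncation supplies it with a bound depending on
  -- `R`; the bound after absorption does not.
  have hafin : a ≠ ⊤ := (lintegral_xSq_lt_top hj hk hW h𝓕 hS hu₀ hu₀' hf hξ hz hzm T).ne
  -- On `B` the processes u and z agree, so the growth bound is expressed through the E-norm of z,
  -- the quantity to be absorbed.
  have hdata : ∀ {f : ℝ≥0 → Ω → ℝ≥0∞} {C' : ℝ≥0},
      (∀ s ω, ‖u s ω‖ₑ ≤ L → f s ω ≤ η * eNormE j (u s ω) ^ 2 + C') →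
      ∫⁻ ω, ∫⁻ s in Set.Iic T, B.indicator (fun p => f p.1 p.2) (s, ω) ∂leb ∂P ≤
        η * a + C' * T := by
    intro f C' hf
    calc ∫⁻ ω, ∫⁻ s in Set.Iic T, B.indicator (fun p => f p.1 p.2) (s, ω) ∂leb ∂P
        ≤ ∫⁻ ω, (η * xSq j (fun s => z s ω) T + C' * T) ∂P := by
          refine lintegral_mono_ae ?_
          filter_upwards [heq] with ω hω
          calc ∫⁻ s in Set.Iic T, B.indicator (fun p => f p.1 p.2) (s, ω) ∂leb
              ≤ ∫⁻ s in Set.Iic T, (η * eNormE j (z s ω) ^ 2 + C') ∂leb := by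
                refine lintegral_mono fun s => ?_
                by_cases hs : (s, ω) ∈ B
                · rw [Set.indicator_of_mem hs, ← hω s hs]
                  exact hf s ω ((enorm_le_xNorm (fun s => u s ω) le_rfl).trans hs.2)
                · rw [Set.indicator_of_notMem hs]
                  exact zero_le
            _ = η * ∫⁻ s in Set.Iic T, eNormE j (z s ω) ^ 2 ∂leb + C' * T := by
                rw [lintegral_add_right _ measurable_const, setLIntegral_const, leb_Iic,
                  lintegral_const_mul' _ _ ENNReal.coe_ne_top]
            _ ≤ _ := by
                gcongr
                exact lintegral_eNormE_le_xSq _ _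
      _ = η * a + C' * T := by
          rw [lintegral_add_right _ measurable_const, lintegral_const, measure_univ, mul_one,
            lintegral_const_mul' _ _ ENNReal.coe_ne_top]
  have ha2 : a ≤ 2 * (D T * ∫⁻ ω, ‖u₀ ω‖ₑ ^ 2 ∂P + C * (C₁ * T + C₂ * T)) := by
    refine le_two_mul_of_le_add_half hafin ((hest u₀ _ _ z hu₀ hf hξ hz hzm T hT).trans ?_)
    simp only [enorm_indicator_sq]
    refine (add_le_add le_rfl (mul_le_mul' le_rfl (add_le_add
      (hdata (f := fun s ω => ‖trunc j θ R F (fun s => u s ω) s‖ₑ ^ 2) fun s ω h => hC₁ R hR _ s h)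
      (hdata (f := fun s ω => ‖trunc j θ R G (fun s => u s ω) s‖ₑ ^ 2) fun s ω h => hC₂ R hR _ s h)))).trans ?_
    have hCη : C * (2 * η) ≤ 2⁻¹ := by
      rw [hη, ← NNReal.coe_le_coe]
      push_cast
      rw [mul_inv, ← mul_assoc, ← mul_assoc, ← div_eq_mul_inv, div_le_iff₀ (by positivity)]
      have := C.2
      nlinarith
    have hCη' : (C : ℝ≥0∞) * (2 * η) ≤ 2⁻¹ := by
      have := ENNReal.coe_le_coe.2 hCη
      rwa [ENNReal.coe_inv two_ne_zero, ENNReal.coe_mul, ENNReal.coe_mul] at this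
    calc D T * ∫⁻ ω, ‖u₀ ω‖ₑ ^ 2 ∂P + C * (η * a + C₁ * T + (η * a + C₂ * T))
        = D T * ∫⁻ ω, ‖u₀ ω‖ₑ ^ 2 ∂P + C * (C₁ * T + C₂ * T) + C * (2 * η) * a := by ring
      _ ≤ _ := by gcongr
  have hmeas : Measurable (fun ω => xSq j (fun s => z s ω) T) := hz.measurable_xSq hj T
  refine le_trans (le_trans (mul_le_mul' le_rfl (measure_mono_ae ?_))
    (mul_meas_ge_le_lintegral hmeas (c ^ 2))) ha2
  filter_upwards [heq] with ω hω h
  obtain ⟨t, htT, hct, hM⟩ := h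
  have htB : (t, ω) ∈ B := by
    refine ⟨htT, (xNorm_id_le hM).trans ?_⟩
    rw [hL]
    push_cast
    gcongr
  change c ^ 2 ≤ xSq j (fun s => z s ω) T
  rw [xNorm_congr (w' := fun s => z s ω) fun s hs => hω s (hBl s t ω hs htB)] at hct
  refine le_trans (pow_le_pow_left' hct 2) ?_
  rw [xNorm_sq]
  exact xSq_mono _ htT

/-- If the limit time is finite, the limit process is unbounded before that time. -/
lemma ae_iSup_eq_top_of_limitTime_lt_top (hj : Function.Injective j) (hk : Function.Injective k)
    (hW : IsWienerProcess W 𝓕 P) (h𝓕 : UsualConditions 𝓕 P)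
    (hS : SemigroupAssumption j k S W 𝓕 P) (hF : PolyLocallyLipschitz j F)
    (hG : PolyLocallyLipschitz j G) (hθ : IsCutoff θ)
    (hu₀ : StronglyMeasurable[𝓕 0] u₀) (hu₀' : ∫⁻ ω, ‖u₀ ω‖ₑ ^ 2 ∂P < ⊤)
    {U : ℕ → ℝ≥0 → Ω → V} {u : ℝ≥0 → Ω → V}
    (hU : ∀ n : ℕ, IsRegularSolution θ (n + 1) j k S F G W 𝓕 P u₀ (U n))
    (hu : ∀ᵐ ω ∂P, ∀ n : ℕ, ∀ t : ℝ≥0, (t : WithTop ℝ≥0) < exitTime j (n + 1) (U n) ω →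
      u t ω = U n t ω) :
    ∀ᵐ ω ∂P, limitTime j U ω < ⊤ →
      (⨆ (t : ℝ≥0) (_ : (t : WithTop ℝ≥0) < limitTime j U ω), ‖u t ω‖ₑ) = ⊤ := by
  have hcomp := ae_isCompatible hj hk hW h𝓕 hS hF hG hθ hU
  have key : ∀ N M : ℕ, ∀ᵐ ω ∂P, ¬ (limitTime j U ω ≤ ((N + 1 : ℝ≥0) : WithTop ℝ≥0) ∧
      ∀ t : ℝ≥0, (t : WithTop ℝ≥0) < limitTime j U ω → ‖u t ω‖ₑ ≤ (M : ℝ≥0)) := by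
    intro N M
    obtain ⟨A, hA, hAle⟩ := exists_measure_mul_sq_le (T := N + 1) hj hk hW h𝓕 hS hF hG hθ hu₀ hu₀'
      (by positivity) (M : ℝ≥0)
    rw [ae_iff]
    simp only [not_not]
    set s : Set Ω := {ω | limitTime j U ω ≤ ((N + 1 : ℝ≥0) : WithTop ℝ≥0) ∧
      ∀ t : ℝ≥0, (t : WithTop ℝ≥0) < limitTime j U ω → ‖u t ω‖ₑ ≤ (M : ℝ≥0)} with hs
    by_contra hne
    -- On `s`, U n reaches norm n + 1 by time N + 1 while its V-norm stays at most M, so (n + 1)² P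
    -- s ≤ A for every n; this forces P s = 0.
    obtain ⟨n, hn⟩ := ENNReal.exists_nat_mul_gt hne hA
    refine absurd hn (not_lt.2 ?_)
    refine le_trans ?_ (hAle (n + 1) (U n) (by positivity) (hU n) (n + 1))
    refine mul_le_mul' ?_ (measure_mono_ae ?_)
    · have : n ≤ (n + 1) ^ 2 := by nlinarith
      exact_mod_cast this
    · filter_upwards [hcomp, hu] with ω h1 h2 h
      obtain ⟨h3, h4⟩ := h
      have h5 : exitTime j (n + 1) (U n) ω ≤ ((N + 1 : ℝ≥0) : WithTop ℝ≥0) :=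
        (le_iSup (fun n : ℕ => exitTime j (n + 1) (U n) ω) n).trans h3
      obtain ⟨t, ht⟩ := WithTop.ne_top_iff_exists.1 (ne_top_of_le_ne_top WithTop.coe_ne_top h5)
      rw [← ht] at h5
      refine ⟨t, WithTop.coe_le_coe.1 h5, h1.le_xNorm ht.symm, fun r hr => ?_⟩
      have hr' : (r : WithTop ℝ≥0) ≤ exitTime j (n + 1) (U n) ω := by
        rw [← ht]
        exact WithTop.coe_le_coe.2 hr
      have h6 : u r ω = U n r ω := h1.eq_of_le (u := fun t => u t ω) h2 hr'
      rw [← h6]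
      exact h4 r ((WithTop.coe_le_coe.2 hr).trans_lt (h1.lt_iSup_of_eq ht.symm))
  filter_upwards [ae_all_iff.2 fun N => ae_all_iff.2 fun M => key N M] with ω hω hlt
  by_contra hsup
  obtain ⟨M, hM⟩ := ENNReal.exists_nat_gt hsup
  obtain ⟨T, hT⟩ := WithTop.ne_top_iff_exists.1 hlt.ne
  obtain ⟨N, hN⟩ := exists_nat_ge T
  refine hω N M ⟨?_, fun t ht => ?_⟩
  · rw [← hT]
    exact WithTop.coe_le_coe.2 (hN.trans (le_add_of_nonneg_right zero_le_one))
  · refine le_trans (le_iSup₂ (f := fun (t : ℝ≥0)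
      (_ : (t : WithTop ℝ≥0) < limitTime j U ω) => ‖u t ω‖ₑ) t ht) ?_
    exact_mod_cast hM.le

end Explosion

end StochEvol

/-! ### Assembly of the theorem -/

theorem theorem3p2 {E V H Ω : Type*}
    [NormedAddCommGroup E] [NormedSpace ℝ E] [CompleteSpace E] [TopologicalSpace.SeparableSpace E]
    [NormedAddCommGroup V] [NormedSpace ℝ V] [CompleteSpace V] [TopologicalSpace.SeparableSpace V]
    [NormedAddCommGroup H] [NormedSpace ℝ H] [CompleteSpace H] [TopologicalSpace.SeparableSpace H]
    (j : E →L[ℝ] V) (hj : Function.Injective j) (k : V →L[ℝ] H) (hk : Function.Injective k)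
    {mΩ : MeasurableSpace Ω} (P : Measure Ω) [IsProbabilityMeasure P] [P.IsComplete]
    (𝓕 : Filtration ℝ≥0 mΩ) (h𝓕 : StochEvol.UsualConditions 𝓕 P)
    (W : ℝ≥0 → Ω → ℝ) (hW : StochEvol.IsWienerProcess W 𝓕 P)
    (F : E → H) (hF : StochEvol.PolyLocallyLipschitz j F)
    (G : E → V) (hG : StochEvol.PolyLocallyLipschitz j G)
    (S : ℝ≥0 → H →L[ℝ] H) (hS : StochEvol.SemigroupAssumption j k S W 𝓕 P)
    (θ : ℝ → ℝ) (hθ : StochEvol.IsCutoff θ)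
    (u₀ : Ω → V) (hu₀ : StronglyMeasurable[𝓕 0] u₀) (hu₀' : MemLp u₀ 2 P) :
    -- the truncated equation at each level `n + 1` has a unique global solution
    (∀ n : ℕ, ∃ w : ℝ≥0 → Ω → V,
      StochEvol.IsTruncatedSolution θ (n + 1) j k S F G W 𝓕 P u₀ w ∧
      ∀ w' : ℝ≥0 → Ω → V, StochEvol.IsTruncatedSolution θ (n + 1) j k S F G W 𝓕 P u₀ w' →
        ∀ᵐ ω ∂P, ∀ t : ℝ≥0, w t ω = w' t ω) ∧
    ∀ un : ℕ → ℝ≥0 → Ω → V,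
      (∀ n : ℕ, StochEvol.IsTruncatedSolution θ (n + 1) j k S F G W 𝓕 P u₀ (un n)) →
      -- the truncation times increase, and there is a process on `[0, τ_∞)` that
      -- coincides with `un n` on `[0, τ_n)` for every `n`
      (∀ᵐ ω ∂P, Monotone (fun n : ℕ => StochEvol.exitTime j (n + 1 : ℝ≥0∞) (un n) ω)) ∧
      (∃ u : ℝ≥0 → Ω → V, ∀ n : ℕ,
        StochEvol.AgreeBefore P (StochEvol.exitTime j (n + 1 : ℝ≥0∞) (un n)) u (un n)) ∧
      -- every such process has the asserted properties
      ∀ u : ℝ≥0 → Ω → V,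
        (∀ n : ℕ,
          StochEvol.AgreeBefore P (StochEvol.exitTime j (n + 1 : ℝ≥0∞) (un n)) u (un n)) →
        StochEvol.IsMaximalLocalMildSolution j k S F G W 𝓕 P u₀ u (StochEvol.limitTime j un) ∧
        (∀ v σ, StochEvol.IsLocalMildSolution j k S F G W 𝓕 P u₀ v σ →
          StochEvol.AgreeBefore P (fun ω => min (StochEvol.limitTime j un ω) (σ ω)) u v) ∧
        (∀ v σ, StochEvol.IsMaximalLocalMildSolution j k S F G W 𝓕 P u₀ v σ →
          StochEvol.Equivalent P u (StochEvol.limitTime j un) v σ) ∧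
        P {ω | StochEvol.limitTime j un ω < ⊤ ∧
          (⨆ (t : ℝ≥0) (_ : (t : WithTop ℝ≥0) < StochEvol.limitTime j un ω), ‖u t ω‖ₑ) < ⊤} = 0 ∧
        ∀ᵐ ω ∂P, ∀ T : ℝ≥0, StochEvol.limitTime j un ω = (T : WithTop ℝ≥0) →
          limsup (fun t => ‖u t ω‖ₑ) (𝓝[<] T) = ⊤ := by

  have := UniformSpace.secondCountable_of_separable E
  have := UniformSpace.secondCountable_of_separable V
  have := UniformSpace.secondCountable_of_separable H
  have hu₀2 : ∫⁻ ω, ‖u₀ ω‖ₑ ^ 2 ∂P < ⊤ := by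
    rw [← StochEvol.eLpNorm_two_sq]
    exact ENNReal.pow_lt_top hu₀'.2
  refine ⟨fun n => ?_, fun un hun => ?_⟩
  · have hn : (0 : ℝ) < n + 1 := by positivity
    obtain ⟨w, hw, hwc, hwm⟩ :=
      StochEvol.exists_mildOn_trunc hj hk hW h𝓕 hS hF hG hθ hn hu₀ hu₀2
    have hreg : StochEvol.IsRegularSolution θ (n + 1) j k S F G W 𝓕 P u₀ w := ⟨hw, hwc, hwm⟩
    refine ⟨w, hreg.isTruncatedSolution hj hk hW h𝓕 hS hF hG hθ hn hu₀ hu₀2, fun w' hw' => ?_⟩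
    obtain ⟨v, hv, hv'⟩ := hw'.exists_regular hj h𝓕
    filter_upwards [hreg.ae_eq hj hk hW h𝓕 hS hF hG hθ hn hv, hv'] with ω h1 h2 t
    rw [h1, h2]
  choose U hU hUeq using fun n => (hun n).exists_regular hj h𝓕
  have hall : ∀ᵐ ω ∂P, ∀ n t, un n t ω = U n t ω := ae_all_iff.2 hUeq
  have hexit : ∀ᵐ ω ∂P, ∀ n : ℕ, StochEvol.exitTime j (n + 1 : ℝ≥0∞) (un n) ω =
      StochEvol.exitTime j (n + 1 : ℝ≥0∞) (U n) ω := by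
    filter_upwards [hall] with ω hω n using StochEvol.exitTime_congr (hω n)
  have hlim : ∀ᵐ ω ∂P, StochEvol.limitTime j U ω = StochEvol.limitTime j un ω := by
    filter_upwards [hexit] with ω hω
    simp only [StochEvol.limitTime, hω]
  have hcomp := StochEvol.ae_isCompatible hj hk hW h𝓕 hS hF hG hθ hU
  refine ⟨?_, ?_, fun u hu => ?_⟩
  · filter_upwards [hcomp, hexit] with ω h1 h2
    simp only [h2]
    exact h1.monotone
  · classical
    -- The first level not yet exited at time t is used; any other such level gives the same value.
    refine ⟨fun t ω => if h : ∃ n : ℕ, (t : WithTop ℝ≥0) <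
      StochEvol.exitTime j (n + 1 : ℝ≥0∞) (U n) ω then U (Nat.find h) t ω else 0, fun n => ?_⟩
    filter_upwards [hcomp, hexit, hall] with ω h1 h2 h3 t ht
    rw [h2] at ht
    have hex : ∃ n : ℕ, (t : WithTop ℝ≥0) < StochEvol.exitTime j (n + 1 : ℝ≥0∞) (U n) ω := ⟨n, ht⟩
    rw [dif_pos hex, h3]
    exact h1.eq_of_lt_of_lt (Nat.find_spec hex) ht
  have hu' : ∀ᵐ ω ∂P, ∀ n : ℕ, ∀ t : ℝ≥0,
      (t : WithTop ℝ≥0) < StochEvol.exitTime j (n + 1) (U n) ω → u t ω = U n t ω := by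
    filter_upwards [ae_all_iff.2 hu, hexit, hall] with ω h1 h2 h3 n t ht
    rw [← h3]
    exact h1 n t (by rwa [h2])
  have hloc := StochEvol.isLocalMildSolution_limit hj hk hW h𝓕 hS hF hG hθ hu₀ hu₀2 hU hlim hu'
  -- Every local mild solution precedes the limit. Both maximality of the limit and uniqueness of
  -- maximal solutions reduce to this.
  have huniq : ∀ v σ, StochEvol.IsLocalMildSolution j k S F G W 𝓕 P u₀ v σ →
      ∀ᵐ ω ∂P, σ ω ≤ StochEvol.limitTime j un ω ∧
        ∀ t : ℝ≥0, (t : WithTop ℝ≥0) < σ ω → u t ω = v t ω := by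
    intro v σ hv
    filter_upwards [hv.ae_lt_limitTime hj hk hW h𝓕 hS hF hG hθ hU, hlim, hu'] with ω h1 h2 h3
    refine ⟨le_of_forall_lt fun c hc => ?_, fun t ht => ?_⟩
    · lift c to ℝ≥0 using (lt_top_of_lt hc).ne
      obtain ⟨n, hn, -⟩ := h1 c hc
      rw [← h2]
      exact hn.trans_le (le_iSup (fun n : ℕ => StochEvol.exitTime j (n + 1) (U n) ω) n)
    · obtain ⟨n, hn, hn'⟩ := h1 t ht
      rw [h3 n t hn, hn']
  have hsup := StochEvol.ae_iSup_eq_top_of_limitTime_lt_top hj hk hW h𝓕 hS hF hG hθ hu₀ hu₀2 hU hu'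
  refine ⟨⟨hloc, fun v σ hv hprec => ⟨?_, hprec.2⟩⟩, fun v σ hv => ?_, fun v σ hv => ?_, ?_, ?_⟩
  · filter_upwards [hprec.1, huniq v σ hv] with ω h1 h2 using le_antisymm h1 h2.1
  · filter_upwards [huniq v σ hv] with ω h1 t ht
    exact h1.2 t (lt_min_iff.1 ht).2
  · have h1 := huniq v σ hv.1
    -- A maximal solution precedes the limit solution, so its own maximality makes the two
    -- equivalent.
    have h2 := hv.2 u (StochEvol.limitTime j un) hloc ⟨h1.mono fun ω h => h.1, by
      filter_upwards [h1] with ω h t ht using (h.2 t ht).symm⟩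
    refine ⟨h2.1.mono fun ω h => h.symm, ?_⟩
    filter_upwards [h2.1, h1] with ω h3 h4 t ht
    exact h4.2 t (by rwa [h3])
  · have h0 : ∀ᵐ ω ∂P, ¬ (StochEvol.limitTime j un ω < ⊤ ∧
        (⨆ (t : ℝ≥0) (_ : (t : WithTop ℝ≥0) < StochEvol.limitTime j un ω), ‖u t ω‖ₑ) < ⊤) := by
      filter_upwards [hsup, hlim] with ω h1 h2 h3
      rw [← h2] at h3
      exact h3.2.ne (h1 h3.1)
    simpa only [ae_iff, not_not] using h0
  · filter_upwards [hsup, hlim, hcomp, hu'] with ω h1 h2 h3 h4 T hT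
    rw [← h2] at hT
    exact h3.limsup_eq_top (u := fun t => u t ω) h4 hT
      (h1 (hT ▸ WithTop.coe_lt_top T))
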